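/- **Conventions.** A *(complex unit) gain graph* $\Psi=(G,\psi)$ is a finite simple graph $G$ with a map $\psi$ from its arcs to the complex unit circle $\mathbb T$ such that $\psi(vu)=\psi(uv)^{-1}$. Its *gain matrix* $A(\Psi)$ is the Hermitian matrix with $(u,v)$-entry $\psi(uv)$ if $uv$ is an arc and $0$ otherwise; the eigenvalues of $\Psi$ are those of $A(\Psi)$. Two gain graphs are *switching isomorphic* if the gain matrix of one arises from the gain matrix $A$ of the other by $A\mapsto S^{-1}AS$ with $S$ diagonal with diagonal entries in $\mathbb T$, possibly followed by inverting all gains and/or relabelling the vertices. They are *cospectral* if their characteristic polynomials coincide. A gain graph is connected or $k$-regular if $G$ is. Let $\varphi=e^{2\pi i/3}$, $\gamma=e^{2\pi i/8}$. Write $CM(c)$ for the cyclic matrix with first row $c$ (each further row is the previous one shifted one place to the right), $K_n$ for the complete graph with all gains $1$, $IG(B)$ for the gain graph with gain matrix $\begin{bmatrix}O&B\\B^*&O\end{bmatrix}$, and $ND(\Psi)$ for the one with gain matrix $\begin{bmatrix}A(\Psi)&I\\I&-A(\Psi)\end{bmatrix}$. Let $$W_2=\begin{bmatrix}1&1\\1&-1\end{bmatrix},\quad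 W_3=\begin{bmatrix}1&1&1\\1&\varphi&\varphi^2\\1&\varphi^2&\varphi\end{bmatrix},\quad W_5=CM(0,1,\varphi,\varphi,1),\quad W_7=CM(-1,1,1,0,1,0,0),$$ and let $W_4$ and $K_{2,2,2}^{(\gamma)}$ be the gain graphs with gain matrices $$\begin{bmatrix}0&1&1&1\\1&0&i&-i\\1&-i&0&i\\1&i&-i&0\end{bmatrix},\qquad \begin{bmatrix}0&0&-i&i&1&1\\0&0&1&1&-1&1\\i&1&0&0&-\bar\gamma&\gamma\\-i&1&0&0&-\gamma&\bar\gamma\\1&-1&-\gamma&-\bar\gamma&0&0\\1&1&\bar\gamma&\gamma&0&0\end{bmatrix}.$$ For $t\ge3$ and $x\in\mathbb T$ let $C$ be the $t\times t$ matrix with $C_{1,2}=C_{2,3}=\dots=C_{t-1,t}=1$, $C_{t,1}=x$ and all other entries $0$; the toral tessellation graph $T_{2t}^{(x)}$ has gain matrix $\begin{bmatrix}C+C^*&C-C^*\\C^*-C&-C-C^*\end{bmatrix}$. **Theorem.** (1) Let $\Psi$ be a connected gain graph with maximum degree at most $4$ that has exactly two distinct eigenvalues $\theta_1,\theta_2$,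 where $\theta_1+\theta_2\ge0$. Then $\Psi$ is switching isomorphic to one of $K_2$; $K_3$, $IG(W_2)$; $K_4$, $W_4$, $IG(W_3)$, $ND(IG(W_2))$; $K_5$, $K_{2,2,2}^{(\gamma)}$, $ND(W_4)$, $IG(W_5)$, $ND(IG(W_3))$, $IG(W_7)$, $ND(ND(IG(W_2)))$; or to $T_{2t}^{(x)}$ for some $t\ge3$ and $x\in\mathbb T$. (2) Each of these gain graphs is connected and regular of degree $k$, has order $n$, and has exactly two distinct eigenvalues; their sum is nonnegative and the larger one has multiplicity $m$, where $(k,n,m)$ is $K_2$: $(1,2,1)$; $K_3$: $(2,3,1)$; $IG(W_2)$: $(2,4,2)$; $K_4$: $(3,4,1)$; $W_4$: $(3,4,2)$; $IG(W_3)$: $(3,6,3)$; $ND(IG(W_2))$: $(3,8,4)$; $K_5$: $(4,5,1)$; $K_{2,2,2}^{(\gamma)}$: $(4,6,2)$; $ND(W_4)$: $(4,8,4)$; $IG(W_5)$: $(4,10,5)$; $ND(IG(W_3))$: $(4,12,6)$; $IG(W_7)$: $(4,14,7)$; $ND(ND(IG(W_2)))$: $(4,16,8)$; $T_{2t}^{(x)}$: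 $(4,2t,t)$. (3) If $\Psi_0$ is one of $K_2,K_3,IG(W_2),K_4,W_4,IG(W_3),ND(IG(W_2)),K_5,K_{2,2,2}^{(\gamma)}$, then every connected gain graph cospectral to $\Psi_0$ is switching isomorphic to $\Psi_0$. If $\Psi_0$ is one of $ND(W_4)$, $IG(W_5)$, $ND(IG(W_3))$, $IG(W_7)$, $ND(ND(IG(W_2)))$, of order $2t$, then every connected gain graph cospectral to $\Psi_0$ is switching isomorphic to $\Psi_0$ or to $T_{2t}^{(x)}$ for some $x\in\mathbb T$. -/

import Mathlib

open Complex Matrix Polynomial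

universe u v

/-- A (complex unit) gain graph on the vertex set `V`: a simple graph together with a map from its
arcs (ordered pairs of adjacent vertices) to the unit circle, such that reversing an arc inverts
its gain. -/
structure GainGraph (V : Type u) where
  graph : SimpleGraph V
  gain : graph.Dart → Circle
  gain_symm : ∀ e : graph.Dart, gain e.symm = (gain e)⁻¹

/-- Every entry of the matrix is zero or a complex number of modulus one. -/
def UnitEntries {V : Type u} {W : Type v} (A : Matrix V W ℂ) : Prop :=
  ∀ i j, A i j = 0 ∨ ‖A i j‖ = 1

namespace GainGraph

/-- A complex number of modulus one as a point of the unit circle. -/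
def toCircle (z : ℂ) (hz : ‖z‖ = 1) : Circle := ⟨z, mem_sphere_zero_iff_norm.2 hz⟩

@[simp]
theorem coe_toCircle (z : ℂ) (hz : ‖z‖ = 1) : (toCircle z hz : ℂ) = z := rfl

theorem circle_eq_inv {z w : ℂ} (hz : ‖z‖ = 1) (hw : ‖w‖ = 1) (h : star z = w) :
    toCircle w hw = (toCircle z hz)⁻¹ := by
  apply Circle.ext
  rw [Circle.coe_inv_eq_conj, coe_toCircle, coe_toCircle]
  exact h.symm

section Basic

variable {V : Type u} {W : Type v}

open Classical in
/-- The gain matrix: the entry at `(u, v)` is the gain of the arc `uv`, and `0` if there is no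
such arc. -/
noncomputable def gainMatrix (Ψ : GainGraph V) : Matrix V V ℂ :=
  Matrix.of fun u v => if h : Ψ.graph.Adj u v then (Ψ.gain ⟨(u, v), h⟩ : ℂ) else 0

/-- The gain graph with a prescribed gain matrix `A`, where `A` is Hermitian with zero diagonal and
all its nonzero entries have modulus one. -/
noncomputable def ofMatrix (A : Matrix V V ℂ) (hA : A.IsHermitian) (h0 : ∀ i, A i i = 0)
    (h1 : UnitEntries A) : GainGraph V where
  graph :=
    { Adj := fun u v => A u v ≠ 0
      symm := ⟨fun u v h h' => h (by rw [← hA.apply u v, h', star_zero])⟩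
      loopless := ⟨fun u h => h (h0 u)⟩ }
  gain e := toCircle (A e.fst e.snd) ((h1 _ _).resolve_left e.adj)
  gain_symm e := circle_eq_inv _ _ (hA.apply e.snd e.fst)

/-- The gain matrix of `ofMatrix A` is indeed `A`. -/
theorem gainMatrix_ofMatrix (A : Matrix V V ℂ) (hA : A.IsHermitian) (h0 : ∀ i, A i i = 0)
    (h1 : UnitEntries A) : (ofMatrix A hA h0 h1).gainMatrix = A := by
  ext u v
  by_cases h : A u v = 0
  · simp [gainMatrix, ofMatrix, h]
  · simp [gainMatrix, ofMatrix, h]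

theorem gainMatrix_isHermitian (Ψ : GainGraph V) : Ψ.gainMatrix.IsHermitian := by
  ext u v
  by_cases h : Ψ.graph.Adj u v
  · have h' : Ψ.graph.Adj v u := h.symm
    have := Ψ.gain_symm ⟨(u, v), h⟩
    have e : (⟨(u, v), h⟩ : Ψ.graph.Dart).symm = ⟨(v, u), h'⟩ := rfl
    rw [e] at this
    simp [gainMatrix, h, h', this, ← Circle.coe_inv_eq_conj]
  · have h' : ¬ Ψ.graph.Adj v u := fun h' => h h'.symm
    simp [gainMatrix, h, h']

theorem gainMatrix_diag (Ψ : GainGraph V) (i : V) : Ψ.gainMatrix i i = 0 := by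
  simp [gainMatrix]

theorem gainMatrix_unitEntries (Ψ : GainGraph V) : UnitEntries Ψ.gainMatrix := by
  intro u v
  by_cases h : Ψ.graph.Adj u v
  · right; simpa [gainMatrix, h] using Circle.norm_coe _
  · left; simp [gainMatrix, h]

/-- The characteristic polynomial of a gain graph. -/
noncomputable def charpoly [Fintype V] [DecidableEq V] (Ψ : GainGraph V) : ℂ[X] :=
  Ψ.gainMatrix.charpoly

/-- The set of distinct eigenvalues of a gain graph. -/
def eigenvalues [Fintype V] [DecidableEq V] (Ψ : GainGraph V) : Set ℂ :=
  {z | Ψ.charpoly.IsRoot z}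

/-- Two gain graphs are switching isomorphic if the gain matrix of the second is obtained from the
gain matrix `A` of the first by a diagonal switching `A ↦ S⁻¹ A S` (`S` diagonal with diagonal
entries on the unit circle), possibly followed by taking the converse (inverting all gains), and
relabelling the vertices. -/
def SwitchingIsomorphic [Fintype V] [DecidableEq V] (Ψ : GainGraph V) (Φ : GainGraph W) : Prop :=
  ∃ (s : V → Circle) (σ : V ≃ W),
    let B : Matrix V V ℂ := Matrix.diagonal (fun v => ((s v)⁻¹ : ℂ)) * Ψ.gainMatrix *
      Matrix.diagonal (fun v => (s v : ℂ))
    Φ.gainMatrix.submatrix σ σ = B ∨ Φ.gainMatrix.submatrix σ σ = B.map (fun z => z⁻¹)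

/-- `Ψ` is connected, `k`-regular, of order `n`, and its eigenvalues are `θ₁` with multiplicity `m`
and `θ₂` with multiplicity `n - m`, where `θ₁ > θ₂` and `θ₁ + θ₂ ≥ 0`. -/
def HasParameters [Fintype V] [DecidableEq V] (Ψ : GainGraph V) (k n m : ℕ) : Prop :=
  Ψ.graph.Connected ∧ (∀ v, (Ψ.graph.neighborSet v).ncard = k) ∧ Fintype.card V = n ∧
    0 < m ∧ m < n ∧
    ∃ θ₁ θ₂ : ℝ, θ₂ < θ₁ ∧ 0 ≤ θ₁ + θ₂ ∧
      Ψ.charpoly = (X - C (θ₁ : ℂ)) ^ m * (X - C (θ₂ : ℂ)) ^ (n - m)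

/-- Every connected gain graph cospectral to `Ψ` is switching isomorphic to `Ψ`. -/
def DeterminedBySpectrum [Fintype W] [DecidableEq W] (Ψ : GainGraph W) : Prop :=
  ∀ (U : Type u) [Fintype U] [DecidableEq U] (Φ : GainGraph U),
    Φ.graph.Connected → Φ.charpoly = Ψ.charpoly → Φ.SwitchingIsomorphic Ψ

end Basic

section Constructions

/-- The complete graph on `n` vertices, all gains being `1`. -/
noncomputable def complete (n : ℕ) : GainGraph (Fin n) where
  graph := ⊤
  gain _ := 1
  gain_symm _ := by simp

theorem gainMatrix_complete (n : ℕ) :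
    (complete n).gainMatrix = Matrix.of fun i j => if i = j then 0 else 1 := by
  ext i j
  by_cases h : i = j <;> simp [gainMatrix, complete, h]

variable {V : Type u} {W : Type v}

/-- The bipartite gain graph `IG(B)` of a matrix `B`, with gain matrix `[[O, B], [B*, O]]`. -/
noncomputable def IG (B : Matrix V W ℂ) (hB : UnitEntries B) : GainGraph (V ⊕ W) :=
  ofMatrix (Matrix.fromBlocks 0 B Bᴴ 0)
    (by simp [Matrix.IsHermitian, Matrix.fromBlocks_conjTranspose])
    (by rintro (i | i) <;> simp)
    (by
      rintro (i | i) (j | j)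
      · simp
      · simpa using hB i j
      · simpa using hB j i
      · simp)

theorem gainMatrix_IG (B : Matrix V W ℂ) (hB : UnitEntries B) :
    (IG B hB).gainMatrix = Matrix.fromBlocks 0 B Bᴴ 0 :=
  gainMatrix_ofMatrix _ _ _ _

/-- The negative double `ND(Ψ)`, with gain matrix `[[A, I], [I, -A]]`, where `A` is the gain matrix
of `Ψ`. -/
noncomputable def ND [DecidableEq V] (Ψ : GainGraph V) : GainGraph (V ⊕ V) :=
  ofMatrix (Matrix.fromBlocks Ψ.gainMatrix 1 1 (-Ψ.gainMatrix))
    (by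
      have h : Ψ.gainMatrixᴴ = Ψ.gainMatrix := Ψ.gainMatrix_isHermitian
      simp [Matrix.IsHermitian, Matrix.fromBlocks_conjTranspose, h])
    (by rintro (i | i) <;> simp [gainMatrix_diag])
    (by
      rintro (i | i) (j | j)
      · simpa using Ψ.gainMatrix_unitEntries i j
      · by_cases h : i = j <;> simp [h]
      · by_cases h : i = j <;> simp [h]
      · simpa using Ψ.gainMatrix_unitEntries i j)

theorem gainMatrix_ND [DecidableEq V] (Ψ : GainGraph V) :
    Ψ.ND.gainMatrix = Matrix.fromBlocks Ψ.gainMatrix 1 1 (-Ψ.gainMatrix) :=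
  gainMatrix_ofMatrix _ _ _ _

/-- The cyclic `n × n` matrix with first row `c`. -/
def cyclicMatrix {n : ℕ} (c : Fin n → ℂ) : Matrix (Fin n) (Fin n) ℂ :=
  Matrix.of fun i j => c (j - i)

/-- The primitive third root of unity `exp(2πi/3)`. -/
noncomputable def φ : ℂ := Complex.exp ((2 * Real.pi / 3 : ℝ) * I)

/-- The primitive eighth root of unity `exp(2πi/8)`. -/
noncomputable def γ : ℂ := Complex.exp ((2 * Real.pi / 8 : ℝ) * I)

theorem norm_φ : ‖φ‖ = 1 := Complex.norm_exp_ofReal_mul_I _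

theorem norm_γ : ‖γ‖ = 1 := Complex.norm_exp_ofReal_mul_I _

def W₂ : Matrix (Fin 2) (Fin 2) ℂ := !![1, 1; 1, -1]

theorem unitEntries_W₂ : UnitEntries W₂ := by
  intro i j; fin_cases i <;> fin_cases j <;> simp [W₂]

noncomputable def W₃ : Matrix (Fin 3) (Fin 3) ℂ := !![1, 1, 1; 1, φ, φ ^ 2; 1, φ ^ 2, φ]

theorem unitEntries_W₃ : UnitEntries W₃ := by
  intro i j; fin_cases i <;> fin_cases j <;> simp [W₃, norm_φ]

noncomputable def W₅ : Matrix (Fin 5) (Fin 5) ℂ := cyclicMatrix ![0, 1, φ, φ, 1]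

theorem unitEntries_W₅ : UnitEntries W₅ := by
  intro i j
  have h : ∀ k : Fin 5, ![0, 1, φ, φ, 1] k = 0 ∨ ‖![0, 1, φ, φ, 1] k‖ = 1 := by
    intro k; fin_cases k <;> simp [norm_φ]
  exact h (j - i)

def W₇ : Matrix (Fin 7) (Fin 7) ℂ := cyclicMatrix ![-1, 1, 1, 0, 1, 0, 0]

theorem unitEntries_W₇ : UnitEntries W₇ := by
  intro i j
  have h : ∀ k : Fin 7, (![-1, 1, 1, 0, 1, 0, 0] : Fin 7 → ℂ) k = 0 ∨
      ‖(![-1, 1, 1, 0, 1, 0, 0] : Fin 7 → ℂ) k‖ = 1 := by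
    intro k; fin_cases k <;> simp
  exact h (j - i)

/-- The gain graph `W_4` on four vertices. -/
noncomputable def W₄ : GainGraph (Fin 4) :=
  ofMatrix !![0, 1, 1, 1; 1, 0, I, -I; 1, -I, 0, I; 1, I, -I, 0]
    (by ext i j; fin_cases i <;> fin_cases j <;> simp)
    (by intro i; fin_cases i <;> simp)
    (by intro i j; fin_cases i <;> fin_cases j <;> simp)

theorem gainMatrix_W₄ :
    W₄.gainMatrix = !![0, 1, 1, 1; 1, 0, I, -I; 1, -I, 0, I; 1, I, -I, 0] :=
  gainMatrix_ofMatrix _ _ _ _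

/-- The gain graph `K_{2,2,2}^{(γ)}`. -/
noncomputable def K₂₂₂γ : GainGraph (Fin 6) :=
  ofMatrix
    !![0, 0, -I, I, 1, 1;
       0, 0, 1, 1, -1, 1;
       I, 1, 0, 0, -star γ, γ;
       -I, 1, 0, 0, -γ, star γ;
       1, -1, -γ, -star γ, 0, 0;
       1, 1, star γ, γ, 0, 0]
    (by ext i j; fin_cases i <;> fin_cases j <;> simp)
    (by intro i; fin_cases i <;> simp)
    (by intro i j; fin_cases i <;> fin_cases j <;> simp [norm_γ])

theorem gainMatrix_K₂₂₂γ :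
    K₂₂₂γ.gainMatrix =
      !![0, 0, -I, I, 1, 1;
         0, 0, 1, 1, -1, 1;
         I, 1, 0, 0, -star γ, γ;
         -I, 1, 0, 0, -γ, star γ;
         1, -1, -γ, -star γ, 0, 0;
         1, 1, star γ, γ, 0, 0] :=
  gainMatrix_ofMatrix _ _ _ _

/-- The weighted `t × t` cyclic shift: `C_{1,2} = C_{2,3} = ⋯ = C_{t-1,t} = 1`, `C_{t,1} = x`, and
all other entries are zero. -/
noncomputable def shiftMatrix (t : ℕ) (x : Circle) : Matrix (Fin t) (Fin t) ℂ :=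
  Matrix.of fun i j =>
    if i.val + 1 = j.val then 1 else if i.val + 1 = t ∧ j.val = 0 then (x : ℂ) else 0

theorem shiftMatrix_entry (t : ℕ) (ht : 3 ≤ t) (x : Circle) (i j : Fin t) :
    (shiftMatrix t x i j = 0 ∨ ‖shiftMatrix t x i j‖ = 1) ∧
      (shiftMatrix t x i j = 0 ∨ shiftMatrix t x j i = 0) := by
  have hi := i.isLt
  have hj := j.isLt
  constructor
  · simp only [shiftMatrix, Matrix.of_apply]
    split_ifs
    · simp
    · exact Or.inr (Circle.norm_coe x)
    · simp
  · simp only [shiftMatrix, Matrix.of_apply]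
    split_ifs <;> first | omega | simp

/-- The toral tessellation graph `T_{2t}^{(x)}`, with gain matrix
`[[C + C*, C - C*], [C* - C, -C - C*]]`, where `C` is the weighted cyclic shift. -/
noncomputable def toral (t : ℕ) (ht : 3 ≤ t) (x : Circle) : GainGraph (Fin t ⊕ Fin t) :=
  ofMatrix
    (Matrix.fromBlocks
      (shiftMatrix t x + (shiftMatrix t x)ᴴ) (shiftMatrix t x - (shiftMatrix t x)ᴴ)
      ((shiftMatrix t x)ᴴ - shiftMatrix t x) (-shiftMatrix t x - (shiftMatrix t x)ᴴ))
    (by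
      simp only [Matrix.IsHermitian, Matrix.fromBlocks_conjTranspose,
        Matrix.conjTranspose_add, Matrix.conjTranspose_sub, Matrix.conjTranspose_neg,
        Matrix.conjTranspose_conjTranspose]
      congr 1 <;> abel)
    (by
      rintro (i | i) <;> rcases (shiftMatrix_entry t ht x i i).2 with h | h <;> simp [h])
    (by
      rintro (i | i) (j | j) <;>
      rcases (shiftMatrix_entry t ht x i j).2 with h | h <;>
      rcases (shiftMatrix_entry t ht x i j).1 with h1 | h1 <;>
      rcases (shiftMatrix_entry t ht x j i).1 with h2 | h2 <;>
      simp_all)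

theorem gainMatrix_toral (t : ℕ) (ht : 3 ≤ t) (x : Circle) :
    (toral t ht x).gainMatrix = Matrix.fromBlocks
      (shiftMatrix t x + (shiftMatrix t x)ᴴ) (shiftMatrix t x - (shiftMatrix t x)ᴴ)
      ((shiftMatrix t x)ᴴ - shiftMatrix t x) (-shiftMatrix t x - (shiftMatrix t x)ᴴ) :=
  gainMatrix_ofMatrix _ _ _ _

end Constructions

/-- Every connected gain graph cospectral to `Ψ` is switching isomorphic to `Ψ` or to some toral
tessellation graph `T_{2t}^{(x)}`. -/
def DeterminedBySpectrumUpToToral {W : Type v} [Fintype W] [DecidableEq W] (Ψ : GainGraph W)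
    (t : ℕ) (ht : 3 ≤ t) : Prop :=
  ∀ (U : Type u) [Fintype U] [DecidableEq U] (Φ : GainGraph U),
    Φ.graph.Connected → Φ.charpoly = Ψ.charpoly →
      Φ.SwitchingIsomorphic Ψ ∨ ∃ x : Circle, Φ.SwitchingIsomorphic (toral t ht x)

end GainGraph

-- A Hermitian matrix has exactly two eigenvalues only if it satisfies `A² = aA + kI`, where `a` is
-- their sum and `-k` their product. This equation is packaged in `Quadratic`. Its diagonal says
-- that the graph is `k`-regular, so `k ≤ 4`. Off the diagonal, the gains of the walks of length two
-- from `u` to `v` sum to `a` times the entry at `(u, v)`. These summands are complex units, and few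
-- units rarely have a prescribed sum. When the right side is zero, a single summand is impossible,
-- two are opposite, three are proportional to the cube roots of unity, and four form two opposite
-- pairs. When `a ≠ 0`, every edge lies in a triangle. Such local facts determine a family of
-- vertices closed under adjacency, which is everything by connectedness (`Quadratic.exists_equiv`).
-- The gains are then compared with the model by an explicit switching.
--
-- Degrees one to three need only these remarks. Several graphs with `a = 0` split into two halves
-- joined by a perfect matching. Orthogonality of rows makes such a graph the negative double of one
-- half, which has degree one less (`Quadratic.exists_ndMatrix`), so these cases reduce to a lower
-- degree.
--
-- Degree four with `a = 0` splits by how many neighbours two vertices may share. Two vertices with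
-- equal neighbourhoods force a `2 × 2` block of rank one (`Quadratic.exists_link`). Such a block
-- reproduces itself along a chain of pairs (`Quadratic.link_step`), and finiteness closes the chain
-- into a toral tessellation graph (`TwinChain.mswitch_toral`). Without such twins, a triple of
-- common neighbours leads to one of two incidence structures (`Quadratic.triple_structure`), that
-- of `W₅` or two copies of `K_{3,3}` joined by a matching. If at most two neighbours are ever
-- shared, a triangle yields two copies of `K₄` joined by a matching. A triangle-free graph is a
-- semibiplane, either the complement of the Fano plane or the four-dimensional cube
-- (`Quadratic.semibiplane_structure`).
--
-- Degree four with `a > 0` splits by the number of triangles on an edge. Three triangles give `K₅`.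
-- An edge in exactly one triangle forces `a = 1` and spreads through the graph, where signs on a
-- prism give a contradiction. Two triangles on every edge give an octahedron with `a² = 2`.
--
-- Conversely, each listed graph is shown to satisfy its quadratic equation, and its multiplicities
-- follow because the trace is zero. A cospectral connected graph satisfies the same equation and
-- has the same order (`Quadratic.of_charpoly_eq`), so the classification can be applied to it.
-- Order, degree and `a` then single out the graph, up to the toral family, which shares its orders
-- with the sporadic graphs of degree four and `a = 0`.

universe w

namespace GainGraph

/-! ### Gain matrices with a quadratic equation, neighbour lists, and switching of matrices. -/

section Quadratic

variable {V : Type u} {W : Type v} {X : Type w}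

/-- Two indices are adjacent if the corresponding matrix entry is nonzero. -/
def Adj (A : Matrix V V ℂ) (u v : V) : Prop := A u v ≠ 0

/-- The gain matrix of a connected gain graph satisfying `A² = a A + k I`. -/
structure Quadratic [Fintype V] [DecidableEq V] (A : Matrix V V ℂ) (a : ℝ) (k : ℕ) : Prop where
  herm : ∀ u v, A v u = star (A u v)
  diag : ∀ u, A u u = 0
  unit : UnitEntries A
  sq : ∀ u v, ∑ w, A u w * A w v = a * A u v + if u = v then (k : ℂ) else 0
  conn : ∀ S : Set V, S.Nonempty → (∀ u ∈ S, ∀ v, Adj A u v → v ∈ S) → ∀ v, v ∈ S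

/-- The neighbours of `u` are the members of the list `l`, without repetition. -/
def NbList (A : Matrix V V ℂ) (u : V) (l : List V) : Prop :=
  l.Nodup ∧ ∀ v, Adj A u v ↔ v ∈ l

/-- The neighbours of `u` are the distinct vertices `p` and `q`. -/
def Nb2 (A : Matrix V V ℂ) (u p q : V) : Prop :=
  p ≠ q ∧ ∀ v, Adj A u v ↔ v = p ∨ v = q

/-- The neighbours of `u` are the distinct vertices `p`, `q` and `r`. -/
def Nb3 (A : Matrix V V ℂ) (u p q r : V) : Prop :=
  (p ≠ q ∧ p ≠ r ∧ q ≠ r) ∧ ∀ v, Adj A u v ↔ v = p ∨ v = q ∨ v = r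

/-- The neighbours of `u` are the distinct vertices `p`, `q`, `r` and `s`. -/
def Nb4 (A : Matrix V V ℂ) (u p q r s : V) : Prop :=
  (p ≠ q ∧ p ≠ r ∧ p ≠ s ∧ q ≠ r ∧ q ≠ s ∧ r ≠ s) ∧
    ∀ v, Adj A u v ↔ v = p ∨ v = q ∨ v = r ∨ v = s

theorem nbList_two {A : Matrix V V ℂ} {u p q : V} : NbList A u [p, q] ↔ Nb2 A u p q := by
  simp [NbList, Nb2]

theorem nbList_three {A : Matrix V V ℂ} {u p q r : V} :
    NbList A u [p, q, r] ↔ Nb3 A u p q r := by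
  simp [NbList, Nb3, and_assoc]

theorem nbList_four {A : Matrix V V ℂ} {u p q r s : V} :
    NbList A u [p, q, r, s] ↔ Nb4 A u p q r s := by
  simp [NbList, Nb4, and_assoc]

theorem Nb3.swap23 {A : Matrix V V ℂ} {u p q r : V} (h : Nb3 A u p q r) : Nb3 A u p r q := by
  unfold Nb3 at *; grind

theorem Nb4.swap12 {A : Matrix V V ℂ} {u p q r s : V} (h : Nb4 A u p q r s) :
    Nb4 A u q p r s := by
  unfold Nb4 at *; grind

theorem Nb4.swap23 {A : Matrix V V ℂ} {u p q r s : V} (h : Nb4 A u p q r s) :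
    Nb4 A u p r q s := by
  unfold Nb4 at *; grind

theorem Nb4.swap34 {A : Matrix V V ℂ} {u p q r s : V} (h : Nb4 A u p q r s) :
    Nb4 A u p q s r := by
  unfold Nb4 at *; grind

theorem eq_zero_of_not_adj {A : Matrix V V ℂ} {u v : V} (huv : ¬ Adj A u v) : A u v = 0 :=
  not_not.1 huv

namespace Quadratic

variable [Fintype V] [DecidableEq V] {A : Matrix V V ℂ} {a : ℝ} {k : ℕ}

theorem norm_eq_one (h : Quadratic A a k) {u v : V} (huv : Adj A u v) : ‖A u v‖ = 1 :=
  (h.unit u v).resolve_left huv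

theorem symm (h : Quadratic A a k) {u v : V} (huv : Adj A u v) : Adj A v u := by
  unfold Adj at *
  rw [h.herm u v]
  simpa using huv

theorem ne (h : Quadratic A a k) {u v : V} (huv : Adj A u v) : u ≠ v := by
  rintro rfl
  exact huv (h.diag u)

theorem adj_comm (h : Quadratic A a k) (u v : V) : Adj A u v ↔ Adj A v u := ⟨h.symm, h.symm⟩

theorem not_adj_self (h : Quadratic A a k) (u : V) : ¬ Adj A u u := fun h' => h.ne h' rfl

theorem mul_swap (h : Quadratic A a k) {u v : V} (huv : Adj A u v) : A u v * A v u = 1 := by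
  rw [h.herm u v, star_def, mul_conj, normSq_eq_norm_sq, h.norm_eq_one huv]
  simp

/-- Each neighbour contributes a gain times its inverse to the diagonal entry of the square, so that
entry counts neighbours. -/
theorem nbList_length (h : Quadratic A a k) {u : V} {l : List V} (hl : NbList A u l) :
    l.length = k := by
  have h1 := h.sq u u
  have h2 : ∀ w, A u w * A w u = if w ∈ l.toFinset then 1 else 0 := by
    intro w
    split_ifs with hw
    · exact h.mul_swap ((hl.2 w).2 (by simpa using hw))
    · have : ¬ Adj A u w := fun h' => hw (by simpa using (hl.2 w).1 h')
      rw [eq_zero_of_not_adj this, zero_mul]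
  simp only [h2, h.diag] at h1
  rw [Finset.sum_ite_mem, Finset.univ_inter, Finset.sum_const,
    List.toFinset_card_of_nodup hl.1] at h1
  simp only [nsmul_eq_mul, mul_one, mul_zero, if_true, zero_add] at h1
  exact_mod_cast h1

/-- This is the source of all lemmas that name the remaining neighbours once some are known. The
length equation lets the case distinctions on `m` end. -/
theorem exists_nbList (h : Quadratic A a k) (u : V) (l : List V) (hl : l.Nodup)
    (hu : ∀ v ∈ l, Adj A u v) : ∃ m : List V, l.length + m.length = k ∧ NbList A u (l ++ m) := by
  classical
  have hnb : NbList A u (l ++ (Finset.univ.filter fun v => Adj A u v ∧ v ∉ l).toList) := by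
    refine ⟨?_, ?_⟩
    · rw [List.nodup_append]
      refine ⟨hl, Finset.nodup_toList _, ?_⟩
      intro x hx y hy hxy
      simp only [Finset.mem_toList, Finset.mem_filter] at hy
      exact hy.2.2 (hxy ▸ hx)
    · intro v
      simp only [List.mem_append, Finset.mem_toList, Finset.mem_filter, Finset.mem_univ, true_and]
      have := hu v
      tauto
  exact ⟨_, by simpa using h.nbList_length hnb, hnb⟩

theorem sum_eq (h : Quadratic A a k) {u : V} {l : List V} (hl : NbList A u l) (v : V) :
    (l.map fun w => A u w * A w v).sum = a * A u v + if u = v then (k : ℂ) else 0 := by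
  rw [← h.sq u v, ← List.sum_toFinset _ hl.1]
  refine Finset.sum_subset (Finset.subset_univ _) ?_
  intro w _ hw
  have : ¬ Adj A u w := fun h' => hw (by simpa using (hl.2 w).1 h')
  rw [eq_zero_of_not_adj this, zero_mul]

theorem sum2 (h : Quadratic A a k) {u v p q : V} (hu : Nb2 A u p q) (huv : u ≠ v) :
    A u p * A p v + A u q * A q v = a * A u v := by
  simpa [huv] using h.sum_eq (nbList_two.2 hu) v

theorem sum3 (h : Quadratic A a k) {u v p q r : V} (hu : Nb3 A u p q r) (huv : u ≠ v) :
    A u p * A p v + A u q * A q v + A u r * A r v = a * A u v := by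
  simpa [huv, add_assoc] using h.sum_eq (nbList_three.2 hu) v

theorem sum4 (h : Quadratic A a k) {u v p q r s : V} (hu : Nb4 A u p q r s) (huv : u ≠ v) :
    A u p * A p v + A u q * A q v + A u r * A r v + A u s * A s v = a * A u v := by
  simpa [huv, add_assoc] using h.sum_eq (nbList_four.2 hu) v

/-- Two vertices whose rows are orthogonal cannot have exactly one common neighbour. -/
theorem exists_other (h : Quadratic A a k) {u v p : V} (huv : u ≠ v) (h0 : a * A u v = 0)
    (hp : Adj A u p) (hv : Adj A v p) : ∃ q, q ≠ p ∧ Adj A u q ∧ Adj A v q := by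
  by_contra! hcon
  have h1 := h.sq u v
  rw [Finset.sum_eq_single p, h0, if_neg huv, add_zero] at h1
  · exact mul_ne_zero hp (h.symm hv) h1
  · intro q _ hq
    by_cases hq' : Adj A u q
    · rw [eq_zero_of_not_adj fun h' => hcon q hq hq' (h.symm h'), mul_zero]
    · rw [eq_zero_of_not_adj hq', zero_mul]
  · simp

/-- If the eigenvalues do not sum to zero then every edge is in a triangle. -/
theorem exists_triangle (h : Quadratic A a k) (ha : a ≠ 0) {u v : V} (huv : Adj A u v) :
    ∃ q, Adj A u q ∧ Adj A v q := by
  by_contra! hcon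
  have h1 := h.sq u v
  rw [Finset.sum_eq_zero, if_neg (h.ne huv), add_zero] at h1
  · exact mul_ne_zero (by exact_mod_cast ha) huv h1.symm
  · intro q _
    by_cases hq' : Adj A u q
    · rw [eq_zero_of_not_adj fun h' => hcon q hq' (h.symm h'), mul_zero]
    · rw [eq_zero_of_not_adj hq', zero_mul]

theorem exists_nb2 (h : Quadratic A a 2) {u p : V} (hp : Adj A u p) : ∃ q, Nb2 A u p q := by
  obtain ⟨m, hm, hl⟩ := h.exists_nbList u [p] (by simp) (by simpa using hp)
  rcases m with _ | ⟨q, _ | ⟨r, m⟩⟩ <;> simp at hm <;> try omega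
  exact ⟨q, nbList_two.1 hl⟩

theorem exists_nb3 (h : Quadratic A a 3) {u p : V} (hp : Adj A u p) :
    ∃ q r, Nb3 A u p q r := by
  obtain ⟨m, hm, hl⟩ := h.exists_nbList u [p] (by simp) (by simpa using hp)
  rcases m with _ | ⟨q, _ | ⟨r, _ | ⟨s, m⟩⟩⟩ <;> simp at hm <;> try omega
  exact ⟨q, r, nbList_three.1 hl⟩

theorem exists_nb3_of_two (h : Quadratic A a 3) {u p q : V} (hpq : p ≠ q) (hp : Adj A u p)
    (hq : Adj A u q) : ∃ r, Nb3 A u p q r := by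
  obtain ⟨m, hm, hl⟩ := h.exists_nbList u [p, q] (by simp [hpq]) (by simp [hp, hq])
  rcases m with _ | ⟨r, _ | ⟨s, m⟩⟩ <;> simp at hm <;> try omega
  exact ⟨r, nbList_three.1 hl⟩

theorem nb3_of_three (h : Quadratic A a 3) {u p q r : V} (hd : p ≠ q ∧ p ≠ r ∧ q ≠ r)
    (hp : Adj A u p) (hq : Adj A u q) (hr : Adj A u r) : Nb3 A u p q r := by
  obtain ⟨m, hm, hl⟩ := h.exists_nbList u [p, q, r] (by simp [hd]) (by simp [hp, hq, hr])
  rcases m with _ | ⟨s, m⟩ <;> simp at hm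
  exact nbList_three.1 hl

theorem exists_nb4 (h : Quadratic A a 4) {u p : V} (hp : Adj A u p) :
    ∃ q r s, Nb4 A u p q r s := by
  obtain ⟨m, hm, hl⟩ := h.exists_nbList u [p] (by simp) (by simpa using hp)
  rcases m with _ | ⟨q, _ | ⟨r, _ | ⟨s, _ | ⟨t, m⟩⟩⟩⟩ <;> simp at hm <;> try omega
  exact ⟨q, r, s, nbList_four.1 hl⟩

theorem exists_nb4_of_two (h : Quadratic A a 4) {u p q : V} (hpq : p ≠ q) (hp : Adj A u p)
    (hq : Adj A u q) : ∃ r s, Nb4 A u p q r s := by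
  obtain ⟨m, hm, hl⟩ := h.exists_nbList u [p, q] (by simp [hpq]) (by simp [hp, hq])
  rcases m with _ | ⟨r, _ | ⟨s, _ | ⟨t, m⟩⟩⟩ <;> simp at hm <;> try omega
  exact ⟨r, s, nbList_four.1 hl⟩

theorem exists_nb4_of_three (h : Quadratic A a 4) {u p q r : V} (hd : p ≠ q ∧ p ≠ r ∧ q ≠ r)
    (hp : Adj A u p) (hq : Adj A u q) (hr : Adj A u r) : ∃ s, Nb4 A u p q r s := by
  obtain ⟨m, hm, hl⟩ := h.exists_nbList u [p, q, r] (by simp [hd]) (by simp [hp, hq, hr])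
  rcases m with _ | ⟨s, _ | ⟨t, m⟩⟩ <;> simp at hm <;> try omega
  exact ⟨s, nbList_four.1 hl⟩

theorem nb4_of_four (h : Quadratic A a 4) {u p q r s : V}
    (hd : p ≠ q ∧ p ≠ r ∧ p ≠ s ∧ q ≠ r ∧ q ≠ s ∧ r ≠ s)
    (hp : Adj A u p) (hq : Adj A u q) (hr : Adj A u r) (hs : Adj A u s) : Nb4 A u p q r s := by
  obtain ⟨m, hm, hl⟩ := h.exists_nbList u [p, q, r, s] (by simp [hd]) (by simp [hp, hq, hr, hs])
  rcases m with _ | ⟨t, m⟩ <;> simp at hm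
  exact nbList_four.1 hl

theorem exists_adj (h : Quadratic A a k) (hk : k ≠ 0) (u : V) : ∃ p, Adj A u p := by
  obtain ⟨m, hm, hl⟩ := h.exists_nbList u [] (by simp) (by simp)
  rcases m with _ | ⟨p, m⟩
  · simp at hm; omega
  · exact ⟨p, (hl.2 p).2 (by simp)⟩

end Quadratic

/-- Switching isomorphism of matrices, with the switching function placed on the second index
type. -/
def MSwitch (A : Matrix V V ℂ) (B : Matrix W W ℂ) : Prop :=
  ∃ (σ : W ≃ V) (s : W → ℂ), (∀ i, ‖s i‖ = 1) ∧
    ((∀ i j, A (σ i) (σ j) * s j = s i * B i j) ∨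
      ∀ i j, A (σ i) (σ j) * s j = s i * star (B i j))

theorem mul_star_of_norm {z : ℂ} (hz : ‖z‖ = 1) : z * star z = 1 := by
  rw [star_def, mul_conj, normSq_eq_norm_sq, hz]; simp

theorem star_mul_of_norm {z : ℂ} (hz : ‖z‖ = 1) : star z * z = 1 := by
  rw [mul_comm, mul_star_of_norm hz]

theorem ne_zero_of_norm {z : ℂ} (hz : ‖z‖ = 1) : z ≠ 0 := by
  rintro rfl; simp at hz

theorem norm_star_of_norm {z : ℂ} (hz : ‖z‖ = 1) : ‖star z‖ = 1 := by
  rwa [norm_star]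

theorem inv_eq_star_of_norm {z : ℂ} (hz : ‖z‖ = 1) : z⁻¹ = star z :=
  inv_eq_of_mul_eq_one_right (mul_star_of_norm hz)

/-- Switching functions multiply and conjugations cancel in pairs. -/
theorem MSwitch.trans {A : Matrix V V ℂ} {B : Matrix W W ℂ} {C : Matrix X X ℂ}
    (h1 : MSwitch A B) (h2 : MSwitch B C) : MSwitch A C := by
  obtain ⟨σ, s, hs, h1⟩ := h1
  obtain ⟨τ, t, ht, h2⟩ := h2
  rcases h1 with h1 | h1 <;> rcases h2 with h2 | h2
  · refine ⟨τ.trans σ, fun i => s (τ i) * t i, fun i => by simp [hs, ht], Or.inl fun i j => ?_⟩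
    simp only [Equiv.trans_apply]
    linear_combination t j * h1 (τ i) (τ j) + s (τ i) * h2 i j
  · refine ⟨τ.trans σ, fun i => s (τ i) * t i, fun i => by simp [hs, ht], Or.inr fun i j => ?_⟩
    simp only [Equiv.trans_apply]
    linear_combination t j * h1 (τ i) (τ j) + s (τ i) * h2 i j
  -- The first isomorphism conjugates, so the second switching function enters conjugated.
  · refine ⟨τ.trans σ, fun i => s (τ i) * star (t i),
      fun i => by simp [hs, ht], Or.inr fun i j => ?_⟩
    simp only [Equiv.trans_apply]
    have := congrArg star (h2 i j)
    simp only [star_mul'] at this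
    linear_combination star (t j) * h1 (τ i) (τ j) + s (τ i) * this
  · refine ⟨τ.trans σ, fun i => s (τ i) * star (t i),
      fun i => by simp [hs, ht], Or.inl fun i j => ?_⟩
    simp only [Equiv.trans_apply]
    have := congrArg star (h2 i j)
    simp only [star_mul', star_star] at this
    linear_combination star (t j) * h1 (τ i) (τ j) + s (τ i) * this

theorem MSwitch.switchingIsomorphic [Fintype V] [DecidableEq V] {Ψ : GainGraph V}
    {Φ : GainGraph W} (h : MSwitch Ψ.gainMatrix Φ.gainMatrix) : Ψ.SwitchingIsomorphic Φ := by
  obtain ⟨σ, s, hs, h⟩ := h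
  refine ⟨fun v => toCircle (s (σ.symm v)) (hs _), σ.symm, ?_⟩
  rcases h with h | h
  · left
    ext u v
    have := h (σ.symm u) (σ.symm v)
    simp only [Equiv.apply_symm_apply] at this
    simp only [submatrix_apply, mul_diagonal, diagonal_mul, coe_toCircle]
    have h0 := ne_zero_of_norm (hs (σ.symm u))
    field_simp
    linear_combination -this
  · right
    ext u v
    have := h (σ.symm u) (σ.symm v)
    simp only [Equiv.apply_symm_apply] at this
    simp only [submatrix_apply, mul_diagonal, diagonal_mul, coe_toCircle, Matrix.map_apply]
    have h0 := ne_zero_of_norm (hs (σ.symm u))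
    -- Inversion and conjugation agree on units, and both fix zero under the convention `0⁻¹ = 0`.
    rcases Φ.gainMatrix_unitEntries (σ.symm u) (σ.symm v) with h1 | h1
    · rw [h1] at this ⊢
      simp only [star_zero, mul_zero] at this
      rw [mul_assoc, this]; simp
    · rw [mul_assoc, this, ← mul_assoc, inv_mul_cancel₀ h0, one_mul,
        inv_eq_star_of_norm (norm_star_of_norm h1), star_star]

end Quadratic

end GainGraph

namespace GainGraph

/-! ### Consequences of row orthogonality for common neighbours. -/

section Orthogonality

variable {V : Type u} [Fintype V] [DecidableEq V] {A : Matrix V V ℂ} {a : ℝ} {k : ℕ}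

theorem Quadratic.sum_eq' (h : Quadratic A a k) {u : V} {l : List V} (hl : NbList A u l) (v : V) :
    (l.map fun w => A v w * A w u).sum = a * A v u + if v = u then (k : ℂ) else 0 := by
  rw [← h.sq v u, ← List.sum_toFinset _ hl.1]
  refine Finset.sum_subset (Finset.subset_univ _) ?_
  intro w _ hw
  have : ¬ Adj A w u := fun h' => hw (by simpa using (hl.2 w).1 (h.symm h'))
  rw [eq_zero_of_not_adj this, mul_zero]

theorem Quadratic.sum3' (h : Quadratic A a k) {u v p q r : V} (hu : Nb3 A u p q r)
    (huv : v ≠ u) : A v p * A p u + A v q * A q u + A v r * A r u = a * A v u := by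
  simpa [huv, add_assoc] using h.sum_eq' (nbList_three.2 hu) v

theorem Quadratic.sum4' (h : Quadratic A a k) {u v p q r s : V} (hu : Nb4 A u p q r s)
    (huv : v ≠ u) :
    A v p * A p u + A v q * A q u + A v r * A r u + A v s * A s u = a * A v u := by
  simpa [huv, add_assoc] using h.sum_eq' (nbList_four.2 hu) v

/-- Two distinct vertices have no, two, three or four common neighbours; if there are exactly
two, then the gains of the two paths are opposite. -/
theorem Quadratic.two_common (h : Quadratic A 0 4) {u v p q r s : V} (hu : Nb4 A u p q r s)
    (huv : u ≠ v) (hr : ¬ Adj A v r) (hs : ¬ Adj A v s) : A u p * A p v + A u q * A q v = 0 := by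
  have h1 := h.sum4 hu huv
  rw [eq_zero_of_not_adj fun h' => hr (h.symm h'),
    eq_zero_of_not_adj fun h' => hs (h.symm h')] at h1
  simpa using h1

theorem Quadratic.nb4_adj (_h : Quadratic A a k) {u p q r s : V} (hu : Nb4 A u p q r s) :
    Adj A u p ∧ Adj A u q ∧ Adj A u r ∧ Adj A u s := by
  simp [hu.2]

theorem Quadratic.nb3_adj (_h : Quadratic A a k) {u p q r : V} (hu : Nb3 A u p q r) :
    Adj A u p ∧ Adj A u q ∧ Adj A u r := by
  simp [hu.2]

/-- The primed numbers are the inverses, which are the conjugates in the applications. Three units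
with sum zero are 120 degrees apart, so a quotient and its conjugate add up to -1. -/
theorem mul_inv_add_mul_inv {x y z x' y' z' : ℂ} (h : x + y + z = 0) (h' : x' + y' + z' = 0)
    (hx : x * x' = 1) (hy : y * y' = 1) (hz : z * z' = 1) : x * y' + y * x' = -1 := by
  linear_combination (-z') * h + (x + y) * h' + hz - hx - hy

/-- If `u` and `t` have exactly three common neighbours, then every further vertex that is adjacent
to one but not all of them is adjacent to the fourth neighbour of `u`. -/
theorem Quadratic.adj_fourth (h : Quadratic A 0 4) {u t e p q r s s' : V} (hu : Nb4 A u p q r s)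
    (ht : Nb4 A t p q r s') (hs : s ≠ s') (hut : u ≠ t) (heu : e ≠ u) (het : e ≠ t)
    (hep : Adj A e p) (heq : ¬ Adj A e q) : Adj A e s := by
  by_contra hes
  have hts : ¬ Adj A t s := by
    unfold Nb4 at *; grind
  obtain ⟨hup, huq, hur, hus⟩ := h.nb4_adj hu
  obtain ⟨htp, htq, htr, hts'⟩ := h.nb4_adj ht
  have z1 : A e s = 0 := eq_zero_of_not_adj hes
  have z2 : A s e = 0 := eq_zero_of_not_adj fun h' => hes (h.symm h')
  have z3 : A e q = 0 := eq_zero_of_not_adj heq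
  have z4 : A q e = 0 := eq_zero_of_not_adj fun h' => heq (h.symm h')
  have z5 : A t s = 0 := eq_zero_of_not_adj hts
  have z6 : A s t = 0 := eq_zero_of_not_adj fun h' => hts (h.symm h')
  have e1 := h.sum4 hu heu.symm
  have e1' := h.sum4' hu heu
  have e2 := h.sum4 ht het.symm
  have e2' := h.sum4' ht het
  have e3 := h.sum4 hu hut
  have e3' := h.sum4' hu hut.symm
  simp only [z1, z2, z3, z4, z5, z6, ofReal_zero, zero_mul, mul_zero, add_zero] at e1 e1' e2 e2' e3 e3'
  have m1 := h.mul_swap hup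
  have m2 := h.mul_swap hur
  have m3 := h.mul_swap huq
  have m4 := h.mul_swap htp
  have m5 := h.mul_swap htq
  have m6 := h.mul_swap htr
  have m7 := h.mul_swap hep
  -- The three walks from `u` to `t` sum to zero, so those through `p` and `r` differ by 120
  -- degrees.
  have key := mul_inv_add_mul_inv (x := A u p * A p t) (y := A u r * A r t) (z := A u q * A q t)
    (x' := A t p * A p u) (y' := A t r * A r u) (z' := A t q * A q u)
    (by linear_combination e3) (by linear_combination e3')
    (by linear_combination A p t * A t p * m1 + m4)
    (by linear_combination A r t * A t r * m2 + m6)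
    (by linear_combination A q t * A t q * m3 + m5)
  -- As `e` misses `q` and, by assumption, `s`, the walks from `u` to `e` through `p` and `r`
  -- cancel. In particular `e` is adjacent to `r`.
  have hr : A e r * A r e = 1 := by
    have : (A u r * A r e) * (A e r * A r u) = (A u p * A p e) * (A e p * A p u) := by
      linear_combination (A e r * A r u) * e1 - (A u p * A p e) * e1'
    linear_combination this + (A p e * A e p) * m1 + m7 - (A r e * A e r) * m2
  -- The sign from that cancellation turns 120 degrees into 60. The walks from `t` to `e` through
  -- `p` and `r` therefore add up to a number of squared modulus 3, which the single walk through
  -- `s'` cannot balance.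
  have hz : (A t s' * A s' e) * (A e s' * A s' t) = 3 := by
    have f1 : A p e * A e r = - (A p u * A u r) := by
      linear_combination (A p u * A e r) * e1 - (A p e * A e r) * m1 - (A p u * A u r) * hr
    have f2 : A r e * A e p = - (A r u * A u p) := by
      linear_combination (A r u * A e p) * e1 - (A r e * A e p) * m2 - (A r u * A u p) * m7
    have : (A t s' * A s' e) * (A e s' * A s' t) =
        (A t p * A p e + A t r * A r e) * (A e p * A p t + A e r * A r t) := by
      linear_combination (A e s' * A s' t) * e2 - (A t p * A p e + A t r * A r e) * e2'
    rw [this]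
    linear_combination (A t p * A r t) * f1 + (A t r * A p t) * f2 + (A t p * A p t) * m7 +
      m4 + (A t r * A r t) * hr + m6 - key
  by_cases hes' : Adj A e s'
  · have m8 := h.mul_swap hts'
    have m9 := h.mul_swap hes'
    have : (3 : ℂ) = 1 := by
      rw [← hz]
      linear_combination (A t s' * A s' t) * m9 + m8
    norm_num at this
  · rw [eq_zero_of_not_adj hes'] at hz
    norm_num at hz

end Orthogonality

end GainGraph

namespace GainGraph

/-! ### Pairs of vertices with three common neighbours. -/

section Triples

variable {V : Type u} [Fintype V] [DecidableEq V] {A : Matrix V V ℂ}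

theorem Quadratic.exists_other' (h : Quadratic A 0 4) {u v p : V} (huv : u ≠ v)
    (hp : Adj A u p) (hv : Adj A v p) : ∃ q, q ≠ p ∧ Adj A u q ∧ Adj A v q :=
  h.exists_other huv (by simp) hp hv

/-- The first possible structure around two vertices with three common neighbours. -/
def FiveByFive (A : Matrix V V ℂ) (u t x y z p q r s s' : V) : Prop :=
  (u ≠ t ∧ u ≠ x ∧ u ≠ y ∧ u ≠ z ∧ t ≠ x ∧ t ≠ y ∧ t ≠ z ∧ x ≠ y ∧ x ≠ z ∧ y ≠ z) ∧ s ≠ s' ∧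
  Nb4 A u p q r s ∧ Nb4 A t p q r s' ∧ Nb4 A x p q s s' ∧ Nb4 A y p r s s' ∧ Nb4 A z q r s s'

/-- The second possible structure around two vertices with three common neighbours. -/
def SixBySix (A : Matrix V V ℂ) (u t f x y z p q r s s' s'' : V) : Prop :=
  (s ≠ s' ∧ s ≠ s'' ∧ s' ≠ s'') ∧
  (Nb4 A u p q r s ∧ Nb4 A t p q r s' ∧ Nb4 A f p q r s'' ∧ Nb4 A x p s s' s'' ∧
    Nb4 A y q s s' s'' ∧ Nb4 A z r s s' s'') ∧
  (Nb4 A p u t f x ∧ Nb4 A q u t f y ∧ Nb4 A r u t f z ∧ Nb4 A s u x y z ∧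
    Nb4 A s' t x y z ∧ Nb4 A s'' f x y z)

/-- The required vertex is the fourth neighbour of `p`. It cannot see both `q` and `r`: in the
absence of twins it would miss `s` and `s'`, while comparing `x` with `u` forces it to see `s'`. So
`Quadratic.adj_fourth` attaches it to `s` and `s'`, and it misses `q` since it is no twin of `x`. -/
theorem Quadratic.fiveByFive_aux (h : Quadratic A 0 4)
    (hno : ∀ u v p q r s, Nb4 A u p q r s → Nb4 A v p q r s → u = v) {u t x p q r s s' : V}
    (hu : Nb4 A u p q r s) (ht : Nb4 A t p q r s') (hut : u ≠ t)
    (hx : Nb4 A x p q s s') (hxu : x ≠ u) (hxt : x ≠ t) (hss' : s ≠ s') :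
    ∃ f, f ≠ u ∧ f ≠ t ∧ f ≠ x ∧ Nb4 A f p r s s' := by
  have hup := (h.nb4_adj hu).1
  have htp := (h.nb4_adj ht).1
  have hxp := (h.nb4_adj hx).1
  obtain ⟨f, hp⟩ := h.exists_nb4_of_three ⟨hut, hxu.symm, hxt.symm⟩ (h.symm hup) (h.symm htp)
    (h.symm hxp)
  have hfp : Adj A f p := h.symm (h.nb4_adj hp).2.2.2
  have hfu : f ≠ u := fun h' => hp.1.2.2.1 h'.symm
  have hft : f ≠ t := fun h' => hp.1.2.2.2.2.1 h'.symm
  have hfx : f ≠ x := fun h' => hp.1.2.2.2.2.2 h'.symm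
  have hr' : r ≠ s' := by unfold Nb4 at ht; tauto
  have hpqrs := hu.1
  have hpqrs' := ht.1
  have hnot : ¬ (Adj A f q ∧ Adj A f r) := by
    rintro ⟨hfq, hfr⟩
    have hfs : ¬ Adj A f s := fun hfs => hfu (hno _ _ _ _ _ _
      (h.nb4_of_four hpqrs hfp hfq hfr hfs) hu)
    have hfs' : ¬ Adj A f s' := fun hfs' => hft (hno _ _ _ _ _ _
      (h.nb4_of_four hpqrs' hfp hfq hfr hfs') ht)
    exact hfs' (h.adj_fourth hx.swap23 hu.swap34.swap23 hr'.symm hxu hfx hfu hfp hfs)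
  have hboth : Adj A f s ∧ Adj A f s' := by
    by_cases hfq : Adj A f q
    · have hfr : ¬ Adj A f r := fun h' => hnot ⟨hfq, h'⟩
      exact ⟨h.adj_fourth hu.swap23 ht.swap23 hss' hut hfu hft hfp hfr,
        h.adj_fourth ht.swap23 hu.swap23 hss'.symm hut.symm hft hfu hfp hfr⟩
    · exact ⟨h.adj_fourth hu ht hss' hut hfu hft hfp hfq,
        h.adj_fourth ht hu hss'.symm hut.symm hft hfu hfp hfq⟩
  have hfq : ¬ Adj A f q := fun hfq => hfx (hno _ _ _ _ _ _
      (h.nb4_of_four hx.1 hfp hfq hboth.1 hboth.2) hx)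
  have hfr : Adj A f r := h.adj_fourth hu.swap34 hx hr' hxu.symm hfu hfx hfp hfq
  exact ⟨f, hfu, hft, hfx, h.nb4_of_four (by grind) hfp hfr hboth.1 hboth.2⟩

-- The split is by the neighbours of `s` other than `u`. If one of them sees two of `p, q, r`, the
-- structure closes on five vertices of each kind. Otherwise three of them see one each, and the
-- fourth neighbour `f` of `p` must see all of `p, q, r`. The last neighbour `s''` of `f` then
-- completes a structure of six of each kind.
set_option maxHeartbeats 400000 in
theorem Quadratic.triple_structure (h : Quadratic A 0 4)
    (hno : ∀ u v p q r s, Nb4 A u p q r s → Nb4 A v p q r s → u = v) {u t p q r s s' : V}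
    (hu : Nb4 A u p q r s) (ht : Nb4 A t p q r s') (hut : u ≠ t) :
    (∃ u t x y z p q r s s', FiveByFive A u t x y z p q r s s') ∨
      ∃ u t f x y z p q r s s' s'', SixBySix A u t f x y z p q r s s' s'' := by
  have hss' : s ≠ s' := by
    rintro rfl
    exact hut (hno _ _ _ _ _ _ hu ht)
  have hpqrs := hu.1
  have hpqrs' := ht.1
  have hts : ¬ Adj A t s := by rw [ht.2]; grind
  have hus' : ¬ Adj A u s' := by rw [hu.2]; grind
  obtain ⟨hup, huq, hur, hus⟩ := h.nb4_adj hu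
  obtain ⟨htp, htq, htr, hts'⟩ := h.nb4_adj ht
  -- A vertex that sees some but not all of `p, q, r` sees both remaining neighbours `s` and `s'`.
  have G : ∀ e, e ≠ u → e ≠ t → (Adj A e p ∨ Adj A e q ∨ Adj A e r) →
      (¬ Adj A e p ∨ ¬ Adj A e q ∨ ¬ Adj A e r) → Adj A e s ∧ Adj A e s' := by
    intro e heu het h1 h2
    have key : ∀ {p q r : V}, Nb4 A u p q r s → Nb4 A t p q r s' → Adj A e p → ¬ Adj A e q →
        Adj A e s ∧ Adj A e s' := fun hu ht h1 h2 =>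
      ⟨h.adj_fourth hu ht hss' hut heu het h1 h2,
        h.adj_fourth ht hu hss'.symm hut.symm het heu h1 h2⟩
    by_cases hp : Adj A e p
    · by_cases hq : Adj A e q
      · exact key hu.swap23 ht.swap23 hp (by tauto)
      · exact key hu ht hp hq
    · by_cases hq : Adj A e q
      · exact key hu.swap12 ht.swap12 hq hp
      · exact key hu.swap23.swap12 ht.swap23.swap12 (by tauto) hp
  -- Sharing `s` with `u` requires a second shared neighbour among `p, q, r`. Seeing all three would
  -- make `e` a twin of `u`, so `G` applies.
  have F : ∀ e, e ≠ u → Adj A e s → Adj A e s' := by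
    intro e heu hes
    have het : e ≠ t := by rintro rfl; exact hts hes
    obtain ⟨w, hws, huw, hew⟩ := h.exists_other' heu.symm hus hes
    refine (G e heu het ?_ ?_).2
    · have := (hu.2 w).1 huw; grind
    · by_contra! hcon
      exact heu (hno _ _ _ _ _ _ (h.nb4_of_four hpqrs hcon.1 hcon.2.1 hcon.2.2 hes) hu)
  have C : ∀ w, w ≠ s → Adj A u w → ∃ e, e ≠ u ∧ Adj A e w ∧ Adj A e s := by
    intro w hws huw
    obtain ⟨e, h1, h2, h3⟩ := h.exists_other' hws (h.symm huw) (h.symm hus)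
    exact ⟨e, h1, h.symm h2, h.symm h3⟩
  have caseA : ∀ {p q r : V}, Nb4 A u p q r s → Nb4 A t p q r s' →
      (∃ x, x ≠ u ∧ Adj A x s ∧ Adj A x p ∧ Adj A x q) →
      ∃ u t x y z p q r s s', FiveByFive A u t x y z p q r s s' := by
    intro p q r hu ht ⟨x, hxu, hxs, hxp, hxq⟩
    have hxt : x ≠ t := by rintro rfl; exact hts hxs
    have hu1 := hu.1
    have ht1 := ht.1
    have hx : Nb4 A x p q s s' := h.nb4_of_four (by grind) hxp hxq hxs (F x hxu hxs)
    obtain ⟨y, hyu, hyt, hyx, hy⟩ := h.fiveByFive_aux hno hu ht hut hx hxu hxt hss'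
    obtain ⟨z, hzu, hzt, hzx, hz⟩ :=
      h.fiveByFive_aux hno hu.swap12 ht.swap12 hut hx.swap12 hxu hxt hss'
    have hyz : y ≠ z := by
      rintro rfl
      have := (hy.2 q).1 (h.nb4_adj hz).1
      grind
    exact ⟨u, t, x, y, z, p, q, r, s, s', ⟨hut, hxu.symm, hyu.symm, hzu.symm, hxt.symm, hyt.symm,
      hzt.symm, hyx.symm, hzx.symm, hyz⟩, hss', hu, ht, hx, hy, hz⟩
  by_cases hA : ∃ x, x ≠ u ∧ Adj A x s ∧
      ((Adj A x p ∧ Adj A x q) ∨ (Adj A x p ∧ Adj A x r) ∨ (Adj A x q ∧ Adj A x r))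
  · left
    obtain ⟨x, hxu, hxs, h1 | h1 | h1⟩ := hA
    · exact caseA hu ht ⟨x, hxu, hxs, h1⟩
    · exact caseA hu.swap23 ht.swap23 ⟨x, hxu, hxs, h1⟩
    · exact caseA hu.swap12.swap23 ht.swap12.swap23 ⟨x, hxu, hxs, h1⟩
  · right
    push Not at hA
    obtain ⟨x, hxu, hxp, hxs⟩ := C p (by grind) hup
    obtain ⟨y, hyu, hyq, hys⟩ := C q (by grind) huq
    obtain ⟨z, hzu, hzr, hzs⟩ := C r (by grind) hur
    have hA' : ∀ e, e ≠ u → Adj A e s → (Adj A e p → ¬ Adj A e q ∧ ¬ Adj A e r) ∧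
      (Adj A e q → ¬ Adj A e p ∧ ¬ Adj A e r) ∧ (Adj A e r → ¬ Adj A e p ∧ ¬ Adj A e q) := by
      intro e h1 h2; have := hA e h1 h2; tauto
    have hxA := hA' x hxu hxs
    have hyA := hA' y hyu hys
    have hzA := hA' z hzu hzs
    have hxy : x ≠ y := by grind
    have hxz : x ≠ z := by grind
    have hyz : y ≠ z := by grind
    have hxt : x ≠ t := by grind
    have hyt : y ≠ t := by grind
    have hzt : z ≠ t := by grind
    have hs : Nb4 A s u x y z := h.nb4_of_four (by grind) (h.symm hus) (h.symm hxs) (h.symm hys)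
      (h.symm hzs)
    have hs' : Nb4 A s' t x y z := h.nb4_of_four (by grind) (h.symm hts') (h.symm (F x hxu hxs))
      (h.symm (F y hyu hys)) (h.symm (F z hzu hzs))
    -- All neighbours of `s` are already named, so `f` misses `s`, and `G` then makes it see all of
    -- `p, q, r`.
    obtain ⟨f, hp⟩ := h.exists_nb4_of_three ⟨hut, hxu.symm, hxt.symm⟩ (h.symm hup) (h.symm htp)
      (h.symm hxp)
    have hpd := hp.1
    have hfp : Adj A f p := h.symm (h.nb4_adj hp).2.2.2
    have hfs : ¬ Adj A f s := by
      intro hfs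
      have := (hs.2 f).1 (h.symm hfs)
      grind
    have hfs' : ¬ Adj A f s' := by
      intro hfs
      have := (hs'.2 f).1 (h.symm hfs)
      grind
    have hfqr : Adj A f q ∧ Adj A f r := by
      by_contra hcon
      exact hfs (G f hpd.2.2.1.symm hpd.2.2.2.2.1.symm (Or.inl hfp)
        (Or.inr (not_and_or.1 hcon))).1
    obtain ⟨s'', hf⟩ := h.exists_nb4_of_three ⟨hpqrs.1, hpqrs.2.1, hpqrs.2.2.2.1⟩ hfp hfqr.1 hfqr.2
    have hfd := hf.1
    have hss'' : s ≠ s'' := by rintro rfl; exact hfs (h.nb4_adj hf).2.2.2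
    have hs's'' : s' ≠ s'' := by rintro rfl; exact hfs' (h.nb4_adj hf).2.2.2
    -- A second common neighbour of `e` and `f` must exist, and `hA'` leaves only `s''` for it.
    have share : ∀ e w, e ≠ u → Adj A e s → w ≠ s'' → Adj A f w → Adj A e w → Adj A e s'' := by
      intro e w heu hes hws hfw hew
      obtain ⟨w', hw', h1, h2⟩ := h.exists_other' (show e ≠ f by rintro rfl; exact hfs hes) hew hfw
      have h3 := (hf.2 w).1 hfw
      have h4 := (hf.2 w').1 h2
      have h5 := hA' e heu hes
      grind
    have hx'' := share x p hxu hxs (by grind) hfp hxp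
    have hy'' := share y q hyu hys (by grind) hfqr.1 hyq
    have hz'' := share z r hzu hzs (by grind) hfqr.2 hzr
    refine ⟨u, t, f, x, y, z, p, q, r, s, s', s'', ⟨hss', hss'', hs's''⟩,
      ⟨hu, ht, hf, ?_, ?_, ?_⟩, hp.swap34, ?_, ?_, hs, hs', ?_⟩
    · exact h.nb4_of_four (by grind) hxp hxs (F x hxu hxs) hx''
    · exact h.nb4_of_four (by grind) hyq hys (F y hyu hys) hy''
    · exact h.nb4_of_four (by grind) hzr hzs (F z hzu hzs) hz''
    · exact h.nb4_of_four (by grind) (h.symm huq) (h.symm htq) (h.symm hfqr.1) (h.symm hyq)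
    · exact h.nb4_of_four (by grind) (h.symm hur) (h.symm htr) (h.symm hfqr.2) (h.symm hzr)
    · exact h.nb4_of_four (by grind) (h.symm (h.nb4_adj hf).2.2.2) (h.symm hx'') (h.symm hy'')
        (h.symm hz'')

end Triples

end GainGraph

namespace GainGraph

/-! ### Graphs in which two vertices share zero or two neighbours. -/

section Semibiplane

variable {V : Type u} [Fintype V] [DecidableEq V] {A : Matrix V V ℂ}

theorem Quadratic.other_of_nb4 (h : Quadratic A 0 4) {e f p q r s : V} (he : Nb4 A e p q r s)
    (hef : e ≠ f) (hf : Adj A f p) : Adj A f q ∨ Adj A f r ∨ Adj A f s := by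
  obtain ⟨w, h1, h2, h3⟩ := h.exists_other' hef (h.nb4_adj he).1 hf
  rcases (he.2 w).1 h2 with rfl | rfl | rfl | rfl <;> tauto

/-- No two vertices have three common neighbours. -/
def AtMostTwoCommon (A : Matrix V V ℂ) : Prop :=
  ∀ u v p q r, u ≠ v → p ≠ q → p ≠ r → q ≠ r → Adj A u p → Adj A u q → Adj A u r →
    Adj A v p → Adj A v q → ¬ Adj A v r

/-- The incidence structure of the complement of the Fano plane. -/
def SevenBySeven (A : Matrix V V ℂ) (u b₁₂ b₁₃ b₁₄ b₂₃ b₂₄ b₃₄ p q r s x y w : V) : Prop :=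
  (Nb4 A u p q r s ∧ Nb4 A b₁₂ p q x y ∧ Nb4 A b₁₃ p r x w ∧ Nb4 A b₁₄ p s y w ∧
    Nb4 A b₂₃ q r y w ∧ Nb4 A b₂₄ q s x w ∧ Nb4 A b₃₄ r s x y) ∧
  (Nb4 A p u b₁₂ b₁₃ b₁₄ ∧ Nb4 A q u b₁₂ b₂₃ b₂₄ ∧ Nb4 A r u b₁₃ b₂₃ b₃₄ ∧
    Nb4 A s u b₁₄ b₂₄ b₃₄ ∧ Nb4 A x b₁₂ b₁₃ b₂₄ b₃₄ ∧ Nb4 A y b₁₂ b₁₄ b₂₃ b₃₄ ∧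
    Nb4 A w b₁₃ b₁₄ b₂₃ b₂₄)

/-- The incidence structure of the four-dimensional cube. -/
def EightByEight (A : Matrix V V ℂ) (u b₁₂ b₁₃ b₁₄ b₂₃ b₂₄ b₃₄ z p q r s x y w v : V) : Prop :=
  (Nb4 A u p q r s ∧ Nb4 A b₁₂ p q x y ∧ Nb4 A b₁₃ p r x w ∧ Nb4 A b₁₄ p s y w ∧
    Nb4 A b₂₃ q r x v ∧ Nb4 A b₂₄ q s y v ∧ Nb4 A b₃₄ r s w v ∧ Nb4 A z x y w v) ∧
  (Nb4 A p u b₁₂ b₁₃ b₁₄ ∧ Nb4 A q u b₁₂ b₂₃ b₂₄ ∧ Nb4 A r u b₁₃ b₂₃ b₃₄ ∧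
    Nb4 A s u b₁₄ b₂₄ b₃₄ ∧ Nb4 A x b₁₂ b₁₃ b₂₃ z ∧ Nb4 A y b₁₂ b₁₄ b₂₄ z ∧
    Nb4 A w b₁₃ b₁₄ b₃₄ z ∧ Nb4 A v b₂₃ b₂₄ b₃₄ z)

/-- Here two vertices that share a neighbour share exactly two. Each pair of neighbours of `u` thus
determines one further vertex `b`, and six such vertices fill the neighbourhoods of `p, q, r, s`. A
single choice remains, namely the third block through the second common point `x` of `b₁₂` and
`b₁₃`; everything else is forced. -/
theorem Quadratic.semibiplane_structure (h : Quadratic A 0 4) (hc : AtMostTwoCommon A)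
    {u p q r s : V} (hu : Nb4 A u p q r s) :
    (∃ b₁₂ b₁₃ b₁₄ b₂₃ b₂₄ b₃₄ x y w, SevenBySeven A u b₁₂ b₁₃ b₁₄ b₂₃ b₂₄ b₃₄ p q r s x y w) ∨
      ∃ b₁₂ b₁₃ b₁₄ b₂₃ b₂₄ b₃₄ z x y w v,
        EightByEight A u b₁₂ b₁₃ b₁₄ b₂₃ b₂₄ b₃₄ z p q r s x y w v := by
  obtain ⟨d12, d13, d14, d23, d24, d34⟩ := hu.1
  obtain ⟨hup, huq, hur, hus⟩ := h.nb4_adj hu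
  have B : ∀ p q, p ≠ q → Adj A u p → Adj A u q → ∃ b, u ≠ b ∧ Adj A b p ∧ Adj A b q ∧
      ∀ r, r ≠ p → r ≠ q → Adj A u r → ¬ Adj A b r := by
    intro p q hpq hp hq
    obtain ⟨b, h1, h2, h3⟩ := h.exists_other' hpq (h.symm hp) (h.symm hq)
    exact ⟨b, h1.symm, h.symm h2, h.symm h3, fun r h4 h5 h6 =>
      hc u b p q r h1.symm hpq h4.symm h5.symm hp hq h6 (h.symm h2) (h.symm h3)⟩
  obtain ⟨b₁₂, n1, i1, i1', j1⟩ := B p q d12 hup huq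
  obtain ⟨b₁₃, n2, i2, i2', j2⟩ := B p r d13 hup hur
  obtain ⟨b₁₄, n3, i3, i3', j3⟩ := B p s d14 hup hus
  obtain ⟨b₂₃, n4, i4, i4', j4⟩ := B q r d23 huq hur
  obtain ⟨b₂₄, n5, i5, i5', j5⟩ := B q s d24 huq hus
  obtain ⟨b₃₄, n6, i6, i6', j6⟩ := B r s d34 hur hus
  have k13 := j1 r d13.symm d23.symm hur
  have k14 := j1 s d14.symm d24.symm hus
  have k22 := j2 q d12.symm d23 huq
  have k24 := j2 s d14.symm d34.symm hus
  have k32 := j3 q d12.symm d24 huq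
  have k33 := j3 r d13.symm d34 hur
  have k41 := j4 p d12 d13 hup
  have k44 := j4 s d24.symm d34.symm hus
  have k51 := j5 p d12 d14 hup
  have k53 := j5 r d23.symm d34 hur
  have k61 := j6 p d13 d14 hup
  have k62 := j6 q d23 d24 huq
  clear j1 j2 j3 j4 j5 j6 B
  have e12 : b₁₂ ≠ b₁₃ := by rintro rfl; exact k13 i2'
  have e13 : b₁₂ ≠ b₁₄ := by rintro rfl; exact k14 i3'
  have e14 : b₁₂ ≠ b₂₃ := by rintro rfl; exact k13 i4'
  have e15 : b₁₂ ≠ b₂₄ := by rintro rfl; exact k14 i5'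
  have e16 : b₁₂ ≠ b₃₄ := by rintro rfl; exact k13 i6
  have e23 : b₁₃ ≠ b₁₄ := by rintro rfl; exact k24 i3'
  have e24 : b₁₃ ≠ b₂₃ := by rintro rfl; exact k22 i4
  have e25 : b₁₃ ≠ b₂₄ := by rintro rfl; exact k22 i5
  have e26 : b₁₃ ≠ b₃₄ := by rintro rfl; exact k24 i6'
  have e34 : b₁₄ ≠ b₂₃ := by rintro rfl; exact k32 i4
  have e35 : b₁₄ ≠ b₂₄ := by rintro rfl; exact k32 i5
  have e36 : b₁₄ ≠ b₃₄ := by rintro rfl; exact k33 i6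
  have e45 : b₂₃ ≠ b₂₄ := by rintro rfl; exact k44 i5'
  have e46 : b₂₃ ≠ b₃₄ := by rintro rfl; exact k44 i6'
  have e56 : b₂₄ ≠ b₃₄ := by rintro rfl; exact k53 i6
  have hp : Nb4 A p u b₁₂ b₁₃ b₁₄ := h.nb4_of_four ⟨n1, n2, n3, e12, e13, e23⟩
    (h.symm hup) (h.symm i1) (h.symm i2) (h.symm i3)
  have hq : Nb4 A q u b₁₂ b₂₃ b₂₄ := h.nb4_of_four ⟨n1, n4, n5, e14, e15, e45⟩
    (h.symm huq) (h.symm i1') (h.symm i4) (h.symm i5)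
  have hr : Nb4 A r u b₁₃ b₂₃ b₃₄ := h.nb4_of_four ⟨n2, n4, n6, e24, e26, e46⟩
    (h.symm hur) (h.symm i2') (h.symm i4') (h.symm i6)
  have hs : Nb4 A s u b₁₄ b₂₄ b₃₄ := h.nb4_of_four ⟨n3, n5, n6, e35, e36, e56⟩
    (h.symm hus) (h.symm i3') (h.symm i5') (h.symm i6')
  obtain ⟨x, xp, hx1, hx2⟩ := h.exists_other' e12 i1 i2
  have xq : x ≠ q := by rintro rfl; exact k22 hx2
  have xr : x ≠ r := by rintro rfl; exact k13 hx1
  have xs : x ≠ s := by rintro rfl; exact k14 hx1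
  obtain ⟨y, hb12⟩ := h.exists_nb4_of_three ⟨d12, xp.symm, xq.symm⟩ i1 i1' hx1
  obtain ⟨w, hb13⟩ := h.exists_nb4_of_three ⟨d13, xp.symm, xr.symm⟩ i2 i2' hx2
  have hy1 := (h.nb4_adj hb12).2.2.2
  have hw2 := (h.nb4_adj hb13).2.2.2
  -- Otherwise `x` and `p` would share the three vertices `b₁₂, b₁₃, b₁₄`.
  have hx3 : ¬ Adj A b₁₄ x := fun h' => hc x p _ _ _ xp e12 e13 e23 (h.symm hx1) (h.symm hx2)
    (h.symm h') (h.symm i1) (h.symm i2) (h.symm i3)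
  have hy3 : Adj A b₁₄ y := by
    rcases h.other_of_nb4 hb12 e13 i3 with h' | h' | h'
    exacts [absurd h' k32, absurd h' hx3, h']
  have hw3 : Adj A b₁₄ w := by
    rcases h.other_of_nb4 hb13 e23 i3 with h' | h' | h'
    exacts [absurd h' k33, absurd h' hx3, h']
  have hb12d := hb12.1
  have hb13d := hb13.1
  have yw : y ≠ w := by
    rintro rfl
    exact hc _ _ _ _ _ e12 xp.symm hb12d.2.2.1 hb12d.2.2.2.2.2 i1 hx1 hy1 i2 hx2 hw2
  have ys : y ≠ s := by rintro rfl; exact k14 hy1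
  have yr : y ≠ r := by rintro rfl; exact k13 hy1
  have ws : w ≠ s := by rintro rfl; exact k24 hw2
  have wq : w ≠ q := by rintro rfl; exact k22 hw2
  have hb14 : Nb4 A b₁₄ p s y w := h.nb4_of_four (by grind) i3 i3' hy3 hw3
  have hux : ¬ Adj A x u := fun h' => by have := (hu.2 x).1 (h.symm h'); tauto
  have huy : ¬ Adj A y u := fun h' => by have := (hu.2 y).1 (h.symm h'); grind
  have huw : ¬ Adj A w u := fun h' => by have := (hu.2 w).1 (h.symm h'); grind
  have three : ∀ {e b c d f : V}, Nb4 A f u b c d → e ≠ f → Adj A b e → Adj A c e →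
      ¬ Adj A d e := fun {e b c d f} hf hef h1 h2 h3 =>
    hc _ _ _ _ _ hef hf.1.2.2.2.1 hf.1.2.2.2.2.1 hf.1.2.2.2.2.2 (h.symm h1) (h.symm h2)
      (h.symm h3) (h.nb4_adj hf).2.1 (h.nb4_adj hf).2.2.1 (h.nb4_adj hf).2.2.2
  -- Sharing `b` with `f` entails sharing a second neighbour, and `u` is not available.
  have next : ∀ {e b c d f : V}, Nb4 A f u b c d → e ≠ f → ¬ Adj A e u → Adj A b e →
      Adj A c e ∨ Adj A d e := fun {e b c d f} hf hef hue h1 => by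
    rcases h.other_of_nb4 hf.swap12 hef.symm (h.symm h1) with h' | h' | h'
    exacts [absurd h' hue, Or.inl (h.symm h'), Or.inr (h.symm h')]
  have yq : y ≠ q := hb12d.2.2.2.2.1.symm
  have wr : w ≠ r := hb13d.2.2.2.2.1.symm
  have xy : x ≠ y := hb12d.2.2.2.2.2
  have xw : x ≠ w := hb13d.2.2.2.2.2
  -- With `b₂₃` through `x` the structure is the cube and needs a further point `v` and block `z`.
  -- With `b₂₄` through `x` it closes up on seven points.
  rcases next hq xq hux hx1 with hx4 | hx5
  · right
    have hx5 : ¬ Adj A b₂₄ x := three hq xq hx1 hx4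
    have hx6 : ¬ Adj A b₃₄ x := three hr xr hx2 hx4
    have hy4 : ¬ Adj A b₂₃ y := fun h' => hc _ _ _ _ _ e14 xq.symm yq.symm xy i1' hx1 hy1 i4 hx4 h'
    have hy5 : Adj A b₂₄ y := (next hq yq huy hy1).resolve_left hy4
    have hy6 : ¬ Adj A b₃₄ y := three hs ys hy3 hy5
    have hw4 : ¬ Adj A b₂₃ w := fun h' => hc _ _ _ _ _ e24 xr.symm wr.symm xw i2' hx2 hw2 i4' hx4 h'
    have hw6 : Adj A b₃₄ w := (next hr wr huw hw2).resolve_left hw4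
    have hw5 : ¬ Adj A b₂₄ w := fun h' => three hs ws hw3 h' hw6
    obtain ⟨v, hb23⟩ := h.exists_nb4_of_three ⟨d23, xq.symm, xr.symm⟩ i4 i4' hx4
    have hv4 := (h.nb4_adj hb23).2.2.2
    have hv5 : Adj A b₂₄ v := by
      rcases h.other_of_nb4 hb23 e45 i5 with h' | h' | h'
      exacts [absurd h' k53, absurd h' hx5, h']
    have hv6 : Adj A b₃₄ v := by
      rcases h.other_of_nb4 hb23.swap12 e46 i6 with h' | h' | h'
      exacts [absurd h' k62, absurd h' hx6, h']
    have hb23d := hb23.1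
    have vs : v ≠ s := by rintro rfl; exact k44 hv4
    have vy : v ≠ y := by rintro rfl; exact hy4 hv4
    have vw : v ≠ w := by rintro rfl; exact hw4 hv4
    have xv : x ≠ v := hb23d.2.2.2.2.2
    obtain ⟨z, hv⟩ := h.exists_nb4_of_three ⟨e45, e46, e56⟩ (h.symm hv4) (h.symm hv5) (h.symm hv6)
    have hzv := (h.nb4_adj hv).2.2.2
    have hzx : Adj A x z := by
      rcases h.other_of_nb4 hv xv.symm (h.symm hx4) with h' | h' | h'
      exacts [absurd (h.symm h') hx5, absurd (h.symm h') hx6, h']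
    have hzy : Adj A y z := by
      rcases h.other_of_nb4 hv.swap12 vy (h.symm hy5) with h' | h' | h'
      exacts [absurd (h.symm h') hy4, absurd (h.symm h') hy6, h']
    have hzw : Adj A w z := by
      rcases h.other_of_nb4 hv.swap23.swap12 vw (h.symm hw6) with h' | h' | h'
      exacts [absurd (h.symm h') hw4, absurd (h.symm h') hw5, h']
    have hvd := hv.1
    have z1 : z ≠ b₁₂ := by
      rintro rfl
      have := (hb12.2 v).1 (h.symm hzv)
      grind
    have z2 : z ≠ b₁₃ := by
      rintro rfl
      have := (hb13.2 v).1 (h.symm hzv)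
      grind
    have z3 : z ≠ b₁₄ := by
      rintro rfl
      exact hx3 (h.symm hzx)
    refine ⟨b₁₂, b₁₃, b₁₄, b₂₃, b₂₄, b₃₄, z, x, y, w, v,
      ⟨hu, hb12, hb13, hb14, hb23, ?_, ?_, ?_⟩, hp, hq, hr, hs, ?_, ?_, ?_, hv⟩
    · exact h.nb4_of_four ⟨d24, yq.symm, hb23d.2.2.1, ys.symm, vs.symm, vy.symm⟩ i5 i5' hy5 hv5
    · exact h.nb4_of_four ⟨d34, wr.symm, hb23d.2.2.2.2.1, ws.symm, vs.symm, vw.symm⟩ i6 i6' hw6 hv6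
    · exact h.nb4_of_four ⟨xy, xw, xv, yw, vy.symm, vw.symm⟩ (h.symm hzx) (h.symm hzy)
        (h.symm hzw) (h.symm hzv)
    · exact h.nb4_of_four ⟨e12, e14, z1.symm, e24, z2.symm, hvd.2.2.1⟩ (h.symm hx1) (h.symm hx2)
        (h.symm hx4) hzx
    · exact h.nb4_of_four ⟨e13, e15, z1.symm, e35, z3.symm, hvd.2.2.2.2.1⟩ (h.symm hy1)
        (h.symm hy3) (h.symm hy5) hzy
    · exact h.nb4_of_four ⟨e23, e26, z2.symm, e36, z3.symm, hvd.2.2.2.2.2⟩ (h.symm hw2)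
        (h.symm hw3) (h.symm hw6) hzw
  · left
    have hx4 : ¬ Adj A b₂₃ x := fun h' => three hq xq hx1 h' hx5
    have hx6 : Adj A b₃₄ x := (next hr xr hux hx2).resolve_left hx4
    have hy5 : ¬ Adj A b₂₄ y := fun h' => hc _ _ _ _ _ e15 xq.symm yq.symm xy i1' hx1 hy1 i5 hx5 h'
    have hy4 : Adj A b₂₃ y := (next hq yq huy hy1).resolve_right hy5
    have hy6 : Adj A b₃₄ y := (next hs ys huy hy3).resolve_left hy5
    have hw6 : ¬ Adj A b₃₄ w := fun h' => hc _ _ _ _ _ e26 xr.symm wr.symm xw i2' hx2 hw2 i6 hx6 h'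
    have hw4 : Adj A b₂₃ w := (next hr wr huw hw2).resolve_right hw6
    have hw5 : Adj A b₂₄ w := (next hs ws huw hw3).resolve_right hw6
    refine ⟨b₁₂, b₁₃, b₁₄, b₂₃, b₂₄, b₃₄, x, y, w,
      ⟨hu, hb12, hb13, hb14, ?_, ?_, ?_⟩, hp, hq, hr, hs, ?_, ?_, ?_⟩
    · exact h.nb4_of_four ⟨d23, yq.symm, wq.symm, yr.symm, wr.symm, yw⟩ i4 i4' hy4 hw4
    · exact h.nb4_of_four ⟨d24, xq.symm, wq.symm, xs.symm, ws.symm, xw⟩ i5 i5' hx5 hw5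
    · exact h.nb4_of_four ⟨d34, xr.symm, yr.symm, xs.symm, ys.symm, xy⟩ i6 i6' hx6 hy6
    · exact h.nb4_of_four ⟨e12, e15, e16, e25, e26, e56⟩ (h.symm hx1) (h.symm hx2)
        (h.symm hx5) (h.symm hx6)
    · exact h.nb4_of_four ⟨e13, e14, e16, e34, e36, e46⟩ (h.symm hy1) (h.symm hy3)
        (h.symm hy4) (h.symm hy6)
    · exact h.nb4_of_four ⟨e23, e24, e25, e34, e35, e45⟩ (h.symm hw2) (h.symm hw3)
        (h.symm hw4) (h.symm hw5)

end Semibiplane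

end GainGraph

namespace GainGraph

/-! ### Recognising negative doubles and bipartite models. -/

section NegativeDouble

variable {V : Type u} [Fintype V] [DecidableEq V] {A : Matrix V V ℂ} {a : ℝ} {k : ℕ}

/-- A family of distinct vertices that is closed under taking neighbours exhausts the vertices. -/
theorem Quadratic.exists_equiv (h : Quadratic A a k) {H : Type w} [Nonempty H] (f : H → V)
    (hf : Function.Injective f) (hc : ∀ i v, Adj A (f i) v → v ∈ Set.range f) :
    ∃ e : H ≃ V, ∀ i, e i = f i := by
  have hs : Function.Surjective f := h.conn (Set.range f) (Set.range_nonempty f) (by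
    rintro _ ⟨i, rfl⟩ v hv
    exact hc i v hv)
  exact ⟨Equiv.ofBijective f ⟨hf, hs⟩, fun _ => rfl⟩

/-- The gain matrix of the negative double. -/
def ndMatrix {H : Type w} [DecidableEq H] (B : Matrix H H ℂ) : Matrix (H ⊕ H) (H ⊕ H) ℂ :=
  Matrix.fromBlocks B 1 1 (-B)

theorem MSwitch.ndMatrix {H : Type w} {K : Type v} [DecidableEq H] [DecidableEq K]
    {B : Matrix H H ℂ} {C : Matrix K K ℂ} (h : MSwitch B C) :
    MSwitch (ndMatrix B) (ndMatrix C) := by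
  obtain ⟨σ, s, hs, h⟩ := h
  refine ⟨Equiv.sumCongr σ σ, Sum.elim s s, by rintro (i | i) <;> simp [hs], ?_⟩
  refine h.imp (fun h => ?_) fun h => ?_
  · rintro (i | i) (j | j)
    · simpa [GainGraph.ndMatrix] using h i j
    · by_cases hij : i = j <;> simp [GainGraph.ndMatrix, hij]
    · by_cases hij : i = j <;> simp [GainGraph.ndMatrix, hij]
    · simpa [GainGraph.ndMatrix] using h i j
  · rintro (i | i) (j | j)
    · simpa [GainGraph.ndMatrix] using h i j
    · by_cases hij : i = j <;> simp [GainGraph.ndMatrix, hij]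
    · by_cases hij : i = j <;> simp [GainGraph.ndMatrix, hij]
    · simpa [GainGraph.ndMatrix] using h i j

/-- A perfect matching that joins two halves of the vertex set and contains all edges between them
turns the gain graph into a negative double. -/
theorem Quadratic.exists_ndMatrix (h : Quadratic A 0 (k + 1)) {H : Type w} [Fintype H]
    [DecidableEq H] (e : H ⊕ H ≃ V)
    (he : ∀ i j, Adj A (e (Sum.inl i)) (e (Sum.inr j)) ↔ i = j) :
    ∃ B : Matrix H H ℂ, Quadratic B 0 k ∧ MSwitch A (ndMatrix B) := by
  have he0 : ∀ i j, i ≠ j → A (e (Sum.inl i)) (e (Sum.inr j)) = 0 := fun i j hij =>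
    eq_zero_of_not_adj fun h' => hij ((he i j).1 h')
  have he0' : ∀ i j, i ≠ j → A (e (Sum.inr i)) (e (Sum.inl j)) = 0 := fun i j hij => by
    rw [h.herm (e (Sum.inl j)), he0 j i hij.symm, star_zero]
  have ha : ∀ i, Adj A (e (Sum.inl i)) (e (Sum.inr i)) := fun i => (he i i).2 rfl
  have hab : ∀ i, A (e (Sum.inl i)) (e (Sum.inr i)) * A (e (Sum.inr i)) (e (Sum.inl i)) = 1 :=
    fun i => h.mul_swap (ha i)
  have hsum : ∀ x y, ∑ z, A (e x) (e z) * A (e z) (e y) =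
      if x = y then ((k + 1 : ℕ) : ℂ) else 0 := by
    intro x y
    have := h.sq (e x) (e y)
    rw [← e.sum_comp] at this
    simpa using this
  -- Only two walks of length two lead from the left copy of `i` to the right copy of `j`, because
  -- each uses one matching edge. Their cancellation makes the second diagonal block, after
  -- switching, the negative of the first.
  have hrel : ∀ i j, A (e (Sum.inl i)) (e (Sum.inl j)) * A (e (Sum.inl j)) (e (Sum.inr j)) +
      A (e (Sum.inl i)) (e (Sum.inr i)) * A (e (Sum.inr i)) (e (Sum.inr j)) = 0 := by
    intro i j
    have := hsum (Sum.inl i) (Sum.inr j)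
    rw [Fintype.sum_sum_type, Finset.sum_eq_single j, Finset.sum_eq_single i] at this
    · simpa using this
    · intro b _ hb; rw [he0 i b hb.symm, zero_mul]
    · simp
    · intro b _ hb; rw [he0 b j hb, mul_zero]
    · simp
  refine ⟨Matrix.of fun i j => A (e (Sum.inl i)) (e (Sum.inl j)), ⟨?_, ?_, ?_, ?_, ?_⟩, ?_⟩
  · intro i j; exact h.herm _ _
  · intro i; exact h.diag _
  · intro i j; exact h.unit _ _
  · intro i j
    have := hsum (Sum.inl i) (Sum.inl j)
    rw [Fintype.sum_sum_type, Finset.sum_eq_single (a := i) (s := (Finset.univ : Finset H))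
      (f := fun x => A (e (Sum.inl i)) (e (Sum.inr x)) * A (e (Sum.inr x)) (e (Sum.inl j)))] at this
    · by_cases hij : i = j
      · subst hij
        rw [hab i] at this
        simpa using this
      · rw [he0' i j hij] at this
        simpa [hij] using this
    · intro b _ hb; rw [he0 i b hb.symm, zero_mul]
    · simp
  · intro S hS hclosed i
    -- Connectedness descends to one half: a closed set there, taken in both copies, is closed,
    -- because `hrel` gives both halves the same edges.
    have key := h.conn {v | Sum.elim id id (e.symm v) ∈ S}
      (by obtain ⟨j, hj⟩ := hS; exact ⟨e (Sum.inl j), by simpa using hj⟩) (by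
        intro v hv w hvw
        obtain ⟨x, rfl⟩ := e.surjective v
        obtain ⟨y, rfl⟩ := e.surjective w
        simp only [Set.mem_ofPred_eq, Equiv.symm_apply_apply] at hv ⊢
        rcases x with i | i <;> rcases y with j | j
        · exact hclosed i hv j hvw
        · rw [he] at hvw; subst hvw; exact hv
        · have := h.symm hvw
          rw [he] at this; subst this; exact hv
        · refine hclosed i hv j ?_
          intro h0
          have h1 := hrel i j
          rw [show A (e (Sum.inl i)) (e (Sum.inl j)) = 0 from h0, zero_mul, zero_add] at h1
          exact mul_ne_zero (ha i) hvw h1) (e (Sum.inl i))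
    simpa using key
  -- This switching gives all matching edges gain 1.
  · refine ⟨e, Sum.elim (fun _ => 1) fun i => A (e (Sum.inr i)) (e (Sum.inl i)), ?_, Or.inl ?_⟩
    · rintro (i | i)
      · simp
      · exact h.norm_eq_one (h.symm (ha i))
    · rintro (i | i) (j | j)
      · simp [ndMatrix]
      · by_cases hij : i = j
        · subst hij; simpa [ndMatrix] using hab i
        · simp [ndMatrix, hij, he0 i j hij]
      · by_cases hij : i = j
        · subst hij; simp [ndMatrix]
        · simp [ndMatrix, hij, he0' i j hij]
      · simp only [ndMatrix, Matrix.fromBlocks_apply₂₂, Sum.elim_inr, Matrix.neg_apply,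
          Matrix.of_apply]
        linear_combination (A (e (Sum.inr i)) (e (Sum.inl i)) * A (e (Sum.inr j)) (e (Sum.inl j))) *
          hrel i j - (A (e (Sum.inr i)) (e (Sum.inl i)) * A (e (Sum.inl i)) (e (Sum.inl j))) * hab j
          - (A (e (Sum.inr i)) (e (Sum.inr j)) * A (e (Sum.inr j)) (e (Sum.inl j))) * hab i

/-- The adjacency relation of a bipartite graph with a prescribed biadjacency relation. -/
def bipAdj {m : ℕ} (P : Fin m → List (Fin m)) : Fin m ⊕ Fin m → Fin m ⊕ Fin m → Prop
  | Sum.inl i, Sum.inr j => j ∈ P i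
  | Sum.inr j, Sum.inl i => j ∈ P i
  | _, _ => False

instance {m : ℕ} (P : Fin m → List (Fin m)) : DecidableRel (bipAdj P) := by
  rintro (i | i) (j | j) <;> simp only [bipAdj] <;> infer_instance

/-- Rows and columns of an incidence structure found locally are closed under adjacency, so they
exhaust the graph. The adjacency relation becomes the decidable `bipAdj`, and later claims about it
can be left to `decide`. -/
theorem Quadratic.exists_bipartite_equiv (h : Quadratic A a k) {m : ℕ} [NeZero m]
    (P : Fin m → List (Fin m)) (r c : Fin m → V) (hr : Function.Injective r)
    (hc : Function.Injective c) (h1 : ∀ i v, Adj A (r i) v ↔ ∃ j ∈ P i, v = c j)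
    (h2 : ∀ j v, Adj A (c j) v → ∃ i, v = r i) (h3 : ∀ i j, r i ≠ c j) :
    ∃ e : Fin m ⊕ Fin m ≃ V, (∀ i, e (Sum.inl i) = r i) ∧ (∀ i, e (Sum.inr i) = c i) ∧
      ∀ x y, Adj A (e x) (e y) ↔ bipAdj P x y := by
  obtain ⟨e, he⟩ := h.exists_equiv (Sum.elim r c) (hr.sumElim hc h3) (by
    rintro (i | j) v hv
    · obtain ⟨j, -, rfl⟩ := (h1 i v).1 hv
      exact ⟨Sum.inr j, rfl⟩
    · obtain ⟨i, rfl⟩ := h2 j v hv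
      exact ⟨Sum.inl i, rfl⟩)
  have hrc : ∀ i j, Adj A (r i) (c j) ↔ j ∈ P i := by
    intro i j
    rw [h1]
    exact ⟨fun ⟨j', h4, h5⟩ => hc h5 ▸ h4, fun h4 => ⟨j, h4, rfl⟩⟩
  refine ⟨e, fun i => he _, fun i => he _, ?_⟩
  rintro (i | i) (j | j) <;> simp only [he, Sum.elim_inl, Sum.elim_inr, bipAdj, iff_false]
  · intro h'
    obtain ⟨j', -, h5⟩ := (h1 i _).1 h'
    exact h3 j j' h5
  · exact hrc i j
  · rw [h.adj_comm]; exact hrc j i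
  · intro h'
    obtain ⟨i', h5⟩ := h2 i _ h'
    exact h3 i' j h5.symm

/-- If a row vertex is also a column vertex, then every vertex is both. -/
theorem Quadratic.rows_eq_cols (h : Quadratic A a k) {m : ℕ} {r c : Fin m → V}
    (h1 : ∀ i v, Adj A (r i) v → ∃ j, v = c j) (h2 : ∀ j v, Adj A (c j) v → ∃ i, v = r i)
    {i j : Fin m} (hij : r i = c j) (v : V) : (∃ i, v = r i) ∧ ∃ j, v = c j := by
  refine h.conn {v | (∃ i, v = r i) ∧ ∃ j, v = c j} ⟨r i, ⟨i, rfl⟩, j, hij⟩ ?_ v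
  rintro u ⟨⟨i, rfl⟩, j, hj⟩ v hv
  exact ⟨h2 j v (hj ▸ hv), h1 i v hv⟩

/-- If one row vertex is not a column vertex, then none is. -/
theorem Quadratic.rows_ne_cols (h : Quadratic A a k) {m : ℕ} (r c : Fin m → V)
    (h1 : ∀ i v, Adj A (r i) v → ∃ j, v = c j) (h2 : ∀ j v, Adj A (c j) v → ∃ i, v = r i)
    (i₀ : Fin m) (h3 : ∀ j, r i₀ ≠ c j) (i j : Fin m) : r i ≠ c j := by
  intro hij
  obtain ⟨-, j', hj'⟩ := h.rows_eq_cols h1 h2 hij (r i₀)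
  exact h3 j' hj'

end NegativeDouble

end GainGraph

namespace GainGraph

/-! ### Cube roots of unity, and the classification in degrees one and two. -/

section SmallDegree

variable {V : Type u} [Fintype V] [DecidableEq V] {A : Matrix V V ℂ} {a : ℝ} {k : ℕ}

theorem injective_two {V : Type u} {p q : V} (h : p ≠ q) : Function.Injective ![p, q] := by
  rw [← List.nodup_ofFn]; simpa using h

theorem injective_three {V : Type u} {p q r : V} (h : p ≠ q ∧ p ≠ r ∧ q ≠ r) :
    Function.Injective ![p, q, r] := by
  rw [← List.nodup_ofFn]; simp; tauto

theorem injective_four {V : Type u} {p q r s : V}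
    (h : p ≠ q ∧ p ≠ r ∧ p ≠ s ∧ q ≠ r ∧ q ≠ s ∧ r ≠ s) :
    Function.Injective ![p, q, r, s] := by
  rw [← List.nodup_ofFn]; simp; tauto

theorem φ_sq_add : φ ^ 2 + φ + 1 = 0 := by
  have h3 : φ ^ 3 = 1 := by
    rw [φ, ← Complex.exp_nat_mul, ← Complex.exp_two_pi_mul_I]
    congr 1; push_cast; ring
  have h1 : φ ≠ 1 := by
    intro h
    have him := congrArg Complex.im h
    rw [φ, Complex.exp_ofReal_mul_I_im, Complex.one_im] at him
    have : 0 < Real.sin (2 * Real.pi / 3) :=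
      Real.sin_pos_of_pos_of_lt_pi (by positivity) (by linarith [Real.pi_pos])
    linarith
  have : (φ - 1) * (φ ^ 2 + φ + 1) = 0 := by linear_combination h3
  exact (mul_eq_zero.1 this).resolve_left (sub_ne_zero.2 h1)

theorem φ_cubed : φ ^ 3 = 1 := by linear_combination (φ - 1) * φ_sq_add

theorem star_φ : star φ = φ ^ 2 := by
  have := star_mul_of_norm norm_φ
  linear_combination φ ^ 2 * this - star φ * φ_cubed

/-- Three complex units with sum zero are proportional to the cube roots of unity. -/
theorem eq_φ_mul {x y z x' y' z' : ℂ} (h : x + y + z = 0) (h' : x' + y' + z' = 0)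
    (hx : x * x' = 1) (hy : y * y' = 1) (hz : z * z' = 1) :
    (y = φ * x ∧ z = φ ^ 2 * x) ∨ (y = φ ^ 2 * x ∧ z = φ * x) := by
  have h1 := mul_inv_add_mul_inv h h' hx hy hz
  have h2 : (y - φ * x) * (y - φ ^ 2 * x) = 0 := by
    linear_combination (x * y) * h1 - x ^ 2 * hy - y ^ 2 * hx - x * y * φ_sq_add + x ^ 2 * φ_cubed
  rcases mul_eq_zero.1 h2 with h3 | h3
  · exact Or.inl ⟨by linear_combination h3, by linear_combination h - h3 - x * φ_sq_add⟩
  · exact Or.inr ⟨by linear_combination h3, by linear_combination h - h3 - x * φ_sq_add⟩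

/-- Switching by the gains towards a base vertex makes all edges at that vertex trivial. The second
hypothesis says that the triangles through it have gain 1, which makes the other edges trivial too.
-/
theorem Quadratic.mswitch_complete (h : Quadratic A a k) {n : ℕ} [NeZero n] (e : Fin n ≃ V)
    (h1 : ∀ i j, i ≠ j → Adj A (e i) (e j))
    (h2 : ∀ i j, i ≠ 0 → j ≠ 0 → i ≠ j → A (e i) (e j) * A (e j) (e 0) = A (e i) (e 0)) :
    MSwitch A (complete n).gainMatrix := by
  refine ⟨e, fun i => if i = 0 then 1 else A (e i) (e 0), fun i => ?_, Or.inl fun i j => ?_⟩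
  · by_cases hi : i = 0
    · simp [hi]
    · simpa [hi] using h.norm_eq_one (h1 i 0 hi)
  · rw [gainMatrix_complete, Matrix.of_apply]
    by_cases hij : i = j
    · simp [hij, h.diag]
    · by_cases hi : i = 0
      · subst hi
        simpa [hij, Ne.symm hij] using h.mul_swap (h1 0 j hij)
      · by_cases hj : j = 0
        · subst hj; simp [hi]
        · simpa [hi, hj, hij] using h2 i j hi hj hij

/-- For bipartite models it suffices to match the biadjacency block, with `s` scaling rows and `t`
scaling columns. The other block follows by taking adjoints. -/
theorem Quadratic.mswitch_IG (h : Quadratic A a k) {m : ℕ} {P : Fin m → List (Fin m)}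
    {B : Matrix (Fin m) (Fin m) ℂ} (hB : UnitEntries B) (e : Fin m ⊕ Fin m ≃ V)
    (he : ∀ x y, Adj A (e x) (e y) ↔ bipAdj P x y) (s t : Fin m → ℂ) (hs : ∀ i, ‖s i‖ = 1)
    (ht : ∀ i, ‖t i‖ = 1)
    (hst : (∀ i j, A (e (Sum.inl i)) (e (Sum.inr j)) * t j = s i * B i j) ∨
      ∀ i j, A (e (Sum.inl i)) (e (Sum.inr j)) * t j = s i * star (B i j)) :
    MSwitch A (IG B hB).gainMatrix := by
  have hl : ∀ i j, A (e (Sum.inl i)) (e (Sum.inl j)) = 0 := fun i j =>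
    eq_zero_of_not_adj fun h' => by simpa [bipAdj] using (he _ _).1 h'
  have hr : ∀ i j, A (e (Sum.inr i)) (e (Sum.inr j)) = 0 := fun i j =>
    eq_zero_of_not_adj fun h' => by simpa [bipAdj] using (he _ _).1 h'
  have key : ∀ (B : Matrix (Fin m) (Fin m) ℂ),
      (∀ i j, A (e (Sum.inl i)) (e (Sum.inr j)) * t j = s i * B i j) →
      ∀ i j, A (e (Sum.inr j)) (e (Sum.inl i)) * s i = t j * star (B i j) := by
    intro B hB i j
    rw [h.herm (e (Sum.inl i))]
    have := congrArg star (hB i j)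
    simp only [star_mul'] at this
    linear_combination s i * t j * this + t j * star (B i j) * star_mul_of_norm (hs i) -
      s i * star (A (e (Sum.inl i)) (e (Sum.inr j))) * star_mul_of_norm (ht j)
  refine ⟨e, Sum.elim s t, by rintro (i | i) <;> simp [hs, ht], hst.imp (fun h1 => ?_) fun h1 => ?_⟩
  · rw [gainMatrix_IG]
    rintro (i | i) (j | j)
    · simp [hl]
    · simpa using h1 i j
    · simpa using key B h1 j i
    · simp [hr]
  · rw [gainMatrix_IG]
    rintro (i | i) (j | j)
    · simp [hl]
    · simpa using h1 i j
    · simpa using key (Matrix.of fun i j => star (B i j)) h1 j i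
    · simp [hr]

theorem Quadratic.degree_one (h : Quadratic A a 1) (u : V) :
    MSwitch A (complete 2).gainMatrix := by
  have hN : ∀ u, ∃ p, ∀ v, Adj A u v ↔ v = p := by
    intro u
    obtain ⟨p, hp⟩ := h.exists_adj one_ne_zero u
    obtain ⟨m, hm, hl⟩ := h.exists_nbList u [p] (by simp) (by simpa using hp)
    rcases m with _ | ⟨q, m⟩ <;> simp at hm
    exact ⟨p, fun v => by simpa using hl.2 v⟩
  obtain ⟨p, hp⟩ := hN u
  have hup := (hp p).2 rfl
  obtain ⟨e, he⟩ := h.exists_equiv ![u, p] (injective_two (h.ne hup)) (by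
    intro i v hv
    fin_cases i
    · exact ⟨1, by simpa using ((hp v).1 hv).symm⟩
    · obtain ⟨q, hq⟩ := hN p
      have h1 := (hq u).1 (h.symm hup)
      have h2 := (hq v).1 hv
      exact ⟨0, by simp [h1, h2]⟩)
  refine h.mswitch_complete e ?_ ?_
  · intro i j hij
    fin_cases i <;> fin_cases j <;> simp at hij <;> simp [he, hup, h.symm hup]
  · intro i j hi hj hij
    fin_cases i <;> fin_cases j <;> simp_all

theorem Quadratic.degree_two (h : Quadratic A a 2) (ha : 0 ≤ a) (u : V) :
    MSwitch A (complete 3).gainMatrix ∨ MSwitch A (IG W₂ unitEntries_W₂).gainMatrix := by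
  obtain ⟨p, hup⟩ := h.exists_adj two_ne_zero u
  obtain ⟨q, hu⟩ := h.exists_nb2 hup
  have huq : Adj A u q := by simp [hu.2]
  by_cases hpq : Adj A p q
  · left
    have hp : Nb2 A p u q := by
      obtain ⟨w, hw⟩ := h.exists_nb2 (h.symm hup)
      have := (hw.2 q).1 hpq
      have := h.ne huq
      obtain rfl : q = w := by grind
      exact hw
    have hq : Nb2 A q u p := by
      obtain ⟨w, hw⟩ := h.exists_nb2 (h.symm huq)
      have := (hw.2 p).1 (h.symm hpq)
      have := h.ne hup
      obtain rfl : p = w := by grind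
      exact hw
    obtain ⟨e, he⟩ := h.exists_equiv ![u, p, q] (injective_three ⟨h.ne hup, h.ne huq, h.ne hpq⟩) (by
      intro i v hv
      simp only [Set.mem_range, Fin.exists_fin_succ]
      fin_cases i
      · have := (hu.2 v).1 hv; simp; tauto
      · have := (hp.2 v).1 hv; simp; tauto
      · have := (hq.2 v).1 hv; simp; tauto)
    have e1 := h.sum2 hp (h.ne hup).symm
    have e2 := h.sum2 hq (h.ne huq).symm
    rw [h.diag u, mul_zero, zero_add] at e1 e2
    -- In a triangle only one walk of length two joins adjacent vertices, so `a` is nonnegative of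
    -- modulus 1.
    have ha1 : a = 1 := by
      have := congrArg norm e1
      rw [norm_mul, norm_mul, h.norm_eq_one hpq, h.norm_eq_one (h.symm huq),
        h.norm_eq_one (h.symm hup), norm_real, Real.norm_of_nonneg ha] at this
      linarith
    subst ha1
    refine h.mswitch_complete e ?_ ?_
    · intro i j hij
      fin_cases i <;> fin_cases j <;> simp at hij <;>
        simp [he, hup, h.symm hup, huq, h.symm huq, hpq, h.symm hpq]
    · intro i j hi hj hij
      fin_cases i <;> fin_cases j <;> simp at hi hj hij <;> simp [he]
      · simpa using e1
      · simpa using e2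
  · right
    have ha0 : a = 0 := by
      by_contra ha0
      obtain ⟨w, h1, h2⟩ := h.exists_triangle ha0 hup
      rcases (hu.2 w).1 h1 with rfl | rfl
      · exact h.not_adj_self _ h2
      · exact hpq h2
    subst ha0
    obtain ⟨b, hbu, hpb, hqb⟩ := h.exists_other hu.1 (by simp) (h.symm hup) (h.symm huq)
    have complete_nb : ∀ {x y z}, Adj A x y → Adj A x z → z ≠ y → Nb2 A x y z := by
      intro x y z h1 h2 h3
      obtain ⟨w, hw⟩ := h.exists_nb2 h1
      obtain rfl : z = w := ((hw.2 z).1 h2).resolve_left h3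
      exact hw
    have hp := complete_nb (h.symm hup) hpb hbu
    have hq := complete_nb (h.symm huq) hqb hbu
    have hb := complete_nb (h.symm hpb) (h.symm hqb) hu.1.symm
    have hne : ∀ j, u ≠ ![p, q] j := by
      intro j; fin_cases j
      · exact h.ne hup
      · exact h.ne huq
    have h1 : ∀ i v, Adj A (![u, b] i) v ↔ ∃ j ∈ [0, 1], v = ![p, q] j := by
      intro i v; fin_cases i
      · simpa using hu.2 v
      · simpa using hb.2 v
    have h2 : ∀ j v, Adj A (![p, q] j) v → ∃ i, v = ![u, b] i := by
      intro i v hv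
      simp only [Fin.exists_fin_succ]
      fin_cases i
      · simpa using (hp.2 v).1 hv
      · simpa using (hq.2 v).1 hv
    obtain ⟨e, hr, hc, he⟩ := h.exists_bipartite_equiv (fun _ => [0, 1]) ![u, b] ![p, q]
      (injective_two hbu.symm) (injective_two hu.1) h1 h2
      (h.rows_ne_cols _ _ (fun i v hv => by
        obtain ⟨j, -, hj⟩ := (h1 i v).1 hv; exact ⟨j, hj⟩) h2 0 hne)
    have e1 := h.sum2 hu hbu.symm
    have m1 := h.mul_swap hup
    have m2 := h.mul_swap huq
    have m3 := h.mul_swap hpb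
    have m4 := h.mul_swap hqb
    -- The first row and first column are normalised to 1. Orthogonality of the two rows makes the
    -- last entry -1.
    refine h.mswitch_IG unitEntries_W₂ e he ![1, A b p * A p u] ![A p u, A q u] ?_ ?_ (Or.inl ?_)
    · intro i; fin_cases i
      · simp
      · simp [h.norm_eq_one (h.symm hup), h.norm_eq_one (h.symm hpb)]
    · intro i; fin_cases i
      · simp [h.norm_eq_one (h.symm hup)]
      · simp [h.norm_eq_one (h.symm huq)]
    · intro i j
      rw [hr, hc]
      fin_cases i <;> fin_cases j <;> simp [W₂, m1, m2]
      simp only [ofReal_zero, zero_mul] at e1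
      linear_combination (A b p * A p u * A b q * A q u) * e1 - (A b q * A q u * A p b * A b p) * m1 - (A b p * A p u * A b q * A q b) * m2 - (A b p * A p u) * m4 - (A b q * A q u) * m3

end SmallDegree

end GainGraph

namespace GainGraph

/-! ### The classification in degree three. -/

section DegreeThree

variable {V : Type u} [Fintype V] [DecidableEq V] {A : Matrix V V ℂ} {a : ℝ} {k : ℕ}

/-- The lists `f` and `g` contain corresponding ends of a perfect matching. Both hypotheses on them
are finite checks. -/
theorem Quadratic.exists_ndMatrix_of_bipartite (h : Quadratic A 0 (k + 1)) {m : ℕ}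
    {P : Fin m → List (Fin m)} (e : Fin m ⊕ Fin m ≃ V)
    (he : ∀ x y, Adj A (e x) (e y) ↔ bipAdj P x y) (f g : Fin m → Fin m ⊕ Fin m)
    (hfg : Function.Bijective (Sum.elim f g)) (hP : ∀ i j, bipAdj P (f i) (g j) ↔ i = j) :
    ∃ B : Matrix (Fin m) (Fin m) ℂ, Quadratic B 0 k ∧ MSwitch A (ndMatrix B) :=
  h.exists_ndMatrix ((Equiv.ofBijective _ hfg).trans e) fun i j => by
    rw [Equiv.trans_apply, Equiv.trans_apply, he]
    exact hP i j

theorem star_ofReal_eq (a : ℝ) : star (a : ℂ) = a := Complex.conj_ofReal a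

theorem eq_one_or_of_pow_four {x : ℂ} (h : x ^ 4 = 1) : x = 1 ∨ x = -1 ∨ x = I ∨ x = -I := by
  have : (x - 1) * ((x + 1) * ((x - I) * (x + I))) = 0 := by
    linear_combination h - (x ^ 2 - 1) * I_sq
  simpa [sub_eq_zero, add_eq_zero_iff_eq_neg] using this

/-- A degree three gain graph containing a triangle is complete. -/
theorem Quadratic.degree_three_triangle (h : Quadratic A a 3) {u p q : V} (hup : Adj A u p)
    (huq : Adj A u q) (hpq : Adj A p q) :
    ∃ r, Nb3 A u p q r ∧ Nb3 A p u q r ∧ Nb3 A q u p r ∧ Nb3 A r u p q := by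
  -- For `a = 0` the vertices `u` and `r` share `p`, and the second shared vertex can only be `q`.
  -- For `a ≠ 0` the third edge at `r` needs a triangle through `u` or `p`, whose neighbourhoods are
  -- full, so its other end is `q`.
  have key : ∀ {u p q r}, Nb3 A u p q r → Adj A p q → Adj A p r → Adj A q r := by
    intro u p q r hu hpq hpr
    obtain ⟨hup, huq, hur⟩ := h.nb3_adj hu
    have hd := hu.1
    have hp : Nb3 A p u q r := h.nb3_of_three ⟨h.ne huq, h.ne hur, hd.2.2⟩ (h.symm hup) hpq hpr
    by_cases ha : a = 0
    · obtain ⟨w, hwp, h1, h2⟩ := h.exists_other (h.ne hur) (by simp [ha]) hup (h.symm hpr)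
      rcases (hu.2 w).1 h1 with rfl | rfl | rfl
      · exact absurd rfl hwp
      · exact h.symm h2
      · exact absurd h2 (h.not_adj_self _)
    · obtain ⟨w, hw⟩ := h.exists_nb3_of_two (h.ne hup) (h.symm hur) (h.symm hpr)
      have hrw := (h.nb3_adj hw).2.2
      obtain ⟨z, h1, h2⟩ := h.exists_triangle ha hrw
      rcases (hw.2 z).1 h1 with rfl | rfl | rfl
      · rcases (hu.2 w).1 (h.symm h2) with rfl | rfl | rfl
        · exact absurd rfl hw.1.2.2
        · exact h.symm hrw
        · exact absurd hrw (h.not_adj_self _)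
      · rcases (hp.2 w).1 (h.symm h2) with rfl | rfl | rfl
        · exact absurd rfl hw.1.2.1
        · exact h.symm hrw
        · exact absurd hrw (h.not_adj_self _)
      · exact absurd h2 (h.not_adj_self _)
  obtain ⟨r, hu⟩ := h.exists_nb3_of_two (h.ne hpq) hup huq
  have hur := (h.nb3_adj hu).2.2
  have hprqr : Adj A p r ∧ Adj A q r := by
    by_cases hpr : Adj A p r
    · exact ⟨hpr, key hu hpq hpr⟩
    · by_cases hqr : Adj A q r
      · exact ⟨key (u := u) (q := p) (p := q) (r := r) (by unfold Nb3 at *; grind) (h.symm hpq) hqr, hqr⟩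
      · exfalso
        have : ∃ w, w ≠ q ∧ w ≠ p ∧ (Adj A u w ∧ (Adj A p w ∨ Adj A q w)) ∨
            Adj A u w ∧ Adj A r w := by
          by_cases ha : a = 0
          · obtain ⟨w, h1, h2, h3⟩ := h.exists_other (h.ne hup) (by simp [ha]) huq hpq
            exact ⟨w, Or.inl ⟨h1, (h.ne h3).symm, h2, Or.inl h3⟩⟩
          · obtain ⟨w, h1, h2⟩ := h.exists_triangle ha hur
            exact ⟨w, Or.inr ⟨h1, h2⟩⟩
        obtain ⟨w, ⟨h1, h2, h3, h4⟩ | ⟨h3, h4⟩⟩ := this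
        · obtain rfl : w = r := by have := (hu.2 w).1 h3; tauto
          tauto
        · rcases (hu.2 w).1 h3 with rfl | rfl | rfl
          · exact hpr (h.symm h4)
          · exact hqr (h.symm h4)
          · exact h.not_adj_self _ h4
  have hd := hu.1
  refine ⟨r, hu, ?_, ?_, ?_⟩
  · exact h.nb3_of_three ⟨h.ne huq, h.ne hur, hd.2.2⟩ (h.symm hup) hpq hprqr.1
  · exact h.nb3_of_three ⟨h.ne hup, h.ne hur, hd.2.1⟩ (h.symm huq) (h.symm hpq) hprqr.2
  · exact h.nb3_of_three ⟨h.ne hup, h.ne huq, hd.1⟩ (h.symm hur) (h.symm hprqr.1) (h.symm hprqr.2)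

/-- The equations for the edges at `u` make all directed triangles through `u` have gain `x` or its
inverse, with `x` plus its inverse equal to `a`. One further edge gives `x ^ 4 = 1`. Here `x = 1` is
the complete graph, `x = -1` has negative `a`, and the two imaginary values are `W₄` and its
converse. -/
theorem Quadratic.degree_three_complete (h : Quadratic A a 3) (ha : 0 ≤ a) {u p q r : V}
    (hu : Nb3 A u p q r) (hp : Nb3 A p u q r) (hq : Nb3 A q u p r) (hr : Nb3 A r u p q) :
    (a = 2 ∧ MSwitch A (complete 4).gainMatrix) ∨ MSwitch A W₄.gainMatrix := by
  obtain ⟨hup, huq, hur⟩ := h.nb3_adj hu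
  obtain ⟨hpu, hpq, hpr⟩ := h.nb3_adj hp
  obtain ⟨hqu, hqp, hqr⟩ := h.nb3_adj hq
  obtain ⟨hru, hrp, hrq⟩ := h.nb3_adj hr
  obtain ⟨e, he⟩ := h.exists_equiv ![u, p, q, r]
    (injective_four ⟨h.ne hup, h.ne huq, h.ne hur, h.ne hpq, h.ne hpr, h.ne hqr⟩) (by
      intro i v hv
      simp only [Set.mem_range, Fin.exists_fin_succ]
      fin_cases i
      · have := (hu.2 v).1 hv; simp; tauto
      · have := (hp.2 v).1 hv; simp; tauto
      · have := (hq.2 v).1 hv; simp; tauto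
      · have := (hr.2 v).1 hv; simp; tauto)
  have m1 := h.mul_swap hup
  have m2 := h.mul_swap huq
  have m3 := h.mul_swap hur
  have m4 := h.mul_swap hpq
  have m5 := h.mul_swap hqr
  have m6 := h.mul_swap hpr
  have e1 := h.sum3' hu (h.ne hpu)
  have e2 := h.sum3' hu (h.ne hqu)
  have e3 := h.sum3' hu (h.ne hru)
  have f1 := h.sum3 hu (h.ne hup)
  have f2 := h.sum3 hu (h.ne huq)
  have f3 := h.sum3 hu (h.ne hur)
  have g := h.sum3 hp (h.ne hpq)
  simp only [h.diag, zero_mul, mul_zero, zero_add, add_zero] at e1 e2 e3 f1 f2 f3 g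
  have hx : (A u p * A p q * A q u) * (A u q * A q p * A p u) = 1 := by
    linear_combination (A p q * A q u * A u q * A q p) * m1 + (A p q * A q p) * m2 + m4
  have hy : (A u q * A q r * A r u) * (A u r * A r q * A q u) = 1 := by
    linear_combination (A q r * A r u * A u r * A r q) * m2 + (A q r * A r q) * m3 + m5
  have hz : (A u r * A r p * A p u) * (A u p * A p r * A r u) = 1 := by
    linear_combination (A r p * A p u * A u p * A p r) * m3 + (A r p * A p r) * m1 + m6
  have s1 : (A u p * A p q * A q u) + (A u p * A p r * A r u) = a := by
    linear_combination A u p * e1 + a * m1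
  have s2 : (A u q * A q p * A p u) + (A u q * A q r * A r u) = a := by
    linear_combination A u q * e2 + a * m2
  have s3 : (A u r * A r p * A p u) + (A u r * A r q * A q u) = a := by
    linear_combination A u r * e3 + a * m3
  have t1 : (A u q * A q p * A p u) + (A u r * A r p * A p u) = a := by
    linear_combination A p u * f1 + a * m1
  have t2 : (A u p * A p q * A q u) + (A u r * A r q * A q u) = a := by
    linear_combination A q u * f2 + a * m2
  have t3 : (A u p * A p r * A r u) + (A u q * A q r * A r u) = a := by
    linear_combination A r u * f3 + a * m3
  have hg : 1 + (A u p * A p r * A r u) * (A u r * A r q * A q u) = a * (A u p * A p q * A q u) := by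
    linear_combination (A u p * A q u) * g + (A u p * A p r * A r q * A q u) * m3
      - A u q * A q u * m1 - m2
  set x := A u p * A p q * A q u with hxdef
  set x' := A u q * A q p * A p u with hx'def
  set y := A u q * A q r * A r u with hydef
  set y' := A u r * A r q * A q u with hy'def
  set z := A u r * A r p * A p u with hzdef
  set z' := A u p * A p r * A r u with hz'def
  have zx : z = x := by linear_combination s3 - t2
  have yx : y = x := by linear_combination s2 - t1 + zx
  have z'x' : z' = x' := by linear_combination t3 - s2
  have y'x' : y' = x' := by linear_combination t2 - s1 + z'x'
  have sx : x + x' = a := by linear_combination s2 - yx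
  -- The equation for the edge `pq` reads `1 + x'² = (x + x') x`. As `x x' = 1`, this gives `x² =
  -- x'²`.
  have hx4 : x ^ 4 = 1 := by
    have : 1 + x' * x' = (x + x') * x := by rw [sx, ← hg, z'x', y'x']
    have h2 : x' * x' = x * x := by linear_combination this + hx
    linear_combination (x * x' + 1) * hx - x ^ 2 * h2
  have r1 : A p q * A q u = A p u * x := by linear_combination A p u * hxdef - A p q * A q u * m1
  have r2 : A p r * A r u = A p u * x' := by
    linear_combination A p u * (z'x' - hz'def) - A p r * A r u * m1
  have r3 : A q p * A p u = A q u * x' := by linear_combination A q u * hx'def - A q p * A p u * m2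
  have r4 : A q r * A r u = A q u * x := by
    linear_combination A q u * (yx - hydef) - A q r * A r u * m2
  have r5 : A r p * A p u = A r u * x := by
    linear_combination A r u * (zx - hzdef) - A r p * A p u * m3
  have r6 : A r q * A q u = A r u * x' := by
    linear_combination A r u * (y'x' - hy'def) - A r q * A q u * m3
  clear_value x x' y y' z z'
  rcases eq_one_or_of_pow_four hx4 with h1 | h1 | h1
  · left
    have h1' : x' = 1 := by rw [h1] at hx; simpa using hx
    rw [h1, mul_one] at r1 r4 r5
    rw [h1', mul_one] at r2 r3 r6
    refine ⟨?_, h.mswitch_complete e ?_ ?_⟩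
    · rw [h1, h1'] at sx
      have : (1 : ℝ) + 1 = a := by exact_mod_cast sx
      linarith
    · intro i j hij
      fin_cases i <;> fin_cases j <;> simp at hij <;> simpa [he]
    · intro i j hi hj hij
      fin_cases i <;> fin_cases j <;> simp at hi hj hij <;> simp only [he] <;> simpa
  · exfalso
    have h1' : x' = -1 := by rw [h1] at hx; linear_combination -hx
    rw [h1, h1'] at sx
    have : (-1 : ℝ) + -1 = a := by exact_mod_cast sx
    linarith
  · right
    refine ⟨e, ![1, A p u, A q u, A r u], ?_, ?_⟩
    · intro i; fin_cases i
      · simp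
      · simpa using h.norm_eq_one hpu
      · simpa using h.norm_eq_one hqu
      · simpa using h.norm_eq_one hru
    · refine h1.imp (fun h1 => ?_) fun h1 => ?_
      · have h1' : x' = -I := by
          rw [h1] at hx; linear_combination (-I) * hx + x' * I_sq
        rw [h1] at r1 r4 r5
        rw [h1'] at r2 r3 r6
        rw [gainMatrix_W₄]
        intro i j
        fin_cases i <;> fin_cases j <;> simp only [he] <;> simp [h.diag] <;>
          first | assumption | simpa using r2 | simpa using r3 | simpa using r6
      · have h1' : x' = I := by
          rw [h1] at hx; linear_combination I * hx + x' * I_sq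
        rw [h1] at r1 r4 r5
        rw [h1'] at r2 r3 r6
        rw [gainMatrix_W₄]
        intro i j
        fin_cases i <;> fin_cases j <;> simp only [he] <;> simp [h.diag] <;>
          first | assumption | simpa using r1 | simpa using r4 | simpa using r5

/-- The outcome of the classification in degree three when the eigenvalues are opposite. -/
theorem Quadratic.degree_three_triangle_free (h : Quadratic A 0 3)
    (hfree : ∀ u p q, Adj A u p → Adj A u q → ¬ Adj A p q) (u : V) :
    MSwitch A (IG W₃ unitEntries_W₃).gainMatrix ∨
      MSwitch A (IG W₂ unitEntries_W₂).ND.gainMatrix := by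
  obtain ⟨p, hup⟩ := h.exists_adj three_ne_zero u
  obtain ⟨q, r, hu⟩ := h.exists_nb3 hup
  obtain ⟨-, huq, hur⟩ := h.nb3_adj hu
  have hd := hu.1
  have other : ∀ {x y z}, x ≠ y → Adj A x z → Adj A y z → ∃ w, w ≠ z ∧ Adj A x w ∧ Adj A y w :=
    fun h1 h2 h3 => h.exists_other h1 (by simp) h2 h3
  -- A vertex with the same neighbours as `u` leads to `K_{3,3}`. Without one the graph is the
  -- three-dimensional cube.
  by_cases hb : ∃ b, b ≠ u ∧ Adj A b p ∧ Adj A b q ∧ Adj A b r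
  · left
    obtain ⟨b, hbu, hbp, hbq, hbr⟩ := hb
    have hbn : Nb3 A b p q r := h.nb3_of_three hd hbp hbq hbr
    obtain ⟨f, hp⟩ := h.exists_nb3_of_two hbu.symm (h.symm hup) (h.symm hbp)
    have hpf := (h.nb3_adj hp).2.2
    have e1 := h.sum3 hu hbu.symm
    have e1' := h.sum3' hu hbu
    have m1 := h.mul_swap hup
    have m2 := h.mul_swap huq
    have m3 := h.mul_swap hur
    have n1 := h.mul_swap hbp
    have n2 := h.mul_swap hbq
    have n3 := h.mul_swap hbr
    simp only [ofReal_zero, zero_mul] at e1 e1'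
    have key : ∀ {q r : V}, Nb3 A u p q r → Adj A b q → Adj A b r →
        A u p * A p b + A u q * A q b + A u r * A r b = 0 → Adj A f q := by
      intro q r hu hbq hbr e1
      obtain ⟨hup, huq, hur⟩ := h.nb3_adj hu
      by_contra hfq
      have e2 := h.sum3 hp hu.1.1
      rw [eq_zero_of_not_adj hfq] at e2
      have m2 := h.mul_swap huq
      have n2 := h.mul_swap hbq
      simp only [ofReal_zero, zero_mul, mul_zero, add_zero] at e2
      have : A u p * A p b + A u q * A q b = 0 := by
        linear_combination (A u p * A q b) * e2 - (A u q * A q b) * m1 - A u p * A p b * n2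
      exact mul_ne_zero hur (h.symm hbr) (by linear_combination e1 - this)
    have hfq : Adj A f q := key hu hbq hbr e1
    have hfr : Adj A f r := key hu.swap23 hbr hbq (by linear_combination e1)
    have hfn : Nb3 A f p q r := h.nb3_of_three hd (h.symm hpf) hfq hfr
    have hq : Nb3 A q u b f := h.nb3_of_three hp.1 (h.symm huq) (h.symm hbq) (h.symm hfq)
    have hr : Nb3 A r u b f := h.nb3_of_three hp.1 (h.symm hur) (h.symm hbr) (h.symm hfr)
    have e2 := h.sum3 hu hp.1.2.1
    have e2' := h.sum3' hu hp.1.2.1.symm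
    have e3 := h.sum3 hbn hp.1.2.2
    have l1 := h.mul_swap (h.symm hpf)
    have l2 := h.mul_swap hfq
    have l3 := h.mul_swap hfr
    simp only [ofReal_zero, zero_mul] at e2 e2' e3
    have c1 := eq_φ_mul (x := A b p * A p u) (y := A b q * A q u) (z := A b r * A r u)
      (x' := A u p * A p b) (y' := A u q * A q b) (z' := A u r * A r b) e1' e1
      (by linear_combination (A b p * A p b) * m1 + n1)
      (by linear_combination (A b q * A q b) * m2 + n2)
      (by linear_combination (A b r * A r b) * m3 + n3)
    have c2 := eq_φ_mul (x := A f p * A p u) (y := A f q * A q u) (z := A f r * A r u)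
      (x' := A u p * A p f) (y' := A u q * A q f) (z' := A u r * A r f) e2' e2
      (by linear_combination (A f p * A p f) * m1 + l1)
      (by linear_combination (A f q * A q f) * m2 + l2)
      (by linear_combination (A f r * A r f) * m3 + l3)
    have main : ∀ b f, Nb3 A b p q r → Nb3 A f p q r → Nb3 A p u b f → Nb3 A q u b f →
        Nb3 A r u b f → (A b q * A q u = φ * (A b p * A p u) ∧
          A b r * A r u = φ ^ 2 * (A b p * A p u)) → (A f q * A q u = φ ^ 2 * (A f p * A p u) ∧
          A f r * A r u = φ * (A f p * A p u)) →
        MSwitch A (IG W₃ unitEntries_W₃).gainMatrix := by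
      intro b f hb hf hp hq hr hbφ hfφ
      have h1 : ∀ i v, Adj A (![u, b, f] i) v ↔ ∃ j ∈ [0, 1, 2], v = ![p, q, r] j := by
        intro i v; fin_cases i
        · simpa using hu.2 v
        · simpa using hb.2 v
        · simpa using hf.2 v
      have h2 : ∀ j v, Adj A (![p, q, r] j) v → ∃ i, v = ![u, b, f] i := by
        intro i v hv
        simp only [Fin.exists_fin_succ]
        fin_cases i
        · simpa using (hp.2 v).1 hv
        · simpa using (hq.2 v).1 hv
        · simpa using (hr.2 v).1 hv
      have hne : ∀ j, u ≠ ![p, q, r] j := by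
        intro j; fin_cases j
        · exact h.ne hup
        · exact h.ne huq
        · exact h.ne hur
      obtain ⟨e, hr', hc', he⟩ := h.exists_bipartite_equiv (fun _ => [0, 1, 2]) ![u, b, f] ![p, q, r]
        (injective_three hp.1) (injective_three hd) h1 h2
        (h.rows_ne_cols _ _ (fun i v hv => by
          obtain ⟨j, -, hj⟩ := (h1 i v).1 hv; exact ⟨j, hj⟩) h2 0 hne)
      refine h.mswitch_IG unitEntries_W₃ e he ![1, A b p * A p u, A f p * A p u]
        ![A p u, A q u, A r u] ?_ ?_ (Or.inl ?_)
      · intro i; fin_cases i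
        · simp
        · simp [h.norm_eq_one (h.symm hup), h.norm_eq_one (h.nb3_adj hb).1]
        · simp [h.norm_eq_one (h.symm hup), h.norm_eq_one (h.nb3_adj hf).1]
      · intro i; fin_cases i
        · simp [h.norm_eq_one (h.symm hup)]
        · simp [h.norm_eq_one (h.symm huq)]
        · simp [h.norm_eq_one (h.symm hur)]
      · intro i j
        rw [hr', hc']
        fin_cases i <;> fin_cases j <;> simp [W₃, m1, m2, m3, hbφ, hfφ] <;> ring
    -- If both rows met the cube roots of unity in the same order, they would be proportional rather
    -- than orthogonal.
    have hnot : ¬ ((A b q * A q u = φ * (A b p * A p u) ∧ A b r * A r u = φ ^ 2 * (A b p * A p u)) ∧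
        (A f q * A q u = φ * (A f p * A p u) ∧ A f r * A r u = φ ^ 2 * (A f p * A p u)) ∨
        (A b q * A q u = φ ^ 2 * (A b p * A p u) ∧ A b r * A r u = φ * (A b p * A p u)) ∧
        (A f q * A q u = φ ^ 2 * (A f p * A p u) ∧ A f r * A r u = φ * (A f p * A p u))) := by
      intro h0
      have key : ∀ {q ξ : _}, ‖ξ‖ = 1 → A u q * A q u = 1 → A b q * A q u = ξ * (A b p * A p u) →
          A f q * A q u = ξ * (A f p * A p u) → A b q * A q f = A b p * A p f := by
        intro q ξ hξ m2 h1 h2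
        have h3 := congrArg star h2
        simp only [star_mul', ← h.herm] at h3
        linear_combination (A u q * A q f) * h1 + (ξ * (A b p * A p u)) * h3 +
          (A b p * A p u * A u p * A p f) * mul_star_of_norm hξ - A b q * A q f * m2 +
          A b p * A p f * m1
      have h2φ : ‖φ ^ 2‖ = 1 := by simp [norm_φ]
      have : A b q * A q f = A b p * A p f ∧ A b r * A r f = A b p * A p f := by
        rcases h0 with ⟨h1, h2⟩ | ⟨h1, h2⟩
        · exact ⟨key norm_φ m2 h1.1 h2.1, key h2φ m3 h1.2 h2.2⟩
        · exact ⟨key h2φ m2 h1.1 h2.1, key norm_φ m3 h1.2 h2.2⟩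
      have h3 : 3 * (A b p * A p f) = 0 := by linear_combination e3 - this.1 - this.2
      exact mul_ne_zero three_ne_zero (mul_ne_zero hbp hpf) h3
    have rot : ∀ {v b f}, Nb3 A v u b f → Nb3 A v u f b := fun h => h.swap23
    rcases c1 with c1 | c1 <;> rcases c2 with c2 | c2
    · exact absurd (Or.inl ⟨c1, c2⟩) hnot
    · exact main b f hbn hfn hp hq hr c1 c2
    · exact main f b hfn hbn (rot hp) (rot hq) (rot hr) c2 c1
    · exact absurd (Or.inr ⟨c1, c2⟩) hnot
  · right
    push Not at hb
    have B : ∀ x y z, x ≠ y → x ≠ z → y ≠ z → Adj A u x → Adj A u y → Adj A u z →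
        ∃ b, b ≠ u ∧ Adj A b x ∧ Adj A b y ∧ ¬ Adj A b z := by
      intro x y z hxy hxz hyz hx hy hz
      obtain ⟨b, h1, h2, h3⟩ := other hxy (h.symm hx) (h.symm hy)
      refine ⟨b, h1, h.symm h2, h.symm h3, fun h4 => ?_⟩
      have key : ∀ w, Adj A u w → Adj A b w := by
        intro w hw
        have := ((h.nb3_of_three ⟨hxy, hxz, hyz⟩ hx hy hz).2 w).1 hw
        rcases this with rfl | rfl | rfl
        exacts [h.symm h2, h.symm h3, h4]
      exact hb b h1 (key p hup) (key q huq) (key r hur)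
    obtain ⟨b, bu, hbp, hbq, hbr⟩ := B p q r hd.1 hd.2.1 hd.2.2 hup huq hur
    obtain ⟨c, cu, hcp, hcr, hcq⟩ := B p r q hd.2.1 hd.1 hd.2.2.symm hup hur huq
    obtain ⟨d, du, hdq, hdr, hdp⟩ := B q r p hd.2.2 hd.1.symm hd.2.1.symm huq hur hup
    have bc : b ≠ c := by rintro rfl; exact hbr hcr
    have bd : b ≠ d := by rintro rfl; exact hbr hdr
    have cd : c ≠ d := by rintro rfl; exact hcq hdq
    obtain ⟨x, hxp, hbx, hcx⟩ := other bc hbp hcp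
    have hxq : x ≠ q := by rintro rfl; exact hcq hcx
    have hxr : x ≠ r := by rintro rfl; exact hbr hbx
    have hbn : Nb3 A b p q x := h.nb3_of_three ⟨hd.1, hxp.symm, hxq.symm⟩ hbp hbq hbx
    have hcn : Nb3 A c p r x := h.nb3_of_three ⟨hd.2.1, hxp.symm, hxr.symm⟩ hcp hcr hcx
    have hdx : Adj A d x := by
      obtain ⟨w, h1, h2, h3⟩ := other bd hbq hdq
      rcases (hbn.2 w).1 h2 with rfl | rfl | rfl
      exacts [absurd h3 hdp, absurd rfl h1, h3]
    have hdn : Nb3 A d q r x := h.nb3_of_three ⟨hd.2.2, hxq.symm, hxr.symm⟩ hdq hdr hdx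
    have hp : Nb3 A p u b c := h.nb3_of_three ⟨bu.symm, cu.symm, bc⟩ (h.symm hup) (h.symm hbp)
      (h.symm hcp)
    have hq : Nb3 A q u b d := h.nb3_of_three ⟨bu.symm, du.symm, bd⟩ (h.symm huq) (h.symm hbq)
      (h.symm hdq)
    have hr : Nb3 A r u c d := h.nb3_of_three ⟨cu.symm, du.symm, cd⟩ (h.symm hur) (h.symm hcr)
      (h.symm hdr)
    have hx : Nb3 A x b c d := h.nb3_of_three ⟨bc, bd, cd⟩ (h.symm hbx) (h.symm hcx) (h.symm hdx)
    have hux : u ≠ x := by rintro rfl; exact hfree _ _ _ hup (h.symm hbx) (h.symm hbp)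
    have h1 : ∀ i v, Adj A (![u, b, c, d] i) v ↔
        ∃ j ∈ ![[0, 1, 2], [0, 1, 3], [0, 2, 3], [1, 2, 3]] i, v = ![p, q, r, x] j := by
      intro i v; fin_cases i
      · simpa using hu.2 v
      · simpa using hbn.2 v
      · simpa using hcn.2 v
      · simpa using hdn.2 v
    have h2 : ∀ j v, Adj A (![p, q, r, x] j) v → ∃ i, v = ![u, b, c, d] i := by
      intro i v hv
      simp only [Fin.exists_fin_succ]
      fin_cases i
      · have := (hp.2 v).1 hv; simp; tauto
      · have := (hq.2 v).1 hv; simp; tauto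
      · have := (hr.2 v).1 hv; simp; tauto
      · have := (hx.2 v).1 hv; simp; tauto
    have hne : ∀ j, u ≠ ![p, q, r, x] j := by
      intro j; fin_cases j
      · exact h.ne hup
      · exact h.ne huq
      · exact h.ne hur
      · exact hux
    obtain ⟨e, hr', hc', he⟩ := h.exists_bipartite_equiv _ ![u, b, c, d] ![p, q, r, x]
      (injective_four ⟨bu.symm, cu.symm, du.symm, bc, bd, cd⟩)
      (injective_four ⟨hd.1, hd.2.1, hxp.symm, hd.2.2, hxq.symm, hxr.symm⟩) h1 h2
      (h.rows_ne_cols _ _ (fun i v hv => by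
        obtain ⟨j, -, hj⟩ := (h1 i v).1 hv; exact ⟨j, hj⟩) h2 0 hne)
    -- The lists name two opposite faces of the cube: `u, p, q, b` are matched with `r, c, d, x`.
    obtain ⟨B, hB, hAB⟩ := h.exists_ndMatrix_of_bipartite e he
      ![Sum.inl 0, Sum.inr 0, Sum.inr 1, Sum.inl 1] ![Sum.inr 2, Sum.inl 2, Sum.inl 3, Sum.inr 3]
      (by decide) (by decide)
    rw [gainMatrix_ND]
    rcases hB.degree_two le_rfl 0 with h3 | h3
    -- A face has four vertices, so it is not `K₃`.
    · obtain ⟨σ, -⟩ := h3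
      simpa using Fintype.card_congr σ
    · exact hAB.trans h3.ndMatrix

theorem Quadratic.degree_three (h : Quadratic A a 3) (ha : 0 ≤ a) (u : V) :
    (a = 2 ∧ MSwitch A (complete 4).gainMatrix) ∨ MSwitch A W₄.gainMatrix ∨
      MSwitch A (IG W₃ unitEntries_W₃).gainMatrix ∨
      MSwitch A (IG W₂ unitEntries_W₂).ND.gainMatrix := by
  by_cases hfree : ∀ u p q, Adj A u p → Adj A u q → ¬ Adj A p q
  · have ha0 : a = 0 := by
      by_contra ha0
      obtain ⟨p, hup⟩ := h.exists_adj three_ne_zero u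
      obtain ⟨q, h1, h2⟩ := h.exists_triangle ha0 hup
      exact hfree _ _ _ hup h1 h2
    subst ha0
    exact Or.inr (Or.inr (h.degree_three_triangle_free hfree u))
  · push Not at hfree
    obtain ⟨u, p, q, h1, h2, h3⟩ := hfree
    obtain ⟨r, h4, h5, h6, h7⟩ := h.degree_three_triangle h1 h2 h3
    rcases h.degree_three_complete ha h4 h5 h6 h7 with h8 | h8
    · exact Or.inl h8
    · exact Or.inr (Or.inl h8)

end DegreeThree

end GainGraph

namespace GainGraph

/-! ### Gain graphs of degree four on five vertices. -/

section CompleteFive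

variable {V : Type u} [Fintype V] [DecidableEq V] {A : Matrix V V ℂ} {a : ℝ} {k : ℕ}

theorem Quadratic.adj_of_card (h : Quadratic A a k) (hV : Fintype.card V = k + 1) {x y : V}
    (hxy : x ≠ y) : Adj A x y := by
  obtain ⟨l, hl, hn⟩ := h.exists_nbList x [] (by simp) (by simp)
  simp only [List.length_nil, zero_add, List.nil_append] at hl hn
  have h1 : l.toFinset = Finset.univ.erase x := by
    refine Finset.eq_of_subset_of_card_le (fun v hv => ?_) ?_
    · have := (hn.2 v).2 (by simpa using hv)
      simpa using (h.ne this).symm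
    · rw [Finset.card_erase_of_mem (Finset.mem_univ x), Finset.card_univ, hV,
        List.toFinset_card_of_nodup hn.1, hl]
      simp
  rw [hn.2, ← List.mem_toFinset, h1]
  simpa using hxy.symm

theorem eq_one_of_norm_of_re {z : ℂ} (hz : ‖z‖ = 1) (hre : z.re = 1) : z = 1 := by
  have h1 : z.re ^ 2 + z.im ^ 2 = 1 := by
    have := Complex.sq_norm z
    rw [hz, normSq_apply] at this
    nlinarith
  have h2 : z.im = 0 := by
    rw [hre] at h1
    have : z.im ^ 2 = 0 := by linarith
    exact pow_eq_zero_iff two_ne_zero |>.1 this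
  exact Complex.ext hre h2

/-- The three triangles on each edge have gains with sum `a`. The ten resulting equations for the
real parts of the ten triangles have a unique solution, `a / 3` everywhere. The imaginary parts then
agree up to sign, and since three of them add up to zero they all vanish. Hence `a = 3` and all
triangles have gain 1. -/
theorem Quadratic.complete_five (h : Quadratic A a 4) (ha : 0 ≤ a) (hV : Fintype.card V = 5) :
    a = 3 ∧ MSwitch A (complete 5).gainMatrix := by
  have hadj : ∀ {x y}, x ≠ y → Adj A x y := fun hxy => h.adj_of_card hV hxy
  set T : V → V → V → ℂ := fun x y z => A x y * A y z * A z x with hT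
  have hTs : ∀ x y z, T y x z = star (T x y z) := by
    intro x y z
    simp only [hT, star_mul', ← h.herm]; ring
  have hTr : ∀ x y z, T y z x = T x y z := by
    intro x y z
    simp only [hT]; ring
  have hTn : ∀ {x y z}, x ≠ y → x ≠ z → y ≠ z → ‖T x y z‖ = 1 := by
    intro x y z h1 h2 h3
    simp [hT, h.norm_eq_one (hadj h1), h.norm_eq_one (hadj h2.symm), h.norm_eq_one (hadj h3)]
  have hE : ∀ {x y z w v : V}, x ≠ y → x ≠ z → x ≠ w → x ≠ v → y ≠ z → y ≠ w → y ≠ v → z ≠ w →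
      z ≠ v → w ≠ v → T x y z + T x y w + T x y v = a := by
    intro x y z w v h1 h2 h3 h4 h5 h6 h7 h8 h9 h10
    have hn : Nb4 A y x z w v := h.nb4_of_four ⟨h2, h3, h4, h8, h9, h10⟩ (hadj h1.symm)
      (hadj h5) (hadj h6) (hadj h7)
    have e1 := h.sum4 hn h1.symm
    rw [h.diag] at e1
    simp only [hT]
    linear_combination A x y * e1 + a * h.mul_swap (hadj h1)
  have hf1 : ∀ x y z, (T y x z).re = (T x y z).re := fun x y z => by rw [hTs x y z]; simp
  have hf2 : ∀ x y z, (T y z x).re = (T x y z).re := fun x y z => by rw [hTr x y z]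
  let e : Fin 5 ≃ V := (Fintype.equivFinOfCardEq hV).symm
  have hR : ∀ i j k l m : Fin 5, [i, j, k, l, m].Nodup → T (e i) (e j) (e k) +
      T (e i) (e j) (e l) + T (e i) (e j) (e m) = a := by
    intro i j k l m hnd
    simp only [List.nodup_cons, List.mem_cons, List.not_mem_nil, or_false, not_or] at hnd
    obtain ⟨⟨h1, h2, h3, h4⟩, ⟨h5, h6, h7⟩, ⟨h8, h9⟩, h10, -⟩ := hnd
    have hi := fun {i j : Fin 5} (hij : i ≠ j) => e.injective.ne hij
    exact hE (hi h1) (hi h2) (hi h3) (hi h4) (hi h5) (hi h6) (hi h7) (hi h8) (hi h9) (hi h10)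
  have hR' : ∀ i j k l m : Fin 5, [i, j, k, l, m].Nodup → (T (e i) (e j) (e k)).re +
      (T (e i) (e j) (e l)).re + (T (e i) (e j) (e m)).re = a := fun i j k l m hnd => by
    simpa using congrArg Complex.re (hR i j k l m hnd)
  have hI : ∀ i j k l m : Fin 5, [i, j, k, l, m].Nodup → (T (e i) (e j) (e k)).im +
      (T (e i) (e j) (e l)).im + (T (e i) (e j) (e m)).im = 0 := fun i j k l m hnd => by
    simpa using congrArg Complex.im (hR i j k l m hnd)
  have s1 : ∀ x y z, (T x z y).re = (T x y z).re := fun x y z => by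
    rw [← hf2, hf1, hf2, hf2, hf2]
  have hre : ∀ i j k l m : Fin 5, [i, j, k, l, m].Nodup → (T (e i) (e j) (e k)).re = a / 3 := by
    intro i j k l m hnd
    have hd := hnd
    simp only [List.nodup_cons, List.mem_cons, List.not_mem_nil, or_false, not_or, List.nodup_nil,
      not_false_eq_true, and_true] at hd
    have r01 := hR' i j k l m hnd
    have r02 := hR' i k j l m (by simp; tauto)
    have r03 := hR' i l j k m (by simp; tauto)
    have r04 := hR' i m j k l (by simp; tauto)
    have r12 := hR' j k i l m (by simp; tauto)
    have r13 := hR' j l i k m (by simp; tauto)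
    have r14 := hR' j m i k l (by simp; tauto)
    have r23 := hR' k l i j m (by simp; tauto)
    have r24 := hR' k m i j l (by simp; tauto)
    have r34 := hR' l m i j k (by simp; tauto)
    rw [hf2] at r12 r13 r14 r23 r24 r34
    rw [hf2 (e j) (e k)] at r23 r24
    rw [hf2 (e j) (e l), hf2 (e k) (e l)] at r34
    linarith [s1 (e i) (e j) (e k), s1 (e i) (e j) (e l), s1 (e i) (e j) (e m),
      s1 (e i) (e k) (e l), s1 (e i) (e k) (e m), s1 (e i) (e l) (e m), s1 (e j) (e k) (e l),
      s1 (e j) (e k) (e m), s1 (e j) (e l) (e m), s1 (e k) (e l) (e m)]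
  have him : ∀ i j k l m : Fin 5, [i, j, k, l, m].Nodup →
      (T (e i) (e j) (e k)).im ^ 2 = 1 - a ^ 2 / 9 := by
    intro i j k l m hnd
    have h1 := Complex.sq_norm (T (e i) (e j) (e k))
    simp only [List.nodup_cons, List.mem_cons, List.not_mem_nil, or_false, not_or] at hnd
    rw [hTn (e.injective.ne hnd.1.1) (e.injective.ne hnd.1.2.1) (e.injective.ne hnd.2.1.1),
      normSq_apply, hre i j k l m (by simpa using hnd)] at h1
    linarith
  -- Three reals with equal squares and sum zero vanish; the common square is `1 - a² / 9`.
  have ha3 : a = 3 := by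
    have i1 := him 0 1 2 3 4 (by decide)
    have i2 := him 0 1 3 2 4 (by decide)
    have i3 := him 0 1 4 2 3 (by decide)
    have i4 := hI 0 1 2 3 4 (by decide)
    set x := (T (e 0) (e 1) (e 2)).im
    set y := (T (e 0) (e 1) (e 3)).im
    set z := (T (e 0) (e 1) (e 4)).im
    have h1 : (x + y) ^ 2 = z ^ 2 := by rw [show z = -(x + y) by linarith]; ring
    have h2 : (x + z) ^ 2 = y ^ 2 := by rw [show y = -(x + z) by linarith]; ring
    have h3 : a ^ 2 = 9 := by
      rcases sq_eq_sq_iff_eq_or_eq_neg.1 (i1.trans i2.symm) with h4 | h4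
      · rw [h4] at h1; nlinarith
      · rw [h4] at h1; nlinarith
    nlinarith
  have hT1 : ∀ i j : Fin 5, i ≠ 0 → j ≠ 0 → i ≠ j → T (e 0) (e i) (e j) = 1 := by
    intro i j hi hj hij
    obtain ⟨l, m, hlm⟩ : ∃ l m, [0, i, j, l, m].Nodup := by
      revert i j; decide
    have h1 := hre 0 i j l m hlm
    rw [ha3, div_self three_ne_zero] at h1
    exact eq_one_of_norm_of_re (hTn (e.injective.ne hi.symm) (e.injective.ne hj.symm)
      (e.injective.ne hij)) h1
  refine ⟨ha3, h.mswitch_complete e (fun i j hij => hadj (e.injective.ne hij)) ?_⟩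
  intro i j hi hj hij
  have h1 := hT1 i j hi hj hij
  simp only [hT] at h1
  linear_combination A (e i) (e 0) * h1 -
    A (e i) (e j) * A (e j) (e 0) * h.mul_swap (hadj (e.injective.ne hi.symm))

end CompleteFive

end GainGraph

namespace GainGraph

/-! ### Normalised entries of orthogonal rows, and the graph `IG(W₅)`. -/

section WeighingMatrices

variable {V : Type u} [Fintype V] [DecidableEq V] {A : Matrix V V ℂ} {a : ℝ} {k n : ℕ}

/-- The root `ω` is left free because both primitive cube roots occur below, one for the graph and
one for its converse. -/
theorem eq_omega_mul {ω x y z x' y' z' : ℂ} (hω : ω ^ 2 + ω + 1 = 0) (h : x + y + z = 0)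
    (h' : x' + y' + z' = 0) (hx : x * x' = 1) (hy : y * y' = 1) (hz : z * z' = 1) :
    (y = ω * x ∧ z = ω ^ 2 * x) ∨ (y = ω ^ 2 * x ∧ z = ω * x) := by
  have h1 := mul_inv_add_mul_inv h h' hx hy hz
  have h2 : (y - ω * x) * (y - ω ^ 2 * x) = 0 := by
    linear_combination (x * y) * h1 - x ^ 2 * hy - y ^ 2 * hx - x * y * hω +
      x ^ 2 * (ω - 1) * hω
  rcases mul_eq_zero.1 h2 with h3 | h3
  · exact Or.inl ⟨by linear_combination h3, by linear_combination h - h3 - x * hω⟩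
  · exact Or.inr ⟨by linear_combination h3, by linear_combination h - h3 - x * hω⟩

/-- Here `S` and `R` are row scalings, `T` is a column scaling, and `α, β` are normalised entries.
The column scaling drops out of a walk from row to row. -/
theorem Quadratic.path_eq (h : Quadratic A a k) {e f c : V} {S R T α β : ℂ} (hT : ‖T‖ = 1)
    (h1 : A e c * T = S * α) (h2 : A f c * T = R * β) :
    A e c * A c f = S * star R * (α * star β) := by
  have h3 := congrArg star h2
  simp only [star_mul', ← h.herm] at h3
  linear_combination (A c f * star T) * h1 + S * α * h3 - A e c * A c f * mul_star_of_norm hT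

/-- If all but one term `m` of an inner product of two rows is known in normalised form,
orthogonality determines the missing normalised entry. -/
theorem Quadratic.entry_eq (h : Quadratic A a k) {e f c : V} {S R T α β m : ℂ} (hS : ‖S‖ = 1)
    (hT : ‖T‖ = 1) (hα : ‖α‖ = 1) (h1 : A e c * T = S * α)
    (h2 : S * star R * m + A e c * A c f = 0) (h3 : m + α * star β = 0) :
    A f c * T = R * β := by
  have h4 : A c f = star R * star β * T := by
    linear_combination (star S * star α * T) * h2 - (star S * star α * A c f) * h1 -
      A c f * mul_star_of_norm hα - A c f * α * star α * mul_star_of_norm hS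
      - star α * T * star R * m * mul_star_of_norm hS - (T * star R * star α) * h3
      + T * star R * star β * mul_star_of_norm hα
  have h5 := congrArg star h4
  simp only [star_mul', ← h.herm, star_star] at h5
  linear_combination T * h5 + R * β * star_mul_of_norm hT

omit [Fintype V] [DecidableEq V] in
theorem Nb4.mem_iff {c : Fin n → V} {e : V} {i j k l : Fin n}
    (h : Nb4 A e (c i) (c j) (c k) (c l)) (v : V) :
    Adj A e v ↔ ∃ m ∈ [i, j, k, l], v = c m := by
  simpa using h.2 v

omit [Fintype V] [DecidableEq V] in
theorem Nb4.exists_eq {c : Fin n → V} {e : V} {i j k l : Fin n}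
    (h : Nb4 A e (c i) (c j) (c k) (c l)) {v : V} (hv : Adj A e v) : ∃ m, v = c m := by
  obtain ⟨m, -, hm⟩ := (h.mem_iff v).1 hv
  exact ⟨m, hm⟩

/-- Each of the five rows misses one column. In the chosen order the missing columns form the
diagonal, as in the cyclic matrix `W₅`. -/
theorem Quadratic.exists_equiv_W₅ (h : Quadratic A 0 4) {u t x y z p q r s s' : V}
    (hF : FiveByFive A u t x y z p q r s s') : ∃ (P : Fin 5 → List (Fin 5))
      (e : Fin 5 ⊕ Fin 5 ≃ V), (∀ i, e (Sum.inl i) = ![t, x, z, y, u] i) ∧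
      (∀ i, e (Sum.inr i) = ![s, r, p, q, s'] i) ∧ ∀ x y, Adj A (e x) (e y) ↔ bipAdj P x y := by
  obtain ⟨⟨ut, ux, uy, uz, tx, ty, tz, xy, xz, yz⟩, hss', hu, ht, hx, hy, hz⟩ := hF
  obtain ⟨hup, huq, hur, hus⟩ := h.nb4_adj hu
  obtain ⟨htp, htq, htr, hts'⟩ := h.nb4_adj ht
  obtain ⟨hxp, hxq, hxs, hxs'⟩ := h.nb4_adj hx
  obtain ⟨hyp, hyr, hys, hys'⟩ := h.nb4_adj hy
  obtain ⟨hzq, hzr, hzs, hzs'⟩ := h.nb4_adj hz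
  have hp : Nb4 A p u t x y := h.nb4_of_four ⟨ut, ux, uy, tx, ty, xy⟩ (h.symm hup) (h.symm htp)
    (h.symm hxp) (h.symm hyp)
  have hq : Nb4 A q u t x z := h.nb4_of_four ⟨ut, ux, uz, tx, tz, xz⟩ (h.symm huq) (h.symm htq)
    (h.symm hxq) (h.symm hzq)
  have hr : Nb4 A r u t y z := h.nb4_of_four ⟨ut, uy, uz, ty, tz, yz⟩ (h.symm hur) (h.symm htr)
    (h.symm hyr) (h.symm hzr)
  have hs : Nb4 A s u x y z := h.nb4_of_four ⟨ux, uy, uz, xy, xz, yz⟩ (h.symm hus) (h.symm hxs)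
    (h.symm hys) (h.symm hzs)
  have hs' : Nb4 A s' t x y z := h.nb4_of_four ⟨tx, ty, tz, xy, xz, yz⟩ (h.symm hts')
    (h.symm hxs') (h.symm hys') (h.symm hzs')
  have h1 : ∀ i v, Adj A (![t, x, z, y, u] i) v ↔
      ∃ j ∈ ![[2, 3, 1, 4], [2, 3, 0, 4], [3, 1, 0, 4], [2, 1, 0, 4], [2, 3, 1, 0]] i,
        v = ![s, r, p, q, s'] j := by
    intro i
    fin_cases i
    exacts [Nb4.mem_iff ht, Nb4.mem_iff hx, Nb4.mem_iff hz, Nb4.mem_iff hy, Nb4.mem_iff hu]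
  have h2 : ∀ j v, Adj A (![s, r, p, q, s'] j) v → ∃ i, v = ![t, x, z, y, u] i := by
    intro i v
    fin_cases i
    exacts [Nb4.exists_eq (c := ![t, x, z, y, u]) (i := 4) (j := 1) (k := 3) (l := 2) hs,
      Nb4.exists_eq (c := ![t, x, z, y, u]) (i := 4) (j := 0) (k := 3) (l := 2) hr,
      Nb4.exists_eq (c := ![t, x, z, y, u]) (i := 4) (j := 0) (k := 1) (l := 3) hp,
      Nb4.exists_eq (c := ![t, x, z, y, u]) (i := 4) (j := 0) (k := 1) (l := 2) hq,
      Nb4.exists_eq (c := ![t, x, z, y, u]) (i := 0) (j := 1) (k := 3) (l := 2) hs']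
  have h1' : ∀ i v, Adj A (![t, x, z, y, u] i) v → ∃ j, v = ![s, r, p, q, s'] j := fun i v hv => by
    obtain ⟨j, -, hj⟩ := (h1 i v).1 hv; exact ⟨j, hj⟩
  have hinj : Function.Injective ![t, x, z, y, u] := by
    rw [← List.nodup_ofFn]; simp [tx, tz, ty, ut.symm, xz, xy, ux.symm, yz.symm, uz.symm, uy.symm]
  have hinj' : Function.Injective ![s, r, p, q, s'] := by
    obtain ⟨d1, d2, d3, d4, d5, d6⟩ := hu.1
    obtain ⟨-, -, e3, -, e5, e6⟩ := ht.1
    rw [← List.nodup_ofFn]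
    simp [d6.symm, d3.symm, d5.symm, hss', d2.symm, d4.symm, e6, d1, e3, e5]
  -- If a row were a column, the five rows would be all vertices, and the graph on five vertices has
  -- `a = 3` rather than 0.
  have hne : ∀ i j, ![t, x, z, y, u] i ≠ ![s, r, p, q, s'] j := by
    intro i j hij
    have hcard : Fintype.card V = 5 := by
      have := Fintype.card_congr (Equiv.ofBijective _ ⟨hinj, fun v => by
        obtain ⟨⟨i, hi⟩, -⟩ := h.rows_eq_cols h1' h2 hij v
        exact ⟨i, hi.symm⟩⟩)
      simpa using this.symm
    have := (h.complete_five le_rfl hcard).1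
    norm_num at this
  exact ⟨_, h.exists_bipartite_equiv _ ![t, x, z, y, u] ![s, r, p, q, s'] hinj hinj' h1 h2 hne⟩

/-- Relative to row `u`, every other row has the normalised entries 1, `ω`, `ω²` on the three shared
columns, in one of two orders. Choosing `ω` fixes the order in row `t`; orthogonality to row `t`
then fixes the other orders and the column `s'`. -/
theorem Quadratic.mswitch_W₅ (h : Quadratic A 0 4) {u t x y z p q r s s' : V}
    (hF : FiveByFive A u t x y z p q r s s') : MSwitch A (IG W₅ unitEntries_W₅).gainMatrix := by
  obtain ⟨P, e, her, hec, he⟩ := h.exists_equiv_W₅ hF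
  obtain ⟨⟨ut, ux, uy, uz, tx, ty, tz, xy, xz, yz⟩, hss', hu, ht, hx, hy, hz⟩ := hF
  obtain ⟨hup, huq, hur, hus⟩ := h.nb4_adj hu
  obtain ⟨htp, htq, htr, hts'⟩ := h.nb4_adj ht
  obtain ⟨hxp, hxq, hxs, hxs'⟩ := h.nb4_adj hx
  obtain ⟨hyp, hyr, hys, hys'⟩ := h.nb4_adj hy
  obtain ⟨hzq, hzr, hzs, hzs'⟩ := h.nb4_adj hz
  have m := fun {x y : V} (hxy : Adj A x y) => h.mul_swap hxy
  have n := fun {x y : V} (hxy : Adj A x y) => h.norm_eq_one hxy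
  obtain ⟨d1, d2, d3, d4, d5, d6⟩ := hu.1
  obtain ⟨-, -, e3, -, e5, e6⟩ := ht.1
  have hts : ¬ Adj A t s := by rw [ht.2]; simp [d6.symm, d3.symm, d5.symm, hss']
  have hxr : ¬ Adj A x r := by rw [hx.2]; simp [d2.symm, d4.symm, d6, e6]
  have hyq : ¬ Adj A y q := by rw [hy.2]; simp [d1.symm, d4, d5, e5]
  have hzp : ¬ Adj A z p := by rw [hz.2]; simp [d1, d2, d3, e3]
  have hus' : ¬ Adj A u s' := by rw [hu.2]; simp [e3.symm, e5.symm, e6.symm, hss'.symm]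
  have three : ∀ {e f p q r s : V}, Nb4 A e p q r s → e ≠ f → ¬ Adj A f s →
      A e p * A p f + A e q * A q f + A e r * A r f = 0 := by
    intro e f p q r s he hef hs
    have h3 := h.sum4 he hef
    rw [eq_zero_of_not_adj fun h' => hs (h.symm h')] at h3
    simpa using h3
  have ratio : ∀ {ω : ℂ} {e p q r s : V}, ω ^ 2 + ω + 1 = 0 → Nb4 A u p q r s → u ≠ e →
      Adj A e p → Adj A e q → Adj A e r → ¬ Adj A e s →
      (A e q * A q u = A e p * A p u * ω ∧ A e r * A r u = A e p * A p u * ω ^ 2) ∨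
        (A e q * A q u = A e p * A p u * ω ^ 2 ∧ A e r * A r u = A e p * A p u * ω) := by
    intro ω e p q r s hω hu hue hp hq hr hs
    obtain ⟨k1, k2, k3, -⟩ := h.nb4_adj hu
    have h3 := three hu hue hs
    have h4 := congrArg star h3
    simp only [star_add, star_mul', ← h.herm, star_zero] at h4
    have := eq_omega_mul (x := A e p * A p u) (y := A e q * A q u) (z := A e r * A r u)
      (x' := A u p * A p e) (y' := A u q * A q e) (z' := A u r * A r e) hω
      (by linear_combination h4) h3
      (by linear_combination (A e p * A p e) * m k1 + m hp)
      (by linear_combination (A e q * A q e) * m k2 + m hq)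
      (by linear_combination (A e r * A r e) * m k3 + m hr)
    simpa only [mul_comm] using this
  have nT : ∀ {x y z w : V}, Adj A x y → Adj A z w → ‖A x y * A z w‖ = 1 := fun h1 h2 => by
    simp [n h1, n h2]
  -- The choice `star φ` corresponds to the converse graph.
  obtain ⟨ω, hωφ, ht1, ht2⟩ : ∃ ω : ℂ, (ω = φ ∨ ω = star φ) ∧
      A t q * A q u = A t p * A p u * ω ∧ A t r * A r u = A t p * A p u * ω ^ 2 := by
    rcases ratio φ_sq_add hu ut htp htq htr hts with h3 | h3
    · exact ⟨φ, Or.inl rfl, h3⟩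
    · refine ⟨star φ, Or.inr rfl, ?_⟩
      rw [star_φ]
      exact ⟨h3.1, by rw [h3.2]; linear_combination -A t p * A p u * φ * φ_cubed⟩
  have hω : ω ^ 2 + ω + 1 = 0 := by
    rcases hωφ with rfl | rfl
    · exact φ_sq_add
    · rw [star_φ]; linear_combination φ_sq_add + φ * φ_cubed
  have nω : ‖ω‖ = 1 := by
    rcases hωφ with rfl | rfl
    · exact norm_φ
    · exact norm_star_of_norm norm_φ
  have sω : star ω = ω ^ 2 := by
    have := star_mul_of_norm nω
    linear_combination ω ^ 2 * this - star ω * (ω - 1) * hω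
  have ω3 : ω ^ 3 = 1 := by linear_combination (ω - 1) * hω
  -- Rows with equal normalised entries in two shared columns would have an inner product consisting
  -- of a term of modulus 2 and one of modulus 1.
  have bad : ∀ {e f c d g : V} {S R T T' α β : ℂ}, ‖S‖ = 1 → ‖R‖ = 1 → ‖T‖ = 1 → ‖T'‖ = 1 →
      ‖α‖ = 1 → ‖β‖ = 1 → A e c * A c f + A e d * A d f + A e g * A g f = 0 → Adj A e g →
      Adj A f g → A e c * T = S * α → A f c * T = R * α → A e d * T' = S * β →
      A f d * T' = R * β → False := by
    intro e f c d g S R T T' α β nS nR nT nT' nα nβ hsum h1 h2 h3 h4 h5 h6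
    rw [h.path_eq nT h3 h4, h.path_eq nT' h5 h6, mul_star_of_norm nα, mul_star_of_norm nβ] at hsum
    have := congrArg norm (eq_neg_of_add_eq_zero_right hsum)
    rw [norm_mul, n h1, n (h.symm h2), norm_neg, ← mul_add, norm_mul, norm_mul,
      norm_star_of_norm nR, nS] at this
    norm_num at this
  have nω2 : ‖ω ^ 2‖ = 1 := by simp [nω]
  have n1 : ‖(1 : ℂ)‖ = 1 := norm_one
  have one : ∀ z : ℂ, z = z * 1 := fun z => (mul_one z).symm
  have sp := n (h.symm hup)
  have sq' := n (h.symm huq)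
  have sr := n (h.symm hur)
  have ss := n (h.symm hus)
  obtain ⟨hx1, hx2⟩ : A x q * A q u = A x p * A p u * ω ^ 2 ∧ A x s * A s u = A x p * A p u * ω := by
    refine (ratio hω hu.swap34 ux hxp hxq hxs hxr).resolve_left fun h3 => ?_
    exact bad (nT htp (h.symm hup)) (nT hxp (h.symm hup)) sp sq' n1 nω
      (three ht.swap34 tx hxr) hts' hxs' (one _) (one _) ht1 h3.1
  obtain ⟨hy1, hy2⟩ : A y r * A r u = A y p * A p u * ω ∧ A y s * A s u = A y p * A p u * ω ^ 2 := by
    refine (ratio hω hu.swap23.swap34 uy hyp hyr hys hyq).resolve_right fun h3 => ?_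
    exact bad (nT htp (h.symm hup)) (nT hyp (h.symm hup)) sp sr n1 nω2
      (three ht.swap23.swap34 ty hyq) hts' hys' (one _) (one _) ht2 h3.1
  obtain ⟨hz1, hz2⟩ : A z r * A r u = A z q * A q u * ω ^ 2 ∧ A z s * A s u = A z q * A q u * ω := by
    refine (ratio hω hu.swap12.swap23.swap34 uz hzq hzr hzs hzp).resolve_left fun h3 => ?_
    refine bad (R := A z q * A q u * ω ^ 2) (nT htp (h.symm hup)) ?_ sq' sr nω nω2
      (three ht.swap12.swap23.swap34 tz hzp) hts' hzs' ht1 ?_ ht2 ?_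
    · rw [norm_mul, nT hzq (h.symm huq), nω2, one_mul]
    · linear_combination -(A z q * A q u) * ω3
    · linear_combination h3.1 - A z q * A q u * ω * ω3
  have ht3 : A t s' * (A s' t * (A t p * A p u)) = A t p * A p u * 1 := by
    linear_combination A t p * A p u * m hts'
  have ns' : ‖A s' t * (A t p * A p u)‖ = 1 := by
    rw [norm_mul, n (h.symm hts'), nT htp (h.symm hup), one_mul]
  have hx3 : A x s' * (A s' t * (A t p * A p u)) = A x p * A p u * ω ^ 2 := by
    have h3 := three ht.swap34 tx hxr
    rw [h.path_eq sp (one _) (one _), h.path_eq sq' ht1 hx1, ← mul_add] at h3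
    refine h.entry_eq (nT htp (h.symm hup)) ns' n1 ht3 h3 ?_
    simp only [star_pow, sω, star_one]
    linear_combination hω + (ω ^ 2 + ω) * ω3
  have hy3 : A y s' * (A s' t * (A t p * A p u)) = A y p * A p u * ω := by
    have h3 := three ht.swap23.swap34 ty hyq
    rw [h.path_eq sp (one _) (one _), h.path_eq sr ht2 hy1, ← mul_add] at h3
    refine h.entry_eq (nT htp (h.symm hup)) ns' n1 ht3 h3 ?_
    simp only [sω, star_one]
    linear_combination hω + ω * ω3
  have hz3 : A z s' * (A s' t * (A t p * A p u)) = A z q * A q u * ω := by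
    have h3 := three ht.swap12.swap23.swap34 tz hzp
    rw [h.path_eq sq' ht1 (one _), h.path_eq sr ht2 hz1, ← mul_add] at h3
    refine h.entry_eq (nT htp (h.symm hup)) ns' n1 ht3 h3 ?_
    simp only [star_pow, sω, star_one]
    linear_combination hω + (ω ^ 3 + 1) * ω3
  have hW : ∀ i j, A (e (Sum.inl i)) (e (Sum.inr j)) *
      ![A s u, A r u * ω, A p u * ω, A q u, A s' t * (A t p * A p u)] j =
      ![A t p * A p u, A x p * A p u * ω, A z q * A q u, A y p * A p u * ω, 1] i *
        !![0, 1, ω, ω, 1; 1, 0, 1, ω, ω; ω, 1, 0, 1, ω; ω, ω, 1, 0, 1; 1, ω, ω, 1, 0] i j := by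
    intro i j
    rw [her, hec]
    fin_cases i <;> fin_cases j <;> simp [eq_zero_of_not_adj hts, eq_zero_of_not_adj hxr,
      eq_zero_of_not_adj hyq, eq_zero_of_not_adj hzp, eq_zero_of_not_adj hus']
    · linear_combination ω * ht2 + (A t p * A p u) * ω3
    · ring
    · linear_combination ht1
    · linear_combination ht3
    · linear_combination hx2
    · ring
    · linear_combination hx1
    · linear_combination hx3
    · linear_combination hz2
    · linear_combination ω * hz1 + (A z q * A q u) * ω3
    · linear_combination hz3
    · linear_combination hy2
    · linear_combination ω * hy1
    · ring
    · linear_combination hy3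
    · linear_combination m hus
    · linear_combination ω * m hur
    · linear_combination ω * m hup
    · linear_combination m huq
  refine h.mswitch_IG unitEntries_W₅ e he
    ![A t p * A p u, A x p * A p u * ω, A z q * A q u, A y p * A p u * ω, 1]
    ![A s u, A r u * ω, A p u * ω, A q u, A s' t * (A t p * A p u)] ?_ ?_ ?_
  · intro i
    fin_cases i <;> simp [n htp, n hxp, n hzq, n hyp, sp, sq', nω]
  · intro i
    fin_cases i <;> simp [n htp, n (h.symm hts'), sp, sq', sr, ss, nω]
  · have hcyc : ∀ ω : ℂ, cyclicMatrix ![0, 1, ω, ω, 1] =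
        !![0, 1, ω, ω, 1; 1, 0, 1, ω, ω; ω, 1, 0, 1, ω; ω, ω, 1, 0, 1; 1, ω, ω, 1, 0] := by
      intro ω; ext i j; fin_cases i <;> fin_cases j <;> rfl
    rcases hωφ with rfl | rfl
    · left
      rw [W₅, hcyc]
      exact hW
    · right
      intro i j
      rw [hW, W₅, hcyc]
      fin_cases i <;> fin_cases j <;> simp

end WeighingMatrices

end GainGraph

namespace GainGraph

/-! ### The complement of the Fano plane and the graph `IG(W₇)`. -/

section SevenPoints

variable {V : Type u} [Fintype V] [DecidableEq V] {A : Matrix V V ℂ}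

/-- In this order row `i` consists of the columns `i + d` modulo 7 with `d` in the difference set
`{0, 1, 2, 4}`, the support of `W₇`. -/
theorem Quadratic.exists_equiv_W₇ (h : Quadratic A 0 4)
    (hfree : ∀ u p q, Adj A u p → Adj A u q → ¬ Adj A p q)
    {u b₁₂ b₁₃ b₁₄ b₂₃ b₂₄ b₃₄ p q r s x y w : V}
    (hF : SevenBySeven A u b₁₂ b₁₃ b₁₄ b₂₃ b₂₄ b₃₄ p q r s x y w) :
    ∃ e : Fin 7 ⊕ Fin 7 ≃ V,
      (∀ i, e (Sum.inl i) = ![u, b₁₂, b₁₄, b₃₄, b₂₄, b₁₃, b₂₃] i) ∧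
      (∀ i, e (Sum.inr i) = ![r, q, p, y, s, x, w] i) ∧ ∀ i j, Adj A (e i) (e j) ↔ bipAdj
        ![[2, 1, 0, 4], [2, 1, 5, 3], [2, 4, 3, 6], [0, 4, 5, 3], [1, 4, 5, 6], [2, 0, 5, 6],
          [1, 0, 3, 6]] i j := by
  obtain ⟨⟨hu, h12, h13, h14, h23, h24, h34⟩, hp, hq, hr, hs, hx, hy, hw⟩ := hF
  have h1 : ∀ i v, Adj A (![u, b₁₂, b₁₄, b₃₄, b₂₄, b₁₃, b₂₃] i) v ↔
      ∃ j ∈ ![[2, 1, 0, 4], [2, 1, 5, 3], [2, 4, 3, 6], [0, 4, 5, 3], [1, 4, 5, 6], [2, 0, 5, 6],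
          [1, 0, 3, 6]] i, v = ![r, q, p, y, s, x, w] j := by
    intro i
    fin_cases i
    exacts [Nb4.mem_iff hu, Nb4.mem_iff h12, Nb4.mem_iff h14, Nb4.mem_iff h34, Nb4.mem_iff h24,
      Nb4.mem_iff h13, Nb4.mem_iff h23]
  have h2 : ∀ j v, Adj A (![r, q, p, y, s, x, w] j) v →
      ∃ i, v = ![u, b₁₂, b₁₄, b₃₄, b₂₄, b₁₃, b₂₃] i := by
    have key := fun {e v : V} {i j k l : Fin 7} => Nb4.exists_eq (A := A)
      (c := ![u, b₁₂, b₁₄, b₃₄, b₂₄, b₁₃, b₂₃]) (e := e) (i := i) (j := j) (k := k) (l := l) (v := v)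
    intro i v
    fin_cases i
    exacts [key (i := 0) (j := 5) (k := 6) (l := 3) hr, key (i := 0) (j := 1) (k := 6) (l := 4) hq,
      key (i := 0) (j := 1) (k := 5) (l := 2) hp, key (i := 1) (j := 2) (k := 6) (l := 3) hy,
      key (i := 0) (j := 2) (k := 4) (l := 3) hs, key (i := 1) (j := 5) (k := 4) (l := 3) hx,
      key (i := 5) (j := 2) (k := 6) (l := 4) hw]
  have hinj : Function.Injective ![u, b₁₂, b₁₄, b₃₄, b₂₄, b₁₃, b₂₃] := by
    have d1 := hp.1
    have d2 := hq.1
    have d3 := hr.1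
    have d4 := hs.1
    have d5 := hx.1
    have d6 := hy.1
    have d7 := hw.1
    clear h1 h2 hu h12 h13 h14 h23 h24 h34 hp hq hr hs hx hy hw h hfree
    rw [← List.nodup_ofFn]
    simp
    grind
  have hinj' : Function.Injective ![r, q, p, y, s, x, w] := by
    have d1 := hu.1
    have d2 := h12.1
    have d3 := h13.1
    have d4 := h14.1
    have d5 := h23.1
    have d6 := h24.1
    have d7 := h34.1
    clear h1 h2 hu h12 h13 h14 h23 h24 h34 hp hq hr hs hx hy hw h hfree
    rw [← List.nodup_ofFn]
    simp
    grind
  have hup := h.nb4_adj hu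
  -- If the column `c` were `u`, then `u`, `p`, `b` would form a triangle.
  have hfar : ∀ {b c}, Adj A b c → Adj A b p → Adj A u p → u ≠ c := by
    rintro b c h1 h2 h3 rfl
    exact hfree p b u (h.symm h2) (h.symm h3) h1
  refine h.exists_bipartite_equiv _ _ _ hinj hinj' h1 h2
    (h.rows_ne_cols _ _ (fun i v hv => by
      obtain ⟨j, -, hj⟩ := (h1 i v).1 hv; exact ⟨j, hj⟩) h2 0 fun j => ?_)
  fin_cases j
  exacts [h.ne hup.2.2.1, h.ne hup.2.1, h.ne hup.1,
    hfar (h.nb4_adj h12).2.2.2 (h.nb4_adj h12).1 hup.1, h.ne hup.2.2.2,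
    hfar (h.nb4_adj h12).2.2.1 (h.nb4_adj h12).1 hup.1,
    hfar (h.nb4_adj h13).2.2.2 (h.nb4_adj h13).1 hup.1]

/-- Rows sharing exactly two columns have opposite terms there, so three normalised entries of the
`2 × 2` block determine the fourth. -/
theorem Quadratic.quad_entry (h : Quadratic A 0 4) {e f c d g k : V} {S R T T' α β α' β' : ℂ}
    (he : Nb4 A e c d g k) (hef : e ≠ f) (hg : ¬ Adj A f g) (hk : ¬ Adj A f k) (hS : ‖S‖ = 1)
    (hT : ‖T‖ = 1) (hT' : ‖T'‖ = 1) (h1 : A e c * T = S * α) (h2 : A f c * T = R * β)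
    (h3 : A e d * T' = S * α') (hα' : ‖α'‖ = 1) (h4 : α * star β + α' * star β' = 0) :
    A f d * T' = R * β' := by
  have h5 := h.two_common he hef hg hk
  rw [h.path_eq hT h1 h2] at h5
  exact h.entry_eq hS hT' hα' h3 h5 h4

/-- Scaling makes one entry 1 in every row and column along a spanning tree of the incidence graph.
Every other entry is reached by `2 × 2` blocks and becomes 1 or -1. -/
theorem Quadratic.mswitch_W₇ (h : Quadratic A 0 4)
    (hfree : ∀ u p q, Adj A u p → Adj A u q → ¬ Adj A p q)
    {u b₁₂ b₁₃ b₁₄ b₂₃ b₂₄ b₃₄ p q r s x y w : V}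
    (hF : SevenBySeven A u b₁₂ b₁₃ b₁₄ b₂₃ b₂₄ b₃₄ p q r s x y w) :
    MSwitch A (IG W₇ unitEntries_W₇).gainMatrix := by
  obtain ⟨e, her, hec, he⟩ := h.exists_equiv_W₇ hfree hF
  have hne : ∀ i j, i ≠ j → ![u, b₁₂, b₁₄, b₃₄, b₂₄, b₁₃, b₂₃] i ≠
      ![u, b₁₂, b₁₄, b₃₄, b₂₄, b₁₃, b₂₃] j := fun i j hij h' => by
    rw [← her, ← her] at h'
    exact hij (Sum.inl_injective (e.injective h'))
  have hP : ∀ i j, j ∉ (![[2, 1, 0, 4], [2, 1, 5, 3], [2, 4, 3, 6], [0, 4, 5, 3], [1, 4, 5, 6],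
      [2, 0, 5, 6], [1, 0, 3, 6]] : Fin 7 → List (Fin 7)) i →
      ¬ Adj A (![u, b₁₂, b₁₄, b₃₄, b₂₄, b₁₃, b₂₃] i) (![r, q, p, y, s, x, w] j) := by
    intro i j
    rw [← her, ← hec, he]
    exact id
  obtain ⟨⟨hu, h12, h13, h14, h23, h24, h34⟩, -⟩ := hF
  obtain ⟨up, uq, ur, us⟩ := h.nb4_adj hu
  obtain ⟨p12, q12, x12, y12⟩ := h.nb4_adj h12
  obtain ⟨p13, r13, x13, w13⟩ := h.nb4_adj h13
  have p14 := (h.nb4_adj h14).1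
  have q23 := (h.nb4_adj h23).1
  have q24 := (h.nb4_adj h24).1
  have r34 := (h.nb4_adj h34).1
  have n := fun {x y : V} (hxy : Adj A x y) => h.norm_eq_one hxy
  have m := fun {x y : V} (hxy : Adj A x y) => h.mul_swap hxy
  have n1 : ‖(1 : ℂ)‖ = 1 := norm_one
  have nn : ‖(-1 : ℂ)‖ = 1 := by simp
  have one : ∀ z : ℂ, z = z * 1 := fun z => (mul_one z).symm
  have tp := n (h.symm up)
  have tq := n (h.symm uq)
  have tr := n (h.symm ur)
  have ts := n (h.symm us)
  have nT : ∀ {x y z w : V}, Adj A x y → Adj A z w → ‖A x y * A z w‖ = 1 := fun h1 h2 => by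
    simp [n h1, n h2]
  have unit : ∀ {c}, Adj A u c → A u c * A c u = 1 * 1 := fun h1 => by rw [m h1, one_mul]
  have s12 := nT p12 (h.symm up)
  have s13 := nT p13 (h.symm up)
  have s14 := nT p14 (h.symm up)
  have N12q := h.quad_entry (β' := -1) hu (hne 0 1 (by decide)) (hP 1 0 (by decide))
    (hP 1 4 (by decide)) n1 tp tq (unit up) (one (A b₁₂ p * A p u)) (unit uq) n1 (by simp)
  have N13r := h.quad_entry (β' := -1) hu.swap23 (hne 0 5 (by decide)) (hP 5 1 (by decide))
    (hP 5 4 (by decide)) n1 tp tr (unit up) (one (A b₁₃ p * A p u)) (unit ur) n1 (by simp)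
  have N14s := h.quad_entry (β' := -1) hu.swap34.swap23 (hne 0 2 (by decide)) (hP 2 1 (by decide))
    (hP 2 0 (by decide)) n1 tp ts (unit up) (one (A b₁₄ p * A p u)) (unit us) n1 (by simp)
  have N23r := h.quad_entry (β' := -1) hu.swap12.swap23 (hne 0 6 (by decide)) (hP 6 2 (by decide))
    (hP 6 4 (by decide)) n1 tq tr (unit uq) (one (A b₂₃ q * A q u)) (unit ur) n1 (by simp)
  have N24s := h.quad_entry (β' := -1) hu.swap12.swap34.swap23 (hne 0 4 (by decide))
    (hP 4 2 (by decide)) (hP 4 0 (by decide)) n1 tq ts (unit uq) (one (A b₂₄ q * A q u))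
    (unit us) n1 (by simp)
  have N34s := h.quad_entry (β' := -1) hu.swap23.swap12.swap34.swap23 (hne 0 3 (by decide))
    (hP 3 2 (by decide)) (hP 3 1 (by decide)) n1 tr ts (unit ur) (one (A b₃₄ r * A r u))
    (unit us) n1 (by simp)
  have tx : ‖A x b₁₂ * (A b₁₂ p * A p u)‖ = 1 := by rw [norm_mul, n (h.symm x12), s12, one_mul]
  have ty : ‖A y b₁₂ * (A b₁₂ p * A p u)‖ = 1 := by rw [norm_mul, n (h.symm y12), s12, one_mul]
  have tw : ‖A w b₁₃ * (A b₁₃ p * A p u)‖ = 1 := by rw [norm_mul, n (h.symm w13), s13, one_mul]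
  have N12x : A b₁₂ x * (A x b₁₂ * (A b₁₂ p * A p u)) = A b₁₂ p * A p u * 1 := by
    linear_combination A b₁₂ p * A p u * m x12
  have N12y : A b₁₂ y * (A y b₁₂ * (A b₁₂ p * A p u)) = A b₁₂ p * A p u * 1 := by
    linear_combination A b₁₂ p * A p u * m y12
  have N13w : A b₁₃ w * (A w b₁₃ * (A b₁₃ p * A p u)) = A b₁₃ p * A p u * 1 := by
    linear_combination A b₁₃ p * A p u * m w13
  have N13x := h.quad_entry (β' := -1) h12.swap23 (hne 1 5 (by decide)) (hP 5 1 (by decide))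
    (hP 5 3 (by decide)) s12 tp tx (one _) (one (A b₁₃ p * A p u)) N12x n1 (by simp)
  have N14y := h.quad_entry (β' := -1) h12.swap34.swap23 (hne 1 2 (by decide)) (hP 2 1 (by decide))
    (hP 2 5 (by decide)) s12 tp ty (one _) (one (A b₁₄ p * A p u)) N12y n1 (by simp)
  have N14w := h.quad_entry (β' := -1) h13.swap34.swap23 (hne 5 2 (by decide)) (hP 2 0 (by decide))
    (hP 2 5 (by decide)) s13 tp tw (one _) (one (A b₁₄ p * A p u)) N13w n1 (by simp)
  have N23y := h.quad_entry (β' := 1) h12.swap12.swap34.swap23 (hne 1 6 (by decide))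
    (hP 6 2 (by decide)) (hP 6 5 (by decide)) s12 tq ty N12q (one (A b₂₃ q * A q u)) N12y n1
    (by simp)
  have N23w := h.quad_entry (β' := -1) h13.swap12.swap34.swap23 (hne 5 6 (by decide))
    (hP 6 2 (by decide)) (hP 6 5 (by decide)) s13 tr tw N13r N23r N13w n1 (by simp)
  have N24x := h.quad_entry (β' := 1) h12.swap12.swap23 (hne 1 4 (by decide)) (hP 4 2 (by decide))
    (hP 4 3 (by decide)) s12 tq tx N12q (one (A b₂₄ q * A q u)) N12x n1 (by simp)
  have N24w := h.quad_entry (β' := 1) h13.swap23.swap12.swap34.swap23 (hne 5 4 (by decide))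
    (hP 4 2 (by decide)) (hP 4 0 (by decide)) s13 tx tw N13x N24x N13w n1 (by simp)
  have N34x := h.quad_entry (β' := -1) h13.swap12.swap23 (hne 5 3 (by decide)) (hP 3 2 (by decide))
    (hP 3 6 (by decide)) s13 tr tx N13r (one (A b₃₄ r * A r u)) N13x nn (by simp)
  have N34y := h.quad_entry (β' := 1) h14.swap12.swap23 (hne 2 3 (by decide)) (hP 3 2 (by decide))
    (hP 3 6 (by decide)) s14 ts ty N14s N34s N14y nn (by simp)
  -- The minus signs on rows `b₁₄`, `b₃₄` and column `r` adapt the normalised signs to those of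
  -- `W₇`.
  refine h.mswitch_IG unitEntries_W₇ e he
    ![1, A b₁₂ p * A p u, -(A b₁₄ p * A p u), -(A b₃₄ r * A r u), A b₂₄ q * A q u, A b₁₃ p * A p u,
      A b₂₃ q * A q u]
    ![-A r u, A q u, A p u, A y b₁₂ * (A b₁₂ p * A p u), A s u, A x b₁₂ * (A b₁₂ p * A p u),
      A w b₁₃ * (A b₁₃ p * A p u)] ?_ ?_ (Or.inl ?_)
  · intro i
    fin_cases i
    exacts [n1, s12, (norm_neg _).trans s14, (norm_neg _).trans (nT r34 (h.symm ur)),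
      nT q24 (h.symm uq), s13, nT q23 (h.symm uq)]
  · intro i
    fin_cases i
    exacts [(norm_neg _).trans tr, tq, tp, ty, ts, tx, tw]
  · have hcyc : W₇ = !![-1, 1, 1, 0, 1, 0, 0; 0, -1, 1, 1, 0, 1, 0; 0, 0, -1, 1, 1, 0, 1;
        1, 0, 0, -1, 1, 1, 0; 0, 1, 0, 0, -1, 1, 1; 1, 0, 1, 0, 0, -1, 1; 1, 1, 0, 1, 0, 0, -1] := by
      ext i j; fin_cases i <;> fin_cases j <;> rfl
    have hz := fun i j hij => eq_zero_of_not_adj (hP i j hij)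
    intro i j
    rw [her, hec, hcyc]
    by_cases hij : j ∈ (![[2, 1, 0, 4], [2, 1, 5, 3], [2, 4, 3, 6], [0, 4, 5, 3], [1, 4, 5, 6],
      [2, 0, 5, 6], [1, 0, 3, 6]] : Fin 7 → List (Fin 7)) i
    · clear hz hP hne her hec he hcyc
      fin_cases i <;> fin_cases j <;> first | exact absurd hij (by decide) | skip
      · exact (mul_neg _ _).trans ((congrArg _ (unit ur)).trans (by simp))
      · exact unit uq
      · exact unit up
      · exact unit us
      · exact N12q
      · exact one _
      · exact N12y
      · exact N12x
      · exact (by simp : A b₁₄ p * A p u = -(A b₁₄ p * A p u) * -1)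
      · exact N14y.trans (by simp)
      · exact N14s.trans (by simp)
      · exact N14w.trans (by simp)
      · exact (by simp : A b₃₄ r * -A r u = -(A b₃₄ r * A r u) * 1)
      · exact N34y.trans (by simp)
      · exact N34s.trans (by simp)
      · exact N34x.trans (by simp)
      · exact one _
      · exact N24s
      · exact N24x
      · exact N24w
      · exact (mul_neg _ _).trans ((congrArg _ N13r).trans (by simp))
      · exact one _
      · exact N13x
      · exact N13w
      · exact (mul_neg _ _).trans ((congrArg _ N23r).trans (by simp))
      · exact one _
      · exact N23y
      · exact N23w
    · rw [hz i j hij, zero_mul]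
      clear hz hP hne her hec he hcyc
      fin_cases i <;> fin_cases j <;> first | exact (mul_zero _).symm | exact absurd (by decide) hij

end SevenPoints

end GainGraph

namespace GainGraph

/-! ### Degree four with opposite eigenvalues and no twins. -/

section WithoutTwins

variable {V : Type u} [Fintype V] [DecidableEq V] {A : Matrix V V ℂ} {a : ℝ} {k : ℕ}

/-- The gain graph with gain matrix `A` is switching isomorphic to the negative double of one of
`W₄`, `IG(W₃)` and `ND(IG(W₂))`. -/
def IsNegativeDoubleOfDegreeThree (A : Matrix V V ℂ) : Prop :=
  MSwitch A W₄.ND.gainMatrix ∨ MSwitch A (IG W₃ unitEntries_W₃).ND.gainMatrix ∨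
    MSwitch A (IG W₂ unitEntries_W₂).ND.ND.gainMatrix

omit [Fintype V] [DecidableEq V] in
theorem Quadratic.isNegativeDouble {H : Type w} [Fintype H] [DecidableEq H] [Nonempty H]
    {B : Matrix H H ℂ} (hB : Quadratic B 0 3) (hAB : MSwitch A (GainGraph.ndMatrix B)) :
    IsNegativeDoubleOfDegreeThree A := by
  rcases hB.degree_three le_rfl (Classical.arbitrary H) with h | h | h | h
  -- The complete graph would need eigenvalue sum 2 instead of 0.
  · norm_num at h
  · left
    rw [gainMatrix_ND]
    exact hAB.trans h.ndMatrix
  · right; left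
    rw [gainMatrix_ND]
    exact hAB.trans h.ndMatrix
  · right; right
    rw [gainMatrix_ND]
    exact hAB.trans h.ndMatrix

/-- The structure consists of a `K_{3,3}` on `u, t, f` and `p, q, r`, another on `x, y, z` and `s,
s', s''`, and a perfect matching between them. -/
theorem Quadratic.isNegativeDouble_of_sixBySix (h : Quadratic A 0 4)
    {u t f x y z p q r s s' s'' : V} (hF : SixBySix A u t f x y z p q r s s' s'') :
    IsNegativeDoubleOfDegreeThree A := by
  obtain ⟨-, ⟨hu, ht, hf, hx, hy, hz⟩, hp, hq, hr, hs, hs', hs''⟩ := hF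
  have h1 : ∀ i v, Adj A (![u, t, f, x, y, z] i) v ↔
      ∃ j ∈ ![[0, 1, 2, 3], [0, 1, 2, 4], [0, 1, 2, 5], [0, 3, 4, 5], [1, 3, 4, 5], [2, 3, 4, 5]] i,
        v = ![p, q, r, s, s', s''] j := by
    intro i
    fin_cases i
    exacts [Nb4.mem_iff hu, Nb4.mem_iff ht, Nb4.mem_iff hf, Nb4.mem_iff hx, Nb4.mem_iff hy,
      Nb4.mem_iff hz]
  have h2 : ∀ j v, Adj A (![p, q, r, s, s', s''] j) v → ∃ i, v = ![u, t, f, x, y, z] i := by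
    have key := fun {e v : V} {i j k l : Fin 6} => Nb4.exists_eq (A := A)
      (c := ![u, t, f, x, y, z]) (e := e) (i := i) (j := j) (k := k) (l := l) (v := v)
    intro i v
    fin_cases i
    exacts [key (i := 0) (j := 1) (k := 2) (l := 3) hp, key (i := 0) (j := 1) (k := 2) (l := 4) hq,
      key (i := 0) (j := 1) (k := 2) (l := 5) hr, key (i := 0) (j := 3) (k := 4) (l := 5) hs,
      key (i := 1) (j := 3) (k := 4) (l := 5) hs', key (i := 2) (j := 3) (k := 4) (l := 5) hs'']
  have hinj : Function.Injective ![u, t, f, x, y, z] := by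
    have d1 := hp.1
    have d2 := hq.1
    have d3 := hr.1
    have d4 := hs.1
    have d5 := hs'.1
    have d6 := hs''.1
    clear h1 h2 hu ht hf hx hy hz hp hq hr hs hs' hs'' h
    rw [← List.nodup_ofFn]
    simp
    grind
  have hinj' : Function.Injective ![p, q, r, s, s', s''] := by
    have d1 := hu.1
    have d2 := ht.1
    have d3 := hf.1
    have d4 := hx.1
    have d5 := hy.1
    have d6 := hz.1
    clear h1 h2 hu ht hf hx hy hz hp hq hr hs hs' hs'' h hinj
    rw [← List.nodup_ofFn]
    simp
    grind
  have hu' := h.nb4_adj hu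
  -- To see that the graph is bipartite it remains to separate `u` from the columns `s'` and `s''`,
  -- which are not its neighbours. A coincidence propagates through the neighbourhoods until it
  -- contradicts their distinctness.
  have aux : ∀ {t f s' s''}, Nb4 A t p q r s' → Nb4 A f p q r s'' → t ≠ f → u ≠ t → u ≠ f →
      Nb4 A s' t x y z → Nb4 A p u t f x → Nb4 A y q s s' s'' → Nb4 A z r s s' s'' → u ≠ s' := by
    intro t f s' s'' ht hf htf hut huf hs' hp hy hz hus
    subst hus
    have htp := h.nb4_adj ht
    have hfp := h.nb4_adj hf
    have hts : t = s := by
      rcases (hu.2 t).1 (h.symm htp.2.2.2) with rfl | rfl | rfl | rfl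
      exacts [absurd rfl (h.ne htp.1), absurd rfl (h.ne htp.2.1), absurd rfl (h.ne htp.2.2.1), rfl]
    subst hts
    have hpf := (h.nb4_adj hp).2.2.1
    rcases (hs'.2 p).1 hu'.1 with rfl | rfl | rfl | rfl
    · exact h.ne htp.1 rfl
    · exact h.ne (h.nb4_adj hp).2.2.2 rfl
    · rcases (hy.2 f).1 hpf with rfl | rfl | rfl | rfl
      exacts [h.ne hfp.2.1 rfl, htf rfl, huf rfl, h.ne hfp.2.2.2 rfl]
    · rcases (hz.2 f).1 hpf with rfl | rfl | rfl | rfl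
      exacts [h.ne hfp.2.2.1 rfl, htf rfl, huf rfl, h.ne hfp.2.2.2 rfl]
  have d1 := hp.1
  have e5 := aux ht hf d1.2.2.2.1 d1.1 d1.2.1 hs' hp hy hz
  have e6 := aux hf ht d1.2.2.2.1.symm d1.2.1 d1.1 hs'' hp.swap23 hy.swap34 hz.swap34
  obtain ⟨e, -, -, he⟩ := h.exists_bipartite_equiv _ _ _ hinj hinj' h1 h2
    (h.rows_ne_cols _ _ (fun i v hv => by
      obtain ⟨j, -, hj⟩ := (h1 i v).1 hv; exact ⟨j, hj⟩) h2 0 fun j => by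
        fin_cases j
        exacts [h.ne hu'.1, h.ne hu'.2.1, h.ne hu'.2.2.1, h.ne hu'.2.2.2, e5, e6])
  obtain ⟨B, hB, hAB⟩ := h.exists_ndMatrix_of_bipartite e he
    ![Sum.inl 0, Sum.inl 1, Sum.inl 2, Sum.inr 0, Sum.inr 1, Sum.inr 2]
    ![Sum.inr 3, Sum.inr 4, Sum.inr 5, Sum.inl 3, Sum.inl 4, Sum.inl 5] (by decide) (by decide)
  exact hB.isNegativeDouble hAB

/-- The four-dimensional cube is two three-dimensional cubes joined by a class of parallel edges.
Most of the work is to show that the sixteen named vertices are distinct. -/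
theorem Quadratic.isNegativeDouble_of_eightByEight (h : Quadratic A 0 4) (hc : AtMostTwoCommon A)
    (hfree : ∀ u p q, Adj A u p → Adj A u q → ¬ Adj A p q)
    {u b₁₂ b₁₃ b₁₄ b₂₃ b₂₄ b₃₄ z p q r s x y w v : V}
    (hF : EightByEight A u b₁₂ b₁₃ b₁₄ b₂₃ b₂₄ b₃₄ z p q r s x y w v) :
    IsNegativeDoubleOfDegreeThree A := by
  obtain ⟨⟨hu, h12, h13, h14, h23, h24, h34, hz⟩, hp, hq, hr, hs, hx, hy, hw, hv⟩ := hF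
  have h1 : ∀ i v', Adj A (![u, b₁₂, b₁₃, b₁₄, b₂₃, b₂₄, b₃₄, z] i) v' ↔
      ∃ j ∈ ![[0, 1, 2, 3], [0, 1, 4, 5], [0, 2, 4, 6], [0, 3, 5, 6], [1, 2, 4, 7], [1, 3, 5, 7],
        [2, 3, 6, 7], [4, 5, 6, 7]] i, v' = ![p, q, r, s, x, y, w, v] j := by
    intro i
    fin_cases i
    exacts [Nb4.mem_iff hu, Nb4.mem_iff h12, Nb4.mem_iff h13, Nb4.mem_iff h14, Nb4.mem_iff h23,
      Nb4.mem_iff h24, Nb4.mem_iff h34, Nb4.mem_iff hz]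
  have h2 : ∀ j v', Adj A (![p, q, r, s, x, y, w, v] j) v' →
      ∃ i, v' = ![u, b₁₂, b₁₃, b₁₄, b₂₃, b₂₄, b₃₄, z] i := by
    have key := fun {e v : V} {i j k l : Fin 8} => Nb4.exists_eq (A := A)
      (c := ![u, b₁₂, b₁₃, b₁₄, b₂₃, b₂₄, b₃₄, z]) (e := e) (i := i) (j := j) (k := k) (l := l)
      (v := v)
    intro i v
    fin_cases i
    exacts [key (i := 0) (j := 1) (k := 2) (l := 3) hp, key (i := 0) (j := 1) (k := 4) (l := 5) hq,
      key (i := 0) (j := 2) (k := 4) (l := 6) hr, key (i := 0) (j := 3) (k := 5) (l := 6) hs,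
      key (i := 1) (j := 2) (k := 4) (l := 7) hx, key (i := 1) (j := 3) (k := 5) (l := 7) hy,
      key (i := 2) (j := 3) (k := 6) (l := 7) hw, key (i := 4) (j := 5) (k := 6) (l := 7) hv]
  have hup := h.nb4_adj hu
  have hfar : ∀ {b c p}, Adj A b c → Adj A b p → Adj A u p → u ≠ c := by
    rintro b c p h1 h2 h3 rfl
    exact hfree p b u (h.symm h2) (h.symm h3) h1
  have hux := hfar (h.nb4_adj h12).2.2.1 (h.nb4_adj h12).1 hup.1
  have huy := hfar (h.nb4_adj h12).2.2.2 (h.nb4_adj h12).1 hup.1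
  have huw := hfar (h.nb4_adj h13).2.2.2 (h.nb4_adj h13).1 hup.1
  have huv := hfar (h.nb4_adj h23).2.2.2 (h.nb4_adj h23).1 hup.2.1
  have d1 := hu.1
  have d2 := h12.1
  have d3 := h13.1
  have d4 := h14.1
  have d5 := h23.1
  have d6 := h24.1
  have d7 := h34.1
  have d8 := hz.1
  have f1 := hp.1
  have f2 := hq.1
  have f3 := hr.1
  have f4 := hs.1
  have f5 := hx.1
  have f6 := hy.1
  have f7 := hw.1
  have f8 := hv.1
  have far : ∀ {b p q r}, u ≠ b → p ≠ q → p ≠ r → q ≠ r → Adj A u p ∧ Adj A u q ∧ Adj A u r →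
      Adj A b p → Adj A b q → ¬ Adj A b r := fun g1 g2 g3 g4 g5 g6 g7 =>
    hc _ _ _ _ _ g1 g2 g3 g4 g5.1 g5.2.1 g5.2.2 g6 g7
  obtain ⟨up, uq, ur, us⟩ := hup
  have p23 := far (r := p) f2.2.1 d1.2.2.2.1 d1.1.symm d1.2.1.symm ⟨uq, ur, up⟩
    (h.nb4_adj h23).1 (h.nb4_adj h23).2.1
  have p24 := far (r := p) f2.2.2.1 d1.2.2.2.2.1 d1.1.symm d1.2.2.1.symm ⟨uq, us, up⟩
    (h.nb4_adj h24).1 (h.nb4_adj h24).2.1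
  have p34 := far (r := p) f3.2.2.1 d1.2.2.2.2.2 d1.2.1.symm d1.2.2.1.symm ⟨ur, us, up⟩
    (h.nb4_adj h34).1 (h.nb4_adj h34).2.1
  have q13 := far (r := q) f1.2.1 d1.2.1 d1.1 d1.2.2.2.1.symm ⟨up, ur, uq⟩
    (h.nb4_adj h13).1 (h.nb4_adj h13).2.1
  have r12 := far (r := r) f1.1 d1.1 d1.2.1 d1.2.2.2.1 ⟨up, uq, ur⟩
    (h.nb4_adj h12).1 (h.nb4_adj h12).2.1
  have s12 := far (r := s) f1.1 d1.1 d1.2.2.1 d1.2.2.2.2.1 ⟨up, uq, us⟩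
    (h.nb4_adj h12).1 (h.nb4_adj h12).2.1
  have apart : ∀ {b c p : V}, Adj A b p → ¬ Adj A c p → b ≠ c := by
    rintro b c p g1 g2 rfl
    exact g2 g1
  have k1 := apart (h.nb4_adj h14).1 p23
  have k2 := apart (h.nb4_adj h13).1 p24
  have k3 := apart (h.nb4_adj h12).1 p34
  have k4 : p ≠ v := apart (h.symm (h.nb4_adj h14).1) fun h' => by
    rcases (hv.2 _).1 h' with g | g | g | g
    exacts [k1 g, f4.2.2.2.1 g, f4.2.2.2.2.1 g, f6.2.2.2.2.1 g]
  have k5 : q ≠ w := (apart (h.symm (h.nb4_adj h13).2.2.2) fun h' => q13 (h.symm h')).symm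
  have k6 : r ≠ y := (apart (h.symm (h.nb4_adj h12).2.2.2) fun h' => r12 (h.symm h')).symm
  have k7 : s ≠ x := (apart (h.symm (h.nb4_adj h12).2.2.1) fun h' => s12 (h.symm h')).symm
  have k8 : u ≠ z := apart up fun h' => by
    rcases (hz.2 _).1 h' with g | g | g | g
    exacts [d2.2.1 g, d2.2.2.1 g, d3.2.2.1 g, k4 g]
  have hinj : Function.Injective ![u, b₁₂, b₁₃, b₁₄, b₂₃, b₂₄, b₃₄, z] := by
    clear * - f1 f2 f3 f4 f5 f6 f7 f8 k1 k2 k3 k8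
    rw [← List.nodup_ofFn]
    simp
    grind
  have hinj' : Function.Injective ![p, q, r, s, x, y, w, v] := by
    clear * - d1 d2 d3 d4 d5 d6 d7 d8 k4 k5 k6 k7
    rw [← List.nodup_ofFn]
    simp
    grind
  obtain ⟨e, -, -, he⟩ := h.exists_bipartite_equiv _ _ _ hinj hinj' h1 h2
    (h.rows_ne_cols _ _ (fun i v hv => by
      obtain ⟨j, -, hj⟩ := (h1 i v).1 hv; exact ⟨j, hj⟩) h2 0 fun j => by
        fin_cases j
        exacts [h.ne up, h.ne uq, h.ne ur, h.ne us, hux, huy, huw, huv])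
  -- The matching consists of the edges parallel to `us`.
  obtain ⟨B, hB, hAB⟩ := h.exists_ndMatrix_of_bipartite e he
    ![Sum.inl 0, Sum.inr 0, Sum.inr 1, Sum.inr 2, Sum.inl 1, Sum.inl 2, Sum.inl 4, Sum.inr 4]
    ![Sum.inr 3, Sum.inl 3, Sum.inl 5, Sum.inl 6, Sum.inr 5, Sum.inr 6, Sum.inr 7, Sum.inl 7]
    (by decide) (by decide)
  exact hB.isNegativeDouble hAB

/-- The triangle extends to a `K₄`. Each of its vertices has one further neighbour, and the
requirement of a second common neighbour joins these four to one another. The graph is thus two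
copies of `K₄` with a perfect matching. -/
theorem Quadratic.isNegativeDouble_of_triangle (h : Quadratic A 0 4) (hc : AtMostTwoCommon A)
    {u p q : V} (hup : Adj A u p) (huq : Adj A u q) (hpq : Adj A p q) :
    IsNegativeDoubleOfDegreeThree A := by
  have sy := fun {x y : V} (hxy : Adj A x y) => h.symm hxy
  have ne := fun {x y : V} (hxy : Adj A x y) => h.ne hxy
  have two : ∀ {x y p q r}, Adj A x y → p ≠ q → p ≠ r → q ≠ r → Adj A x p → Adj A x q →
      Adj A y p → Adj A y q → Adj A x r → ¬ Adj A y r := fun h1 h2 h3 h4 h5 h6 h7 h8 h9 =>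
    hc _ _ _ _ _ (ne h1) h2 h3 h4 h5 h6 h9 h7 h8
  -- The vertex `r` is the second common neighbour of `u` and `p`. If `q` and `r` were not adjacent,
  -- the fourth neighbour `x` of `u` would have to be adjacent to both of them, and `p` and `x`
  -- would share `u, q, r`.
  obtain ⟨r, hur, hpr, hqr, hrq, hru, hrp⟩ : ∃ r, Adj A u r ∧ Adj A p r ∧ Adj A q r ∧ r ≠ q ∧
      r ≠ u ∧ r ≠ p := by
    obtain ⟨r, hrq, hur, hpr⟩ := h.exists_other' (ne hup) huq hpq
    obtain ⟨x, hu⟩ := h.exists_nb4_of_three ⟨ne hpq, ne hpr, hrq.symm⟩ hup huq hur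
    refine ⟨r, hur, hpr, ?_, hrq, (ne hur).symm, (ne hpr).symm⟩
    by_contra hqr
    obtain ⟨x1, h1, h2, h3⟩ := h.exists_other' (ne hur) hup (sy hpr)
    obtain ⟨x2, h4, h5, h6⟩ := h.exists_other' (ne huq) hup (sy hpq)
    have e1 : x1 = x := by
      rcases (hu.2 x1).1 h2 with rfl | rfl | rfl | rfl
      exacts [absurd rfl h1, absurd (sy h3) hqr, absurd rfl (ne h3), rfl]
    have e2 : x2 = x := by
      rcases (hu.2 x2).1 h5 with rfl | rfl | rfl | rfl
      exacts [absurd rfl h4, absurd rfl (ne h6), absurd h6 hqr, rfl]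
    rw [e1] at h2 h3
    rw [e2] at h6
    exact hc p x u q r hu.1.2.2.1 (ne huq) (ne hur) hrq.symm (sy hup) hpq hpr (sy h2) (sy h6)
      (sy h3)
  have ext : ∀ {u p q r}, Adj A u p → Adj A u q → Adj A u r → Adj A p q → Adj A p r → Adj A q r →
      ∃ s, Nb4 A u p q r s ∧ ¬ Adj A s p ∧ ¬ Adj A s q ∧ ¬ Adj A s r ∧ s ≠ u ∧ Adj A u s := by
    intro u p q r hup huq hur hpq hpr hqr
    obtain ⟨s, hu⟩ := h.exists_nb4_of_three ⟨ne hpq, ne hpr, ne hqr⟩ hup huq hur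
    obtain ⟨d1, d2, d3, d4, d5, d6⟩ := hu.1
    have hus := (h.nb4_adj hu).2.2.2
    exact ⟨s, hu, fun h' => two hup d4 d5 d6 huq hur hpq hpr hus (sy h'),
      fun h' => two huq d2 d3 d6 hup hur (sy hpq) hqr hus (sy h'),
      fun h' => two hur d1 d3 d5 hup huq (sy hpr) (sy hqr) hus (sy h'), (ne hus).symm, hus⟩
  obtain ⟨s, hu, hsp, hsq, hsr, hsu, hus⟩ := ext hup huq hur hpq hpr hqr
  obtain ⟨p', hp, hpu', hpq', hpr', hpp', hp'⟩ := ext (sy hup) hpq hpr huq hur hqr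
  obtain ⟨q', hq, hqu', hqp', hqr', hqq', hq'⟩ := ext (sy huq) (sy hpq) hqr hup hur hpr
  obtain ⟨r', hr, hru', hrp', hrq', hrr', hr'⟩ := ext (sy hur) (sy hpr) (sy hqr) hup huq hpq
  -- The vertices `s` and `p` share `u`, and `p'` is the only possible second common neighbour.
  have join : ∀ {u p q r s p'}, Nb4 A p u q r p' → s ≠ p → ¬ Adj A s q → ¬ Adj A s r →
      Adj A s u → Adj A s p' := by
    intro u p q r s p' hp hsp h1 h2 h3
    obtain ⟨x, h4, h5, h6⟩ := h.exists_other' hsp h3 (h.nb4_adj hp).1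
    rcases (hp.2 x).1 h6 with rfl | rfl | rfl | rfl
    exacts [absurd rfl h4, absurd h5 h1, absurd h5 h2, h5]
  have a1 : Adj A s p' := join hp hu.1.2.2.1.symm hsq hsr (sy hus)
  have a2 : Adj A s q' := join hq hu.1.2.2.2.2.1.symm hsp hsr (sy hus)
  have a3 : Adj A s r' := join hr hu.1.2.2.2.2.2.symm hsp hsq (sy hus)
  have a4 : Adj A p' q' := join hq.swap12 hp.1.2.2.2.2.1.symm hpu' hpr' (sy hp')
  have a5 : Adj A p' r' := join hr.swap12 hp.1.2.2.2.2.2.symm hpu' hpq' (sy hp')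
  have a6 : Adj A q' r' := join hr.swap23.swap12 hq.1.2.2.2.2.2.symm hqu' hqp' (sy hq')
  have d1 := hu.1
  have d2 := hp.1
  have d3 := hq.1
  have d4 := hr.1
  have hs : Nb4 A s u p' q' r' :=
    h.nb4_of_four ⟨d2.2.2.1, d3.2.2.1, d4.2.2.1, ne a4, ne a5, ne a6⟩
      (sy hus) a1 a2 a3
  have hsp' : Nb4 A p' p s q' r' :=
    h.nb4_of_four ⟨d1.2.2.1, d3.2.2.2.2.1, d4.2.2.2.2.1, ne a2, ne a3, ne a6⟩
      (sy hp') (sy a1) a4 a5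
  have hsq' : Nb4 A q' q s p' r' :=
    h.nb4_of_four ⟨d1.2.2.2.2.1, d2.2.2.2.2.1, d4.2.2.2.2.2, ne a1, ne a3, ne a5⟩
      (sy hq') (sy a2) (sy a4) a6
  have hsr' : Nb4 A r' r s p' q' :=
    h.nb4_of_four ⟨d1.2.2.2.2.2, d2.2.2.2.2.2, d3.2.2.2.2.2, ne a1, ne a2, ne a4⟩
      (sy hr') (sy a3) (sy a5) (sy a6)
  have hinj : Function.Injective ![u, p, q, r] := by
    have g1 := ne hup
    have g2 := ne huq
    have g3 := ne hur
    clear * - d1 g1 g2 g3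
    rw [← List.nodup_ofFn]
    simp
    grind
  have hinj' : Function.Injective ![s, p', q', r'] := by
    have g1 := ne a1
    have g2 := ne a2
    have g3 := ne a3
    have g4 := ne a4
    have g5 := ne a5
    have g6 := ne a6
    clear * - g1 g2 g3 g4 g5 g6
    rw [← List.nodup_ofFn]
    simp
    grind
  have hne : ∀ i j, ![u, p, q, r] i ≠ ![s, p', q', r'] j := by
    have g1 := ne hus
    have g2 := ne hp'
    have g3 := ne hq'
    have g4 := ne hr'
    clear * - d1 d2 d3 d4 g1 g2 g3 g4
    intro i j
    fin_cases i <;> fin_cases j <;> simp <;> grind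
  have h1 : ∀ i v, Adj A (![u, p, q, r] i) v ↔ v = ![s, p', q', r'] i ∨
      ∃ j, j ≠ i ∧ v = ![u, p, q, r] j := by
    intro i v
    have g1 := hu.2 v
    have g2 := hp.2 v
    have g3 := hq.2 v
    have g4 := hr.2 v
    clear * - g1 g2 g3 g4
    fin_cases i <;> simp [Fin.exists_fin_succ, *] <;> grind
  have h2 : ∀ i v, Adj A (![s, p', q', r'] i) v ↔ v = ![u, p, q, r] i ∨
      ∃ j, j ≠ i ∧ v = ![s, p', q', r'] j := by
    intro i v
    have g1 := hs.2 v
    have g2 := hsp'.2 v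
    have g3 := hsq'.2 v
    have g4 := hsr'.2 v
    clear * - g1 g2 g3 g4
    fin_cases i <;> simp [Fin.exists_fin_succ, *]
  obtain ⟨e, he⟩ := h.exists_equiv (Sum.elim ![u, p, q, r] ![s, p', q', r'])
    (hinj.sumElim hinj' hne) (by
      rintro (i | i) v hv
      · rcases (h1 i v).1 hv with rfl | ⟨j, -, rfl⟩
        exacts [⟨Sum.inr i, rfl⟩, ⟨Sum.inl j, rfl⟩]
      · rcases (h2 i v).1 hv with rfl | ⟨j, -, rfl⟩
        exacts [⟨Sum.inl i, rfl⟩, ⟨Sum.inr j, rfl⟩])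
  obtain ⟨B, hB, hAB⟩ := h.exists_ndMatrix e (by
    intro i j
    rw [he, he, Sum.elim_inl, Sum.elim_inr, h1]
    refine ⟨?_, fun hij => Or.inl (congrArg _ hij.symm)⟩
    rintro (hij | ⟨l, -, hl⟩)
    exacts [(hinj' hij).symm, absurd hl.symm (hne l j)])
  exact hB.isNegativeDouble hAB

/-- The classification in degree four, when the eigenvalues sum to zero and no two vertices have
the same neighbours. -/
theorem Quadratic.degree_four_without_twins (h : Quadratic A 0 4)
    (hno : ∀ u v p q r s, Nb4 A u p q r s → Nb4 A v p q r s → u = v) (u : V) :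
    MSwitch A (IG W₅ unitEntries_W₅).gainMatrix ∨ MSwitch A (IG W₇ unitEntries_W₇).gainMatrix ∨
      IsNegativeDoubleOfDegreeThree A := by
  by_cases hc : AtMostTwoCommon A
  · by_cases hfree : ∀ u p q, Adj A u p → Adj A u q → ¬ Adj A p q
    · obtain ⟨p, hp⟩ := h.exists_adj four_ne_zero u
      obtain ⟨q, r, s, hu⟩ := h.exists_nb4 hp
      rcases h.semibiplane_structure hc hu with ⟨_, _, _, _, _, _, _, _, _, hF⟩ |
        ⟨_, _, _, _, _, _, _, _, _, _, _, hF⟩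
      · exact Or.inr (Or.inl (h.mswitch_W₇ hfree hF))
      · exact Or.inr (Or.inr (h.isNegativeDouble_of_eightByEight hc hfree hF))
    · push Not at hfree
      obtain ⟨u, p, q, h1, h2, h3⟩ := hfree
      exact Or.inr (Or.inr (h.isNegativeDouble_of_triangle hc h1 h2 h3))
  · unfold AtMostTwoCommon at hc
    push Not at hc
    obtain ⟨u, v, p, q, r, huv, hpq, hpr, hqr, h1, h2, h3, h4, h5, h6⟩ := hc
    obtain ⟨s, hu⟩ := h.exists_nb4_of_three ⟨hpq, hpr, hqr⟩ h1 h2 h3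
    obtain ⟨s', hv⟩ := h.exists_nb4_of_three ⟨hpq, hpr, hqr⟩ h4 h5 h6
    rcases h.triple_structure hno hu hv huv with ⟨_, _, _, _, _, _, _, _, _, _, hF⟩ |
      ⟨_, _, _, _, _, _, _, _, _, _, _, _, hF⟩
    · exact Or.inl (h.mswitch_W₅ hF)
    · exact Or.inr (Or.inr (h.isNegativeDouble_of_sixBySix hF))

end WithoutTwins

end GainGraph

namespace GainGraph

/-! ### Vertices with equal neighbourhoods and chains of rank one blocks. -/

section Twins

variable {V : Type u} [Fintype V] [DecidableEq V] {A : Matrix V V ℂ} {a : ℝ} {k : ℕ}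

/-- Two pairs of vertices, joined by four edges, whose block in the gain matrix has rank one. -/
structure Link (A : Matrix V V ℂ) (f g : Bool → V) : Prop where
  left : f true ≠ f false
  right : g true ≠ g false
  adj : ∀ ε δ, Adj A (f ε) (g δ)
  det : A (f true) (g true) * A (f false) (g false) = A (f true) (g false) * A (f false) (g true)

/-- An infinite walk along pairs of twins. -/
structure TwinChain (A : Matrix V V ℂ) (P : ℕ → Bool → V) : Prop where
  link : ∀ n, Link A (P n) (P (n + 1))
  adj : ∀ n ε v, Adj A (P (n + 1) ε) v ↔ ∃ δ, v = P n δ ∨ v = P (n + 2) δ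
  ne : ∀ n ε δ, P n ε ≠ P (n + 2) δ
  orth : ∀ n, A (P (n + 1) true) (P (n + 2) true) * A (P (n + 2) true) (P (n + 1) false) =
    -(A (P (n + 1) true) (P n true) * A (P n true) (P (n + 1) false))

/-- Only two equal units can balance a number of modulus 2; equality follows from the parallelogram
law. -/
theorem eq_neg_of_two_mul_add {z x y : ℂ} (hz : ‖z‖ = 1) (hx : x = 0 ∨ ‖x‖ = 1)
    (hy : y = 0 ∨ ‖y‖ = 1) (h : 2 * z + x + y = 0) : x = -z ∧ y = -z := by
  have h2 : ‖x + y‖ = 2 := by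
    rw [show x + y = -(2 * z) by linear_combination h, norm_neg, norm_mul, hz]
    norm_num
  have hx1 : ‖x‖ = 1 := by
    rcases hx with rfl | hx
    · rcases hy with rfl | hy <;> simp_all
    · exact hx
  have hy1 : ‖y‖ = 1 := by
    rcases hy with rfl | hy
    · simp_all
    · exact hy
  have h3 := parallelogram_law_with_norm ℝ x y
  rw [h2, hx1, hy1] at h3
  have h4 : x - y = 0 := norm_eq_zero.1 (by nlinarith [norm_nonneg (x - y)])
  constructor
  · linear_combination h / 2 + h4 / 2
  · linear_combination h / 2 - h4 / 2

/-- Rank one makes the walks between the two vertices of `g` through `f` equal, with sum of modulus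
2. The other two neighbours must balance this, so they are shared as well, and their equal
contributions give a rank one block again, with the opposite sign. -/
theorem Quadratic.link_step (h : Quadratic A 0 4) {f g : Bool → V} (hfg : Link A f g) :
    ∃ k : Bool → V, Link A g k ∧ (∀ ε v, Adj A (g ε) v ↔ ∃ δ, v = f δ ∨ v = k δ) ∧
      (∀ ε δ, f ε ≠ k δ) ∧ A (g true) (k true) * A (k true) (g false) =
        -(A (g true) (f true) * A (f true) (g false)) := by
  obtain ⟨r, s, hx⟩ := h.exists_nb4_of_two hfg.left (h.symm (hfg.adj true true))
    (h.symm (hfg.adj false true))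
  obtain ⟨-, -, hxr, hxs⟩ := h.nb4_adj hx
  have e := h.sum4 hx hfg.right
  have m1 := h.mul_swap (hfg.adj true true)
  have m2 := h.mul_swap (hfg.adj false true)
  have m3 := h.mul_swap (hfg.adj true false)
  have m4 := h.mul_swap (hfg.adj false false)
  have hz : A (g true) (f false) * A (f false) (g false) =
      A (g true) (f true) * A (f true) (g false) := by
    linear_combination A (g true) (f true) * A (g true) (f false) * hfg.det -
      A (g true) (f false) * A (f false) (g false) * m1 +
      A (f true) (g false) * A (g true) (f true) * m2
  have n := fun {x y : V} (hxy : Adj A x y) => h.norm_eq_one hxy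
  have nz : ‖A (g true) (f true) * A (f true) (g false)‖ = 1 := by
    simp [n (hfg.adj true false), n (h.symm (hfg.adj true true))]
  have un : ∀ {r}, Adj A (g true) r → A (g true) r * A r (g false) = 0 ∨
      ‖A (g true) r * A r (g false)‖ = 1 := by
    intro r hr
    rcases h.unit r (g false) with h1 | h1
    · exact Or.inl (by simp [h1])
    · exact Or.inr (by simp [h1, n hr])
  obtain ⟨er, es⟩ := eq_neg_of_two_mul_add nz (un hxr) (un hxs) (by
    rw [ofReal_zero, zero_mul] at e; linear_combination e - hz)
  have back : ∀ {r}, A (g true) r * A r (g false) = -(A (g true) (f true) * A (f true) (g false)) →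
      Adj A (g false) r := by
    intro r hr
    refine h.symm fun h0 => ?_
    rw [h0, mul_zero] at hr
    rw [neg_eq_zero.1 hr.symm] at nz
    simp at nz
  have hyr := back er
  have hys := back es
  have hy : Nb4 A (g false) (f true) (f false) r s := h.nb4_of_four hx.1
    (h.symm (hfg.adj true false)) (h.symm (hfg.adj false false)) hyr hys
  obtain ⟨d1, d2, d3, d4, d5, d6⟩ := hx.1
  refine ⟨fun b => if b then r else s, ⟨hfg.right, by simpa using d6, ?_, ?_⟩, ?_, ?_, by simpa using er⟩
  · rintro (_ | _) (_ | _) <;> simp [*]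
  · have k1 := h.mul_swap hyr
    have k2 := h.mul_swap hys
    simp only [if_true, Bool.false_eq_true, if_false]
    linear_combination (A (g false) r * A (g false) s) * (er - es) -
      A (g true) r * A (g false) s * k1 + A (g true) s * A (g false) r * k2
  · rintro (_ | _) v <;> simp only [Bool.exists_bool, if_true, Bool.false_eq_true, if_false]
    · rw [hy.2]; tauto
    · rw [hx.2]; tauto
  · rintro (_ | _) (_ | _) <;> simp [*]

theorem Quadratic.exists_twinChain (h : Quadratic A 0 4) {f g : Bool → V} (hfg : Link A f g) :
    ∃ P, TwinChain A P := by
  have : Nonempty V := ⟨f true⟩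
  choose! step h1 h2 h3 h4 using fun (x : (Bool → V) × (Bool → V)) (hx : Link A x.1 x.2) =>
    h.link_step hx
  -- The state is a pair of consecutive pairs, since each step depends on the previous link.
  let seq : ℕ → (Bool → V) × (Bool → V) := fun n => Nat.rec (f, g) (fun _ x => (x.2, step x)) n
  have hl : ∀ n, Link A (seq n).1 (seq n).2 := fun n => by
    induction n with
    | zero => exact hfg
    | succ n ih => exact h1 _ ih
  exact ⟨fun n => (seq n).1, fun n => hl n, fun n => h2 _ (hl n), fun n => h3 _ (hl n),
    fun n => h4 _ (hl n)⟩

/-- Equality of two parallel walks is the vanishing of the `2 × 2` determinant, written with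
products along walks. -/
theorem Quadratic.exists_link_aux (h : Quadratic A 0 4) {f g : Bool → V} 
    (left : f true ≠ f false) (right : g true ≠ g false) (adj : ∀ ε δ, Adj A (f ε) (g δ))
    (he : A (f true) (g true) * A (g true) (f false) =
      A (f true) (g false) * A (g false) (f false)) : Link A f g := by
  refine ⟨left, right, adj, ?_⟩
  have k1 := h.mul_swap (adj false true)
  have k2 := h.mul_swap (adj false false)
  linear_combination (A (f false) (g false) * A (f false) (g true)) * he -
      A (f true) (g true) * A (f false) (g false) * k1 +
      A (f true) (g false) * A (f false) (g true) * k2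

/-- Four unit complex numbers that sum to zero consist of two opposite pairs. -/
theorem opposite_of_sum_four {x y z w : ℂ} (hx : ‖x‖ = 1) (hy : ‖y‖ = 1) (hz : ‖z‖ = 1)
    (hw : ‖w‖ = 1) (h : x + y + z + w = 0) : x + y = 0 ∨ x + z = 0 ∨ x + w = 0 := by
  have h' := congrArg star h
  simp only [star_add, star_zero] at h'
  have mx := mul_star_of_norm hx
  have my := mul_star_of_norm hy
  have mz := mul_star_of_norm hz
  have mw := mul_star_of_norm hw
  have : (x + y) * ((x + z) * (x + w)) = 0 := by
    have e3 : y * z * w + x * z * w + x * y * w + x * y * z = 0 := by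
      linear_combination (x * y * z * w) * h' - y * z * w * mx - x * z * w * my - x * y * w * mz
        - x * y * z * mw
    linear_combination x ^ 2 * h + e3
  rcases mul_eq_zero.1 this with h1 | h1
  · exact Or.inl h1
  · exact Or.inr (mul_eq_zero.1 h1)

/-- The two relations give `b₁ ± b₂` the same moduli as `b₃ ± b₄`, so by the parallelogram law both
pairs have equally many units. If `b₂ = 0`, one of the relations forces `g = r` or `g = -r`. If all
four are units, they form opposite pairs, and the hypotheses leave only one pairing. -/
theorem proportional_of_twisted {g r b₁ b₂ b₃ b₄ : ℂ} (hg : ‖g‖ = 1) (hr : ‖r‖ = 1) (h1 : ‖b₁‖ = 1)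
    (h2 : b₂ = 0 ∨ ‖b₂‖ = 1) (h3 : b₃ = 0 ∨ ‖b₃‖ = 1) (h4 : b₄ = 0 ∨ ‖b₄‖ = 1)
    (hs : b₁ + b₂ + b₃ + b₄ = 0) (ht : b₁ * g + b₂ * (-g) + b₃ * r + b₄ * (-r) = 0)
    (hgr : g ≠ r) (hgr' : g ≠ -r) (h12 : b₁ ≠ b₂) :
    b₂ = -b₁ ∧ b₃ * r = -(g * b₁) ∧ b₄ * r = g * b₁ := by
  have g0 := ne_zero_of_norm hg
  have b0 := ne_zero_of_norm h1
  have key := parallelogram_law_with_norm ℝ b₁ b₂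
  have key' := parallelogram_law_with_norm ℝ b₃ b₄
  have e1 : ‖b₁ + b₂‖ = ‖b₃ + b₄‖ := by
    rw [show b₁ + b₂ = -(b₃ + b₄) by linear_combination hs, norm_neg]
  have e2 : ‖b₁ - b₂‖ = ‖b₃ - b₄‖ := by
    have : (b₁ - b₂) * g = -((b₃ - b₄) * r) := by linear_combination ht
    have := congrArg norm this
    rwa [norm_neg, norm_mul, norm_mul, hg, hr, mul_one, mul_one] at this
  rw [e1, e2, key', h1] at key
  rcases h2 with rfl | h2
  · exfalso
    rcases h3 with rfl | h3 <;> rcases h4 with rfl | h4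
    · exact b0 (by linear_combination hs)
    · exact mul_ne_zero b0 (sub_ne_zero.2 hgr') (by linear_combination ht + r * hs)
    · exact mul_ne_zero b0 (sub_ne_zero.2 hgr) (by linear_combination ht - r * hs)
    · rw [h3, h4, norm_zero] at key
      norm_num at key
  · rw [h2] at key
    have h3 : ‖b₃‖ = 1 := by
      rcases h3 with rfl | h3
      · rcases h4 with rfl | h4
        · norm_num at key
        · rw [h4, norm_zero] at key; norm_num at key
      · exact h3
    have h4 : ‖b₄‖ = 1 := by
      rcases h4 with rfl | h4
      · rw [h3, norm_zero] at key; norm_num at key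
      · exact h4
    rcases opposite_of_sum_four h1 h2 h3 h4 hs with e | e | e
    · refine ⟨by linear_combination e, ?_, ?_⟩
      · linear_combination ht / 2 + g / 2 * e + r / 2 * (hs - e)
      · linear_combination -ht / 2 - g / 2 * e + r / 2 * (hs - e)
    · exact absurd (by linear_combination ht + r * hs - 2 * r * e)
        (mul_ne_zero (sub_ne_zero.2 h12) (sub_ne_zero.2 hgr))
    · exact absurd (by linear_combination ht - r * hs + 2 * r * e)
        (mul_ne_zero (sub_ne_zero.2 h12) (sub_ne_zero.2 hgr'))

/-- If the walk through `p` equals the one through `r` or `s`, the twins themselves give a link.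
Otherwise consider the two remaining neighbours of `p`. Without a link, orthogonality to both twins
determines the row of each of them on `p, q, r, s` up to a scalar, so these two rows are
proportional, contradicting their orthogonality. -/
theorem Quadratic.exists_link_of_opposite (h : Quadratic A 0 4) {u u' p q r s : V}
    (hu : Nb4 A u p q r s) (hu' : Nb4 A u' p q r s) (huu' : u ≠ u')
    (ho : A u p * A p u' + A u q * A q u' = 0) : ∃ f g, Link A f g := by
  have e := h.sum4 hu huu'
  obtain ⟨up, uq, ur, us⟩ := h.nb4_adj hu
  obtain ⟨up', uq', ur', us'⟩ := h.nb4_adj hu'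
  obtain ⟨d1, d2, d3, d4, d5, d6⟩ := hu.1
  rw [ofReal_zero, zero_mul] at e
  by_cases hgr : A u p * A p u' = A u r * A r u'
  · refine ⟨fun b => if b then u else u', fun b => if b then p else r,
      h.exists_link_aux (by simpa using huu') (by simpa using d2) ?_ (by simpa using hgr)⟩
    rintro (_ | _) (_ | _) <;> simp [*]
  by_cases hgr' : A u p * A p u' = -(A u r * A r u')
  · refine ⟨fun b => if b then u else u', fun b => if b then p else s,
      h.exists_link_aux (by simpa using huu') (by simpa using d3) ?_ ?_⟩
    · rintro (_ | _) (_ | _) <;> simp [*]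
    · simp only [if_true, Bool.false_eq_true, if_false]
      linear_combination hgr' - e + ho
  obtain ⟨a, b, hp⟩ := h.exists_nb4_of_two huu' (h.symm up) (h.symm up')
  obtain ⟨-, -, pa, pb⟩ := h.nb4_adj hp
  obtain ⟨-, f2, f3, f4, f5, f6⟩ := hp.1
  by_contra hno
  have n := fun {x y : V} (hxy : Adj A x y) => h.norm_eq_one hxy
  have nT : ∀ {x y z w : V}, Adj A x y → Adj A z w → ‖A x y * A z w‖ = 1 := fun h1 h2 => by
    simp [n h1, n h2]
  have m1 := h.mul_swap up
  have m2 := h.mul_swap uq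
  have m3 := h.mul_swap ur
  have m4 := h.mul_swap us
  have main : ∀ c, u ≠ c → u' ≠ c → Adj A p c →
      A c q * A q u = -(A c p * A p u) ∧
      A c r * A r u * (A u r * A r u') = -(A u p * A p u' * (A c p * A p u)) ∧
      A c s * A s u * (A u r * A r u') = A u p * A p u' * (A c p * A p u) := by
    intro c huc huc' hpc
    have s1 := h.sum4' hu huc.symm
    have s2 := h.sum4' hu' huc'.symm
    rw [ofReal_zero, zero_mul] at s1 s2
    have un : ∀ {q}, Adj A u q → A c q * A q u = 0 ∨ ‖A c q * A q u‖ = 1 := by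
      intro q hq
      rcases h.unit c q with h1 | h1
      · exact Or.inl (by simp [h1])
      · exact Or.inr (by simp [h1, n (h.symm hq)])
    refine proportional_of_twisted (nT up (h.symm up')) (nT ur (h.symm ur'))
      (nT (h.symm hpc) (h.symm up)) (un uq) (un ur) (un us) s1 ?_ hgr hgr' ?_
    · linear_combination s2 - A c q * A q u * ho - A c s * A s u * (e - ho) +
        A c p * A p u' * m1 + A c q * A q u' * m2 + A c r * A r u' * m3 + A c s * A s u' * m4
    -- Equal walks through `p` and `q` would form a link between the pairs `c, u` and `p, q`.
    · intro he
      have hcq : Adj A c q := by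
        intro h0
        rw [h0, zero_mul] at he
        exact mul_ne_zero (h.symm hpc) (h.symm up) he
      refine hno ⟨fun b => if b then c else u, fun b => if b then p else q,
        h.exists_link_aux (by simpa using huc.symm) (by simpa using d1) ?_ (by simpa using he)⟩
      have hcp := h.symm hpc
      rintro (_ | _) (_ | _) <;> simp [*]
  obtain ⟨a2, a3, a4⟩ := main a f2 f4 pa
  obtain ⟨b2, b3, b4⟩ := main b f3 f5 pb
  have na := nT (h.symm pa) (h.symm up)
  have nb := nT (h.symm pb) (h.symm up)
  have ng := nT up (h.symm up')
  have ng3 := nT ur (h.symm ur')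
  have adj : ∀ {q z}, ‖z‖ = 1 → A a q * z ≠ 0 → Adj A a q := fun _ h2 => left_ne_zero_of_mul h2
  have aq : Adj A a q := fun h0 => by
    rw [h0, zero_mul, zero_eq_neg] at a2
    exact ne_zero_of_norm na a2
  have ar : Adj A a r := fun h0 => by
    rw [h0, zero_mul, zero_mul, zero_eq_neg] at a3
    exact mul_ne_zero (ne_zero_of_norm ng) (ne_zero_of_norm na) a3
  have as : Adj A a s := fun h0 => by
    rw [h0, zero_mul, zero_mul] at a4
    exact mul_ne_zero (ne_zero_of_norm ng) (ne_zero_of_norm na) a4.symm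
  have s1 := h.sum4 (h.nb4_of_four hu.1 (h.symm pa) aq ar as) f6
  rw [ofReal_zero, zero_mul] at s1
  have c2 := congrArg star b2
  have c3 := congrArg star b3
  have c4 := congrArg star b4
  have g1 := mul_star_of_norm ng
  have g3 := mul_star_of_norm ng3
  simp only [star_neg, star_mul', ← h.herm] at c2 c3 c4 g1 g3
  -- All four walks from `a` to `b` turn out equal, so they cannot sum to zero.
  have k2 : A a q * A q b = A a p * A p b := by
    linear_combination -(A a q * A q b) * m2 + (A q b * A u q) * a2 - (A a p * A p u) * c2 +
      (A a p * A p b) * m1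
  have k3 : A a r * A r b = A a p * A p b := by
    linear_combination -(A a r * A r b) * m3 - (A a r * A r b) * (A u r * A r u) * g3 + (A r b * A u r * (A r u * A u' r)) * a3 -
      (A u p * A p u' * (A a p * A p u)) * c3 + (A a p * A p u * A p b * A u p) * g1 +
      (A a p * A p b) * m1
  have k4 : A a s * A s b = A a p * A p b := by
    linear_combination -(A a s * A s b) * m4 - (A a s * A s b) * (A u s * A s u) * g3 + (A s b * A u s * (A r u * A u' r)) * a4 +
      (A u p * A p u' * (A a p * A p u)) * c4 + (A a p * A p u * A p b * A u p) * g1 +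
      (A a p * A p b) * m1
  exact mul_ne_zero (h.symm pa) pb (by linear_combination (s1 - k2 - k3 - k4) / 4)

theorem Quadratic.exists_link (h : Quadratic A 0 4) {u u' p q r s : V} (hu : Nb4 A u p q r s)
    (hu' : Nb4 A u' p q r s) (huu' : u ≠ u') : ∃ f g, Link A f g := by
  have e := h.sum4 hu huu'
  obtain ⟨up, uq, ur, us⟩ := h.nb4_adj hu
  obtain ⟨up', uq', ur', us'⟩ := h.nb4_adj hu'
  have nT : ∀ {x y z w : V}, Adj A x y → Adj A z w → ‖A x y * A z w‖ = 1 := fun h1 h2 => by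
    simp [h.norm_eq_one h1, h.norm_eq_one h2]
  rw [ofReal_zero, zero_mul] at e
  rcases opposite_of_sum_four (nT up (h.symm up')) (nT uq (h.symm uq')) (nT ur (h.symm ur'))
    (nT us (h.symm us')) e with e | e | e
  · exact h.exists_link_of_opposite hu hu' huu' e
  · exact h.exists_link_of_opposite hu.swap23 hu'.swap23 huu' e
  · exact h.exists_link_of_opposite hu.swap34.swap23 hu'.swap34.swap23 huu' e

/-- The sign attached to the two members of a pair. -/
def sgn (b : Bool) : ℂ := if b then 1 else -1

/-- The switching function along a chain of pairs. -/
def TwinChain.potential (A : Matrix V V ℂ) (P : ℕ → Bool → V) : ℕ → Bool → ℂ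
  | 0, true => 1
  | 0, false => -(A (P 0 false) (P 1 true) * A (P 1 true) (P 0 true))
  | n + 1, ε => A (P (n + 1) ε) (P n true) * potential A P n true

theorem TwinChain.norm_potential (h : Quadratic A 0 4) {P : ℕ → Bool → V} (hP : TwinChain A P)
    (n : ℕ) (ε : Bool) : ‖potential A P n ε‖ = 1 := by
  induction n generalizing ε with
  | zero =>
    cases ε
    · simp [potential, h.norm_eq_one (h.symm ((hP.link 0).adj true true)),
        h.norm_eq_one ((hP.link 0).adj false true)]
    · simp [potential]
  | succ n ih => simp [potential, ih, h.norm_eq_one (h.symm ((hP.link n).adj true ε))]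

/-- After switching by the potential, the entry depends only on the member of the earlier pair: 1
for `true` and -1 for `false`. This is the sign pattern of the blocks of a toral tessellation graph.
-/
theorem TwinChain.potential_eq (h : Quadratic A 0 4) {P : ℕ → Bool → V} (hP : TwinChain A P)
    (n : ℕ) (ε δ : Bool) : A (P n ε) (P (n + 1) δ) * potential A P (n + 1) δ =
      sgn ε * potential A P n ε := by
  have m := fun n ε δ => h.mul_swap ((hP.link n).adj ε δ)
  have h1 : ∀ δ, A (P n true) (P (n + 1) δ) * potential A P (n + 1) δ = potential A P n true := by
    intro δ
    rw [potential]
    linear_combination potential A P n true * m n true δ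
  -- At the start this is the definition of the potential. Later it is the sign change in
  -- `TwinChain.orth`.
  have h2 : A (P n false) (P (n + 1) true) * potential A P (n + 1) true =
      -potential A P n false := by
    rcases n with _ | n
    · simp [potential]
    · have ho := congrArg star (hP.orth n)
      simp only [star_neg, star_mul', ← h.herm] at ho
      have := h.norm_eq_one (h.symm ((hP.link n).adj true true))
      simp only [potential]
      linear_combination (A (P (n + 1) true) (P n true) * potential A P n true) * ho -
        A (P (n + 1) false) (P n true) * potential A P n true * m n true true
  -- The block has rank one, so its fourth entry follows from the other three.
  have h3 : A (P n false) (P (n + 1) false) * potential A P (n + 1) false =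
      -potential A P n false := by
    have hd := (hP.link n).det
    have := mul_ne_zero ((hP.link n).adj true true)
      (ne_zero_of_norm (norm_potential h hP (n + 1) true))
    refine mul_left_cancel₀ this ?_
    linear_combination potential A P (n + 1) true * potential A P (n + 1) false * hd +
      (A (P n true) (P (n + 1) false) * potential A P (n + 1) false) * h2 -
      potential A P n false * (h1 false - h1 true)
  cases ε
  · cases δ
    · simpa [sgn] using h3
    · simpa [sgn] using h2
  · simpa [sgn] using h1 δ

end Twins

end GainGraph

namespace GainGraph

/-! ### Closing the chain into a toral tessellation graph. -/

section Toral

variable {V : Type u} [Fintype V] [DecidableEq V] {A : Matrix V V ℂ} {a : ℝ} {k : ℕ}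

omit [Fintype V] [DecidableEq V] in
theorem mem_pair {P : ℕ → Bool → V} {n : ℕ} {x y : V} (hxy : x ≠ y)
    (hx : ∃ δ, x = P n δ) (hy : ∃ δ, y = P n δ) {v : V} (hv : ∃ δ, v = P n δ) : v = x ∨ v = y := by
  obtain ⟨δ, rfl⟩ := hx
  obtain ⟨η, rfl⟩ := hy
  obtain ⟨ζ, rfl⟩ := hv
  cases δ <;> cases η <;> cases ζ <;> simp_all

omit [Fintype V] [DecidableEq V] in
theorem TwinChain.inj {P : ℕ → Bool → V} (hP : TwinChain A P) {n : ℕ} {ε δ : Bool} :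
    P n ε = P n δ ↔ ε = δ := by
  have := (hP.link n).left
  cases ε <;> cases δ <;> simp_all [eq_comm]

/-- A chain of pairs in a finite gain graph closes up at its beginning. -/
theorem TwinChain.exists_return (h : Quadratic A 0 4) {P : ℕ → Bool → V} (hP : TwinChain A P) :
    ∃ t, 3 ≤ t ∧ (∀ i < t, ∀ j < t, ∀ ε δ, P (i + 1) ε = P (j + 1) δ → i = j) ∧
      (∀ δ, ∃ η, P t δ = P 0 η) ∧ (∀ δ, ∃ η, P (t + 1) δ = P 1 η) := by
  classical
  have hadj : ∀ n ε δ, P n ε ≠ P (n + 1) δ := fun n ε δ => h.ne ((hP.link n).adj ε δ)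
  -- Indices are shifted by one because neighbourhoods are known only from `P 1` onwards.
  have hex : ∃ t, ∃ s < t, ∃ ε δ, P (t + 1) ε = P (s + 1) δ := by
    obtain ⟨i, j, hij, he⟩ := Finite.exists_ne_map_eq_of_infinite fun n : ℕ => P (n + 1) true
    rcases lt_or_gt_of_ne hij with hlt | hlt
    · exact ⟨j, i, hlt, true, true, he.symm⟩
    · exact ⟨i, j, hlt, true, true, he⟩
  obtain ⟨s, hst, ε, δ, he⟩ := Nat.find_spec hex
  have hmin : ∀ i j, i < Nat.find hex → j < i → ∀ ε δ, P (i + 1) ε ≠ P (j + 1) δ :=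
    fun i j hi hj ε δ h' => Nat.find_min hex hi ⟨j, hj, ε, δ, h'⟩
  generalize Nat.find hex = t at *
  obtain ⟨t, rfl⟩ : ∃ t', t = t' + 1 := ⟨t - 1, by omega⟩
  -- For `s > 0` the vertex before the repeated one lies in a pair next to the first occurrence.
  -- That would be an earlier repetition, or the occurrences are too close to be distinct pairs of
  -- the chain.
  have hs0 : s = 0 := by
    by_contra hs
    obtain ⟨s, rfl⟩ : ∃ s', s = s' + 1 := ⟨s - 1, by omega⟩
    obtain ⟨η, hη | hη⟩ := (hP.adj (s + 1) δ (P (t + 1) true)).1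
      (he ▸ h.symm ((hP.link (t + 1)).adj true ε))
    · exact hmin t s (by omega) (by omega) _ _ hη
    · rcases Nat.lt_trichotomy (s + 2) t with h1 | h1 | h1
      · exact hmin t (s + 2) (by omega) h1 _ _ hη
      · subst h1; exact hP.ne (s + 2) δ ε he.symm
      · obtain rfl : s + 1 = t := by omega
        exact hadj _ _ _ he.symm
  subst hs0
  have ht : 2 ≤ t := by
    by_contra ht
    have : t = 0 ∨ t = 1 := by omega
    rcases this with rfl | rfl
    · exact hadj _ _ _ he.symm
    · exact hP.ne _ _ _ he.symm
  have hinj : ∀ i < t + 1, ∀ j < t + 1, ∀ ε δ, P (i + 1) ε = P (j + 1) δ → i = j := by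
    intro i hi j hj ε δ he
    rcases Nat.lt_trichotomy i j with h1 | h1 | h1
    · exact absurd he.symm (hmin j i hj h1 _ _)
    · exact h1
    · exact absurd he (hmin i j hi h1 _ _)
  have h1 : ∀ δ, ∃ η, P (t + 1) δ = P 0 η := by
    intro η
    obtain ⟨ζ, hζ | hζ⟩ := (hP.adj 0 δ (P (t + 1) η)).1
      (he ▸ h.symm ((hP.link (t + 1)).adj η ε))
    · exact ⟨ζ, hζ⟩
    · have := hinj t (by omega) 1 (by omega) _ _ hζ
      omega
  refine ⟨t + 1, by omega, hinj, h1, ?_⟩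
  obtain ⟨η, hη⟩ := h1 true
  have h2 : ∀ δ, ∃ η, P 1 δ = P (t + 2) η := by
    intro δ
    obtain ⟨t, rfl⟩ : ∃ t', t = t' + 1 := ⟨t - 1, by omega⟩
    obtain ⟨ζ, hζ | hζ⟩ := (hP.adj (t + 1) true (P 1 δ)).1 (by
      rw [hη]; exact (hP.link 0).adj _ _)
    · have := hinj t (by omega) 0 (by omega) _ _ hζ.symm
      omega
    · exact ⟨ζ, hζ⟩
  intro δ
  have := mem_pair (hP.link 0).right (h2 true) (h2 false) ⟨δ, rfl⟩
  rcases this with h3 | h3 <;> exact ⟨_, h3⟩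

/-- After one turn the potential returns up to a unit `x`, the holonomy of the chain. It is the same
for both members of the pair because the potentials on `P 1` and on `P (t + 1)` are both determined
by the edges to a common vertex of the next pair. -/
theorem TwinChain.exists_wrap (h : Quadratic A 0 4) {P : ℕ → Bool → V} (hP : TwinChain A P)
    {t : ℕ} (ht0 : ∀ δ, ∃ η, P 0 δ = P t η) (ht1 : ∀ δ, ∃ η, P (t + 1) δ = P 1 η) :
    ∃ x : Circle, ∀ ε δ, A (P t ε) (P 1 δ) * potential A P 1 δ = sgn ε * potential A P t ε * x := by
  have ht1' : ∀ δ, ∃ η, P 1 δ = P (t + 1) η := fun δ => by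
    have := mem_pair (hP.link t).right (ht1 true) (ht1 false) ⟨δ, rfl⟩
    rcases this with h3 | h3 <;> exact ⟨_, h3⟩
  have ht2 : ∃ η, P (t + 2) true = P 2 η := by
    obtain ⟨η, hη⟩ := ht1 true
    obtain ⟨ζ, hζ | hζ⟩ := (hP.adj 0 η (P (t + 2) true)).1
      (hη ▸ (hP.link (t + 1)).adj true true)
    · obtain ⟨ξ, hξ⟩ := ht0 ζ
      exact absurd (hζ.trans hξ).symm (hP.ne _ _ _)
    · exact ⟨ζ, hζ⟩
  -- The pair may return with its members interchanged; then `c = -1`, and this sign is absorbed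
  -- into `x`.
  have hs : ∃ c : ℂ, c * c = 1 ∧ ∀ δ η, P 1 δ = P (t + 1) η → sgn δ = c * sgn η := by
    have k1 := (hP.link 0).right
    have k2 := (hP.link t).right
    obtain ⟨η, hη⟩ := ht1' true
    obtain ⟨ξ, hξ⟩ := ht1' false
    cases η
    · refine ⟨-1, by norm_num, ?_⟩
      rintro (_ | _) (_ | _) h' <;> simp_all [sgn]
    · refine ⟨1, by norm_num, ?_⟩
      rintro (_ | _) (_ | _) h' <;> simp_all [sgn]
  obtain ⟨η, hη⟩ := ht2
  obtain ⟨c, hc, hs⟩ := hs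
  have np := fun n ε => norm_potential h hP n ε
  have nc : ‖c‖ = 1 := by
    have := congrArg norm hc
    rw [norm_mul, norm_one] at this
    nlinarith [norm_nonneg c]
  have nx : ‖c * (potential A P 2 η * star (potential A P (t + 2) true))‖ = 1 := by
    simp [nc, np]
  refine ⟨toCircle _ nx, fun ε δ => ?_⟩
  obtain ⟨ζ, hζ⟩ := ht1' δ
  have e1 := hP.potential_eq h t ε ζ
  have e2 := hP.potential_eq h (t + 1) ζ true
  have e3 := hP.potential_eq h 1 δ η
  have e4 := hs δ ζ hζ
  have n2 := star_mul_of_norm (np (t + 2) true)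
  have hσ : sgn ζ * sgn ζ = 1 := by cases ζ <;> simp [sgn]
  rw [← hη, hζ, e4] at e3
  rw [← hζ] at e1
  have key : potential A P 1 δ = potential A P (t + 1) ζ *
      (c * (potential A P 2 η * star (potential A P (t + 2) true))) := by
    linear_combination -(sgn ζ * c) * e3 +
      (sgn ζ * c * potential A P 2 η * star (potential A P (t + 2) true)) * e2 -
      (sgn ζ * c * A (P (t + 1) ζ) (P (t + 1 + 1) true) * potential A P 2 η) * n2 -
      potential A P 1 δ * (hc * (sgn ζ * sgn ζ) + hσ) + (potential A P (t + 1) ζ *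
      (c * (potential A P 2 η * star (potential A P (t + 2) true)))) * hσ
  rw [coe_toCircle, ← e1, key]
  ring

/-- The sign belonging to a vertex of the toral tessellation graph. -/
def side {t : ℕ} : Fin t ⊕ Fin t → Bool := Sum.elim (fun _ => true) fun _ => false

/-- The position of a vertex of the toral tessellation graph. -/
def position {t : ℕ} : Fin t ⊕ Fin t → Fin t := Sum.elim id id

theorem eq_of_position {t : ℕ} {y z : Fin t ⊕ Fin t} (h1 : position y = position z)
    (h2 : side y = side z) : y = z := by
  rcases y with y | y <;> rcases z with z | z <;> simp [position, side] at h1 h2 <;> simp [h1]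

/-- One formula for all four blocks: a forward edge carries the sign of its first end, a backward
edge that of its second. -/
theorem toral_apply {t : ℕ} (ht : 3 ≤ t) (x : Circle) (y z : Fin t ⊕ Fin t) :
    (toral t ht x).gainMatrix y z = sgn (side y) * shiftMatrix t x (position y) (position z) +
      sgn (side z) * star (shiftMatrix t x (position z) (position y)) := by
  rw [gainMatrix_toral]
  rcases y with y | y <;> rcases z with z | z <;> simp [side, position, sgn] <;> ring

theorem TwinChain.mswitch_toral (h : Quadratic A 0 4) {P : ℕ → Bool → V} (hP : TwinChain A P) :
    ∃ (t : ℕ) (ht : 3 ≤ t) (x : Circle), MSwitch A (toral t ht x).gainMatrix := by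
  obtain ⟨t, ht, hinj, ht0, ht1⟩ := hP.exists_return h
  have ht0' : ∀ δ, ∃ η, P 0 δ = P t η := fun δ => by
    obtain ⟨t', rfl⟩ : ∃ t', t = t' + 1 := ⟨t - 1, by omega⟩
    have := mem_pair (hP.link t').right (ht0 true) (ht0 false) ⟨δ, rfl⟩
    rcases this with h3 | h3 <;> exact ⟨_, h3⟩
  obtain ⟨x, hx⟩ := hP.exists_wrap h ht0' ht1
  have np := fun n ε => norm_potential h hP n ε
  refine ⟨t, ht, x, ?_⟩
  have adj_cases : ∀ i < t, ∀ ε v, Adj A (P (i + 1) ε) v → ∃ j < t, (∃ δ, v = P (j + 1) δ) ∧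
      ((i + 1 = j ∨ i + 1 = t ∧ j = 0) ∨ (j + 1 = i ∨ j + 1 = t ∧ i = 0)) := by
    intro i hi ε v hv
    obtain ⟨δ, rfl | rfl⟩ := (hP.adj i ε v).1 hv
    · rcases i with _ | i
      · obtain ⟨η, hη⟩ := ht0' δ
        obtain ⟨t', rfl⟩ : ∃ t', t = t' + 1 := ⟨t - 1, by omega⟩
        exact ⟨t', by omega, ⟨η, hη⟩, by omega⟩
      · exact ⟨i, by omega, ⟨δ, rfl⟩, by omega⟩
    · by_cases hit : i + 1 = t
      · obtain ⟨η, hη⟩ := ht1 δ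
        subst hit
        exact ⟨0, by omega, ⟨η, hη⟩, by omega⟩
      · exact ⟨i + 1, by omega, ⟨δ, rfl⟩, by omega⟩
  have hpos : Nonempty (Fin t ⊕ Fin t) := ⟨Sum.inl ⟨0, by omega⟩⟩
  obtain ⟨e, he⟩ := h.exists_equiv (fun z : Fin t ⊕ Fin t => P (position z + 1) (side z))
    (by
      intro y z hyz
      have h1 := hinj _ (position y).2 _ (position z).2 _ _ hyz
      simp only [h1, hP.inj] at hyz
      exact eq_of_position (Fin.ext h1) hyz)
    (by
      intro z v hv
      obtain ⟨j, hj, ⟨δ, rfl⟩, -⟩ := adj_cases _ (position z).2 _ _ hv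
      cases δ
      exacts [⟨Sum.inr ⟨j, hj⟩, rfl⟩, ⟨Sum.inl ⟨j, hj⟩, rfl⟩])
  -- The only forward step not covered by the potential is the one from position `t - 1` to position
  -- 0, where the holonomy `x` enters.
  have fwd : ∀ (i j : Fin t) ε δ, (i.1 + 1 = j ∨ i.1 + 1 = t ∧ j.1 = 0) →
      A (P (i + 1) ε) (P (j + 1) δ) * potential A P (j + 1) δ =
        sgn ε * potential A P (i + 1) ε * shiftMatrix t x i j := by
    intro i j ε δ hij
    rcases hij with hij | ⟨hi, hj⟩
    · have := hP.potential_eq h (i + 1) ε δ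
      simp only [hij, shiftMatrix, Matrix.of_apply, if_true, mul_one] at this ⊢
      exact this
    · have := hx ε δ
      have hne : t ≠ 0 := by omega
      simp only [shiftMatrix, Matrix.of_apply, hne, hi, hj, if_false, if_true, and_self,
        zero_add]
      exact this
  have zero : ∀ i j : Fin t, ¬ (i.1 + 1 = j ∨ i.1 + 1 = t ∧ j.1 = 0) → shiftMatrix t x i j = 0 := by
    intro i j hij
    rw [not_or] at hij
    simp [shiftMatrix, hij.1, hij.2]
  refine ⟨e, fun z => potential A P (position z + 1) (side z), fun z => np _ _, Or.inl ?_⟩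
  intro y z
  rw [he, he, toral_apply]
  beta_reduce
  generalize position y = i
  generalize position z = j
  generalize side y = ε
  generalize side z = δ
  by_cases h1 : i.1 + 1 = j ∨ i.1 + 1 = t ∧ j.1 = 0
  · rw [zero j i (by omega), fwd i j ε δ h1]
    simp
    ring
  · rw [zero i j h1]
    by_cases h2 : j.1 + 1 = i ∨ j.1 + 1 = t ∧ i.1 = 0
    · have h3 := congrArg star (fwd j i δ ε h2)
      have h4 : star (sgn δ) = sgn δ := by cases δ <;> simp [sgn]
      have k1 := star_mul_of_norm (np (i + 1) ε)
      have k2 := star_mul_of_norm (np (j + 1) δ)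
      rw [star_mul', star_mul', star_mul', ← h.herm, h4] at h3
      linear_combination (potential A P (i + 1) ε * potential A P (j + 1) δ) * h3 -
        A (P (i + 1) ε) (P (j + 1) δ) * potential A P (j + 1) δ * k1 +
        sgn δ * star (shiftMatrix t x j i) * potential A P (i + 1) ε * k2
    · have h0 : A (P (i + 1) ε) (P (j + 1) δ) = 0 := eq_zero_of_not_adj fun hadj => by
        obtain ⟨j', hj', ⟨δ', hδ'⟩, h3⟩ := adj_cases i i.2 ε _ hadj
        have := hinj _ j.2 _ hj' _ _ hδ'
        omega
      rw [zero j i h2, h0]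
      simp

/-- The classification in degree four, when the eigenvalues sum to zero. -/
theorem Quadratic.degree_four_of_eq_zero (h : Quadratic A 0 4) (u : V) :
    MSwitch A (IG W₅ unitEntries_W₅).gainMatrix ∨ MSwitch A (IG W₇ unitEntries_W₇).gainMatrix ∨
      IsNegativeDoubleOfDegreeThree A ∨
      ∃ (t : ℕ) (ht : 3 ≤ t) (x : Circle), MSwitch A (toral t ht x).gainMatrix := by
  by_cases hno : ∀ u v p q r s, Nb4 A u p q r s → Nb4 A v p q r s → u = v
  · rcases h.degree_four_without_twins hno u with h1 | h1 | h1
    exacts [Or.inl h1, Or.inr (Or.inl h1), Or.inr (Or.inr (Or.inl h1))]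
  · push Not at hno
    obtain ⟨u, v, p, q, r, s, hu, hv, huv⟩ := hno
    obtain ⟨f, g, hfg⟩ := h.exists_link hu hv huv
    obtain ⟨P, hP⟩ := h.exists_twinChain hfg
    exact Or.inr (Or.inr (Or.inr (hP.mswitch_toral h)))

end Toral

end GainGraph

namespace GainGraph

/-! ### Triangles in degree four with positive eigenvalue sum. -/

section PositiveSum

variable {V : Type u} [Fintype V] [DecidableEq V] {A : Matrix V V ℂ} {a : ℝ} {k : ℕ}

/-- The gain of the closed walk `u p q u`. -/
def tri (A : Matrix V V ℂ) (u p q : V) : ℂ := A u p * A p q * A q u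

theorem Quadratic.star_tri (h : Quadratic A a k) (u p q : V) : star (tri A u p q) = tri A u q p := by
  simp only [tri, star_mul', ← h.herm]
  ring

omit [Fintype V] [DecidableEq V] in
theorem tri_eq_zero {u p q : V} (hpq : ¬ Adj A p q) : tri A u p q = 0 := by
  simp [tri, eq_zero_of_not_adj hpq]

theorem Quadratic.norm_tri (h : Quadratic A a k) {u p q : V} (hup : Adj A u p) (huq : Adj A u q)
    (hpq : Adj A p q) : ‖tri A u p q‖ = 1 := by
  simp [tri, h.norm_eq_one hup, h.norm_eq_one (h.symm huq), h.norm_eq_one hpq]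

theorem Quadratic.tri_sum (h : Quadratic A a 4) {u p q r s : V} (hu : Nb4 A u p q r s) :
    tri A u q p + tri A u r p + tri A u s p = a := by
  have hup := (h.nb4_adj hu).1
  have e := h.sum4 hu (h.ne hup)
  simp only [h.diag] at e
  simp only [tri]
  linear_combination A p u * e + a * h.mul_swap hup

/-- An edge in three triangles forces the complete graph of order five. -/
theorem Quadratic.card_eq_five (h : Quadratic A a 4) (ha : 0 < a) {u v x y z : V}
    (hu : Nb4 A u v x y z) (hv : Nb4 A v u x y z) : Fintype.card V = 5 := by
  have ha0 : a ≠ 0 := ha.ne'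
  -- Otherwise the fourth edge at `y` needs a triangle through `u`, `v` or `x`, whose neighbourhoods
  -- are already full.
  have two : ∀ {x y z}, Nb4 A u v x y z → Nb4 A v u x y z → Adj A x y → Adj A x z → Adj A y z := by
    intro x y z hu hv hxy hxz
    by_contra hyz
    obtain ⟨uv, ux, uy, uz⟩ := h.nb4_adj hu
    obtain ⟨-, vx, vy, vz⟩ := h.nb4_adj hv
    have hx : Nb4 A x u v y z := h.nb4_of_four ⟨h.ne uv, h.ne uy, h.ne uz, h.ne vy, h.ne vz,
      hu.1.2.2.2.2.2⟩ (h.symm ux) (h.symm vx) hxy hxz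
    obtain ⟨y', hy⟩ := h.exists_nb4_of_three ⟨h.ne uv, h.ne ux, h.ne vx⟩ (h.symm uy) (h.symm vy)
      (h.symm hxy)
    have yy' := (h.nb4_adj hy).2.2.2
    obtain ⟨-, -, d1, -, d2, d3⟩ := hy.1
    have key : ∀ w, (Adj A w y' → y' = u ∨ y' = v ∨ y' = x ∨ y' = y ∨ y' = z) → ¬ Adj A w y' := by
      intro w hw hw'
      rcases hw hw' with g | g | g | g | g
      exacts [d1 g.symm, d2 g.symm, d3 g.symm, h.ne yy' g.symm, hyz (g ▸ yy')]
    obtain ⟨q, h1, h2⟩ := h.exists_triangle ha0 yy'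
    rcases (hy.2 q).1 h1 with rfl | rfl | rfl | rfl
    · exact key _ (fun h3 => by have := (hu.2 y').1 h3; tauto) (h.symm h2)
    · exact key _ (fun h3 => by have := (hv.2 y').1 h3; tauto) (h.symm h2)
    · exact key _ (fun h3 => by have := (hx.2 y').1 h3; tauto) (h.symm h2)
    · exact h.not_adj_self _ h2
  -- The edge `uz` lies in one triangle, so `a = 1`. The equations at `u` then make the triangle
  -- `uxy` have gain 1, which leaves gain 0 for the triangle `uvx`.
  have one : ∀ {x y z}, Nb4 A u v x y z → Nb4 A v u x y z → Adj A x y → ¬ Adj A x z →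
      ¬ Adj A y z → False := by
    intro x y z hu hv hxy hxz hyz
    obtain ⟨uv, ux, uy, uz⟩ := h.nb4_adj hu
    obtain ⟨-, vx, vy, vz⟩ := h.nb4_adj hv
    have e1 := h.tri_sum hu
    have e2 := h.tri_sum hu.swap12
    have e3 := h.tri_sum hu.swap23.swap12
    have e4 := h.tri_sum hu.swap34.swap23.swap12
    rw [tri_eq_zero (fun h' => hxz (h.symm h'))] at e2
    rw [tri_eq_zero (fun h' => hyz (h.symm h'))] at e3
    rw [tri_eq_zero hxz, tri_eq_zero hyz, add_zero, add_zero] at e4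
    have e4' := congrArg star e4
    rw [h.star_tri, star_ofReal_eq] at e4'
    have ha1 : (a : ℂ) = 1 := by
      have := congrArg norm e4
      rw [h.norm_tri uv uz vz, norm_real, Real.norm_of_nonneg ha.le] at this
      rw [← this]; simp
    have e1' := congrArg star e1
    simp only [star_add, h.star_tri, star_ofReal_eq] at e1'
    have hR := mul_star_of_norm (h.norm_tri ux uy hxy)
    rw [h.star_tri] at hR
    have h2 : tri A u x y + tri A u y x = 2 := by
      linear_combination e2 + e3 - e1' + e4 + 2 * ha1
    have h3 : tri A u x y = 1 := by
      have : (tri A u x y - 1) ^ 2 = 0 := by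
        linear_combination tri A u x y * h2 - hR
      exact sub_eq_zero.1 (pow_eq_zero_iff two_ne_zero |>.1 this)
    exact ne_zero_of_norm (h.norm_tri uv ux vx) (by linear_combination e2 - h2 + h3 + ha1)
  -- Each of the three triangles on `uv` would have gain `a`, while they sum to `a`.
  have zero : ¬ Adj A x y → ¬ Adj A x z → ¬ Adj A y z → False := by
    intro hxy hxz hyz
    have e1 := congrArg star (h.tri_sum hu)
    have e2 := h.tri_sum hu.swap12
    have e3 := h.tri_sum hu.swap23.swap12
    have e4 := h.tri_sum hu.swap34.swap23.swap12
    simp only [star_add, h.star_tri, star_ofReal_eq] at e1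
    rw [tri_eq_zero (fun h' => hxz (h.symm h')), tri_eq_zero (fun h' => hxy (h.symm h'))] at e2
    rw [tri_eq_zero (fun h' => hyz (h.symm h')), tri_eq_zero hxy] at e3
    rw [tri_eq_zero hxz, tri_eq_zero hyz] at e4
    have : (a : ℂ) = 0 := by linear_combination (e1 - e2 - e3 - e4) / 2
    exact ha0 (by exact_mod_cast this)
  have all : Adj A x y ∧ Adj A x z ∧ Adj A y z := by
    have sy := fun {x y : V} (hxy : ¬ Adj A x y) (hyx : Adj A y x) => hxy (h.symm hyx)
    by_cases hxy : Adj A x y <;> by_cases hxz : Adj A x z <;> by_cases hyz : Adj A y z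
    · exact ⟨hxy, hxz, hyz⟩
    · exact absurd (two hu hv hxy hxz) hyz
    · exact absurd (two hu.swap23 hv.swap23 (h.symm hxy) hyz) hxz
    · exact (one hu hv hxy hxz hyz).elim
    · exact absurd (two hu.swap34.swap23 hv.swap34.swap23 (h.symm hxz) (h.symm hyz)) hxy
    · exact (one hu.swap34 hv.swap34 hxz hxy (sy hyz)).elim
    · exact (one hu.swap23.swap34 hv.swap23.swap34 hyz (sy hxy) (sy hxz)).elim
    · exact (zero hxy hxz hyz).elim
  obtain ⟨hxy, hxz, hyz⟩ := all
  obtain ⟨uv, ux, uy, uz⟩ := h.nb4_adj hu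
  obtain ⟨-, vx, vy, vz⟩ := h.nb4_adj hv
  obtain ⟨e, -⟩ := h.exists_equiv ![u, v, x, y, z] (by
      have d1 := hu.1
      have d2 := hv.1
      have d3 := h.ne uv
      clear * - d1 d2 d3
      rw [← List.nodup_ofFn]
      simp
      grind) (by
    have hx : Nb4 A x u v y z := h.nb4_of_four ⟨h.ne uv, h.ne uy, h.ne uz, h.ne vy, h.ne vz,
      h.ne hyz⟩ (h.symm ux) (h.symm vx) hxy hxz
    have hy : Nb4 A y u v x z := h.nb4_of_four ⟨h.ne uv, h.ne ux, h.ne uz, h.ne vx, h.ne vz,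
      h.ne hxz⟩ (h.symm uy) (h.symm vy) (h.symm hxy) hyz
    have hz : Nb4 A z u v x y := h.nb4_of_four ⟨h.ne uv, h.ne ux, h.ne uy, h.ne vx, h.ne vy,
      h.ne hxy⟩ (h.symm uz) (h.symm vz) (h.symm hxz) (h.symm hyz)
    have key := fun {e v' : V} {i j k l : Fin 5} => Nb4.exists_eq (A := A)
      (c := ![u, v, x, y, z]) (e := e) (i := i) (j := j) (k := k) (l := l) (v := v')
    intro i w hw
    suffices ∃ j, w = ![u, v, x, y, z] j by
      obtain ⟨j, rfl⟩ := this; exact ⟨j, rfl⟩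
    revert hw
    fin_cases i
    exacts [key (i := 1) (j := 2) (k := 3) (l := 4) hu, key (i := 0) (j := 2) (k := 3) (l := 4) hv,
      key (i := 0) (j := 1) (k := 3) (l := 4) hx, key (i := 0) (j := 1) (k := 2) (l := 4) hy,
      key (i := 0) (j := 1) (k := 2) (l := 3) hz])
  simpa using (Fintype.card_congr e).symm

/-- Every edge at `u` lies in at most one triangle. -/
def UniqueTriangles (A : Matrix V V ℂ) (u : V) : Prop :=
  ∀ v w w', Adj A u v → Adj A u w → Adj A v w → Adj A u w' → Adj A v w' → w = w'

/-- No edge lies in three triangles. -/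
def NoTripleEdge (A : Matrix V V ℂ) : Prop :=
  ∀ u v x y z, Nb4 A u v x y z → Adj A v x → Adj A v y → ¬ Adj A v z

/-- An edge in a single triangle has `a` as the gain of that triangle, so `a = 1`. The adjacencies
among the neighbours of `u` are then `vx` and possibly `yz`. -/
theorem Quadratic.local_matching (h : Quadratic A a 4) (ha : 0 < a) (hno : NoTripleEdge A)
    {u v x y z : V} (hu : Nb4 A u v x y z) (hvx : Adj A v x) (hvy : ¬ Adj A v y)
    (hvz : ¬ Adj A v z) : UniqueTriangles A u ∧ a = 1 := by
  have sy := fun {x y : V} (hxy : ¬ Adj A x y) (hyx : Adj A y x) => hxy (h.symm hyx)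
  -- The triangle `uvx` alone already accounts for `a`, so the triangle `uxy` on the edge `ux` would
  -- have gain 0.
  have path : ∀ {y z}, Nb4 A u v x y z → ¬ Adj A v y → ¬ Adj A v z → ¬ Adj A x z → ¬ Adj A x y := by
    intro y z hu hvy hvz hxz hxy
    obtain ⟨uv, ux, uy, uz⟩ := h.nb4_adj hu
    have e1 := congrArg star (h.tri_sum hu)
    have e2 := h.tri_sum hu.swap12
    simp only [star_add, h.star_tri, star_ofReal_eq] at e1
    rw [tri_eq_zero hvy, tri_eq_zero hvz] at e1
    rw [tri_eq_zero (sy hxz)] at e2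
    exact ne_zero_of_norm (h.norm_tri uy ux (h.symm hxy)) (by linear_combination e2 - e1)
  obtain ⟨uv, ux, uy, uz⟩ := h.nb4_adj hu
  have hnot := hno u x v y z hu.swap12 (h.symm hvx)
  have hxy : ¬ Adj A x y := fun h1 => path hu hvy hvz (hnot h1) h1
  have hxz : ¬ Adj A x z := path hu.swap34 hvz hvy hxy
  have ha1 : a = 1 := by
    have e1 := h.tri_sum hu
    rw [tri_eq_zero (sy hvy), tri_eq_zero (sy hvz), add_zero, add_zero] at e1
    have := congrArg norm e1
    rw [h.norm_tri ux uv (h.symm hvx), norm_real, Real.norm_of_nonneg ha.le] at this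
    exact this.symm
  refine ⟨?_, ha1⟩
  intro c w w' h1 h2 h3 h4 h5
  have f1 := (hu.2 c).1 h1
  have f2 := (hu.2 w).1 h2
  have f3 := (hu.2 w').1 h4
  have n1 := h.not_adj_self
  have n2 := sy hvy
  have n3 := sy hvz
  have n4 := sy hxy
  have n5 := sy hxz
  clear * - f1 f2 f3 n1 n2 n3 n4 n5 hvy hvz hxy hxz h3 h5
  rcases f1 with rfl | rfl | rfl | rfl <;> rcases f2 with rfl | rfl | rfl | rfl <;>
    rcases f3 with rfl | rfl | rfl | rfl <;> first | rfl | (exfalso; simp_all)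

/-- The triangle `uxy` and a triangle `vpp'` are joined by edges `uv`, `xp`, `yp'` into a prism. Its
triangles have gain 1, while orthogonality makes each of its three quadrangles negative. Going
around the prism gives a contradiction of signs. -/
theorem Quadratic.not_uniqueTriangles (h : Quadratic A 1 4) (u : V)
    (hone : ∀ u, UniqueTriangles A u) : False := by
  have ha : (1 : ℝ) ≠ 0 := one_ne_zero
  have sy := fun {x y : V} (hxy : Adj A x y) => h.symm hxy
  obtain ⟨v, uv⟩ := h.exists_adj four_ne_zero u
  obtain ⟨w, uw, vw⟩ := h.exists_triangle ha uv
  obtain ⟨x, y, hu⟩ := h.exists_nb4_of_two (h.ne vw) uv uw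
  obtain ⟨-, -, ux, uy⟩ := h.nb4_adj hu
  obtain ⟨d1, d2, d3, d4, d5, d6⟩ := hu.1
  have vx : ¬ Adj A v x := fun h' => d4 (hone u v w x uv uw vw ux h')
  have vy : ¬ Adj A v y := fun h' => d5 (hone u v w y uv uw vw uy h')
  have wx : ¬ Adj A w x := fun h' => d2 (hone u w v x uw uv (sy vw) ux h')
  have wy : ¬ Adj A w y := fun h' => d3 (hone u w v y uw uv (sy vw) uy h')
  have xy : Adj A x y := by
    obtain ⟨q, h1, h2⟩ := h.exists_triangle ha ux
    rcases (hu.2 q).1 h1 with rfl | rfl | rfl | rfl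
    exacts [absurd (sy h2) vx, absurd (sy h2) wx, absurd h2 (h.not_adj_self _), h2]
  obtain ⟨p, p', hv⟩ := h.exists_nb4_of_two (h.ne uw) (sy uv) vw
  -- Nonadjacent vertices cannot share only `u`.
  have pick : ∀ {x}, v ≠ x → Adj A u x → ¬ Adj A v x → ¬ Adj A w x → Adj A p x ∨ Adj A p' x := by
    intro x vx' ux vx wx
    obtain ⟨q, h1, h2, h3⟩ := h.exists_other vx' (by simp [eq_zero_of_not_adj vx]) (sy uv) (sy ux)
    rcases (hv.2 q).1 h2 with rfl | rfl | rfl | rfl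
    exacts [absurd rfl h1, absurd (sy h3) wx, Or.inl (sy h3), Or.inr (sy h3)]
  have main : ∀ {p p'}, Nb4 A v u w p p' → Adj A p x → Adj A p' y → False := by
    intro p p' hv px py
    obtain ⟨-, -, vp, vp'⟩ := h.nb4_adj hv
    obtain ⟨-, f2, f3, f4, f5, f6⟩ := hv.1
    have pp' : Adj A p p' := by
      have up : ¬ Adj A u p := fun h' => f4 (hone u v w p uv uw vw h' vp)
      have wp : ¬ Adj A w p := fun h' => f2 (hone v w u p vw (sy uv) (sy uw) vp h')
      obtain ⟨q, h1, h2⟩ := h.exists_triangle ha vp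
      rcases (hv.2 q).1 h1 with rfl | rfl | rfl | rfl
      exacts [absurd (sy h2) up, absurd (sy h2) wp, absurd h2 (h.not_adj_self _), h2]
    have p'x : ¬ Adj A p' x := fun h' => f3 (hone x y u p' xy (sy ux) (sy uy) (sy h') (sy py))
    have py' : ¬ Adj A p y := fun h' => f2 (hone x y u p xy (sy ux) (sy uy) (sy px) (sy h'))
    have e1 := h.sum4 hv d2
    have e2 := h.sum4 hv d3
    rw [eq_zero_of_not_adj wx, eq_zero_of_not_adj p'x, eq_zero_of_not_adj vx] at e1
    rw [eq_zero_of_not_adj wy, eq_zero_of_not_adj py', eq_zero_of_not_adj vy] at e2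
    have xp' : x ≠ p' := fun h' => vx (h' ▸ vp')
    obtain ⟨q, hp⟩ := h.exists_nb4_of_three ⟨h.ne vp', d2, xp'.symm⟩ (sy vp) pp' px
    have pq := (h.nb4_adj hp).2.2.2
    have qx : Adj A q x := by
      obtain ⟨s, h1, h2⟩ := h.exists_triangle ha px
      rcases (hp.2 s).1 h1 with rfl | rfl | rfl | rfl
      exacts [absurd (sy h2) vx, absurd (sy h2) p'x, absurd h2 (h.not_adj_self _), sy h2]
    have qy : ¬ Adj A q y := fun h' => by
      have := hone x y u q xy (sy ux) (sy uy) (sy qx) (sy h')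
      subst this
      exact f4 (hone u v w p uv uw vw (sy pq) vp)
    have hpy : p ≠ y := fun h' => vy (h' ▸ vp)
    have e3 := h.sum4 hp hpy
    rw [eq_zero_of_not_adj vy, eq_zero_of_not_adj qy, eq_zero_of_not_adj py'] at e3
    have hux : A u x * A x y = A u y := by
      have e := h.sum4 hu (h.ne uy)
      rw [eq_zero_of_not_adj vy, eq_zero_of_not_adj wy, h.diag] at e
      simpa using e
    have hvp : A v p * A p p' = A v p' := by
      have e := h.sum4 hv (h.ne vp')
      have up' : ¬ Adj A u p' := fun h' => f5 (hone u v w p' uv uw vw h' vp')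
      have wp' : ¬ Adj A w p' := fun h' => f3 (hone v w u p' vw (sy uv) (sy uw) vp' h')
      rw [eq_zero_of_not_adj up', eq_zero_of_not_adj wp', h.diag] at e
      simpa using e
    exact mul_ne_zero (sy uv) uy (by linear_combination (A x y * e1 + e2 - A v p * e3 +
      A p' y * hvp - A v u * hux) / 2)
  have key : ∀ {p p'}, Nb4 A v u w p p' → Adj A p x → (Adj A p y ∨ Adj A p' y) → False := by
    intro p p' hv px hy
    rcases hy with py | py
    · exact hv.1.2.1 (hone x y u p xy (sy ux) (sy uy) (sy px) (sy py))
    · exact main hv px py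
  rcases pick d2 ux vx wx with h1 | h1
  · exact key hv h1 (pick d3 uy vy wy)
  · exact key hv.swap34 h1 (pick d3 uy vy wy).symm

end PositiveSum

end GainGraph

namespace GainGraph

/-! ### The octahedron with its gains. -/

section Octahedron

variable {V : Type u} [Fintype V] [DecidableEq V] {A : Matrix V V ℂ} {a : ℝ} {k : ℕ}

/-- An edge in a triangle is in at least two triangles. -/
def NoSingleEdge (A : Matrix V V ℂ) : Prop :=
  ∀ u v x y z, Nb4 A u v x y z → Adj A v x → ¬ Adj A v y → Adj A v z

/-- Every edge lies in exactly two triangles, so the neighbours of `u` induce a graph of degree two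
on four vertices, a quadrangle. -/
theorem Quadratic.local_cycle (h : Quadratic A a 4) (ha : a ≠ 0) (h1 : NoSingleEdge A)
    (h3 : NoTripleEdge A) {u p q r s : V} (hu : Nb4 A u p q r s) (hpq : Adj A p q)
    (hps : Adj A p s) : ¬ Adj A p r ∧ Adj A r q ∧ Adj A r s ∧ ¬ Adj A q s := by
  have hpr := h3 u p q s r hu.swap34 hpq hps
  have hur := (h.nb4_adj hu).2.2.1
  have hr : Nb4 A u r q s p := hu.swap12.swap23.swap34.swap12.swap23.swap23
  have hrqs : Adj A r q ∧ Adj A r s := by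
    have hrp : ¬ Adj A r p := fun h' => hpr (h.symm h')
    obtain ⟨w, hw1, hw2⟩ := h.exists_triangle ha hur
    rcases (hr.2 w).1 hw1 with rfl | rfl | rfl | rfl
    · exact absurd hw2 (h.not_adj_self _)
    · exact ⟨hw2, h1 u r w p s hr.swap34 hw2 hrp⟩
    · exact ⟨h1 u r w p q hr.swap23.swap34 hw2 hrp, hw2⟩
    · exact absurd hw2 hrp
  exact ⟨hpr, hrqs.1, hrqs.2, h3 u q p r s hu.swap12 (h.symm hpq) (h.symm hrqs.1)⟩

/-- The fourth neighbours of `p` and `r` both see `q` and `s`. The neighbourhood of `q` has room for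
only one such vertex, so they coincide in the antipode `w` of `u`. -/
theorem Quadratic.octahedron (h : Quadratic A a 4) (ha : a ≠ 0) (h1 : NoSingleEdge A)
    (h3 : NoTripleEdge A) (u : V) : ∃ w p q r s, (Nb4 A u p q r s ∧ Nb4 A w p q r s) ∧
      (Nb4 A p u q s w ∧ Nb4 A r u q s w) ∧ Nb4 A q u p r w ∧ Nb4 A s u p r w ∧ u ≠ w := by
  have sy := fun {x y : V} (hxy : Adj A x y) => h.symm hxy
  obtain ⟨p, up⟩ := h.exists_adj four_ne_zero u
  obtain ⟨q, uq, pq⟩ := h.exists_triangle ha up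
  obtain ⟨r, s, hu, ps⟩ : ∃ r s, Nb4 A u p q r s ∧ Adj A p s := by
    obtain ⟨r, s, hu⟩ := h.exists_nb4_of_two (h.ne pq) up uq
    by_cases hr : Adj A p r
    · exact ⟨s, r, hu.swap34, hr⟩
    · exact ⟨r, s, hu, h1 u p q r s hu pq hr⟩
  obtain ⟨pr, rq, rs, qs⟩ := h.local_cycle ha h1 h3 hu pq ps
  obtain ⟨-, -, ur, us⟩ := h.nb4_adj hu
  obtain ⟨d1, d2, d3, d4, d5, d6⟩ := hu.1
  have step : ∀ {p r}, Nb4 A u p q r s → Adj A p q → Adj A p s → ¬ Adj A p r →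
      ∃ w, Nb4 A p u q s w ∧ Adj A w q ∧ Adj A w s := by
    intro p r hu pq ps pr
    obtain ⟨w, hp⟩ := h.exists_nb4_of_three ⟨h.ne uq, h.ne us, d5⟩ (sy (h.nb4_adj hu).1) pq ps
    obtain ⟨-, h4, h5, -⟩ := h.local_cycle ha h1 h3 hp.swap34 uq us
    exact ⟨w, hp, h4, h5⟩
  obtain ⟨w, hp, wq, ws⟩ := step hu pq ps pr
  obtain ⟨w', hr, wq', ws'⟩ := step hu.swap12.swap23.swap12 rq rs (fun h' => pr (sy h'))
  have pw := (h.nb4_adj hp).2.2.2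
  have rw' := (h.nb4_adj hr).2.2.2
  have uw : u ≠ w := hp.1.2.2.1
  have hq : Nb4 A q u p r w := h.nb4_of_four ⟨h.ne up, h.ne ur, uw, d2, h.ne pw,
    fun h' => pr (h' ▸ pw)⟩ (sy uq) (sy pq) (sy rq) (sy wq)
  have hs : Nb4 A s u p r w := h.nb4_of_four ⟨h.ne up, h.ne ur, uw, d2, h.ne pw,
    fun h' => pr (h' ▸ pw)⟩ (sy us) (sy ps) (sy rs) (sy ws)
  have hww : w' = w := by
    rcases (hq.2 w').1 (sy wq') with g | g | g | g
    · exact absurd g.symm hr.1.2.2.1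
    · subst g; exact absurd (sy rw') pr
    · exact absurd g.symm (h.ne rw')
    · exact g
  subst hww
  exact ⟨w', p, q, r, s, ⟨hu, h.nb4_of_four hu.1 (sy pw) wq (sy rw') ws⟩, ⟨hp, hr⟩, hq, hs, uw⟩

theorem eq_of_add_star {p q : ℂ} (hp : ‖p‖ = 1) (hq : ‖q‖ = 1) (ha : a ≠ 0)
    (h : p + star q = a) : p = q := by
  have h' := congrArg star h
  simp only [star_add, star_star, star_ofReal_eq] at h'
  have : (a : ℂ) * (p - q) = 0 := by
    linear_combination q * h - p * h' + mul_star_of_norm hp - mul_star_of_norm hq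
  rcases mul_eq_zero.1 this with h1 | h1
  · exact absurd (by exact_mod_cast h1) ha
  · exact sub_eq_zero.1 h1

theorem γ_sq : γ ^ 2 = I := by
  rw [γ, ← Complex.exp_nat_mul]
  refine (congrArg _ ?_).trans Complex.exp_pi_div_two_mul_I
  push_cast
  ring

theorem γ_add_star : γ + star γ = (√2 : ℝ) := by
  rw [star_def, Complex.add_conj, γ, Complex.exp_ofReal_mul_I_re,
    show 2 * Real.pi / 8 = Real.pi / 4 by ring, Real.cos_pi_div_four]
  congr 1
  ring

theorem γ_sub_star : γ - star γ = (√2 : ℝ) * I := by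
  rw [star_def, Complex.sub_conj, γ, Complex.exp_ofReal_mul_I_im,
    show 2 * Real.pi / 8 = Real.pi / 4 by ring, Real.sin_pi_div_four]
  congr 2
  ring

theorem eq_sqrt_two (ha : 0 < a) (h2 : a ^ 2 = 2) : a = √2 :=
  ((Real.sqrt_eq_iff_mul_self_eq_of_pos ha).2 (by nlinarith)).symm

theorem eq_γ_or (ha : 0 < a) {p : ℂ} (hp : ‖p‖ = 1) (h : p + star p = a) (h2 : a ^ 2 = 2) :
    p = γ ∨ p = star γ := by
  rw [eq_sqrt_two ha h2, ← γ_add_star] at h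
  have h4 := mul_star_of_norm hp
  have h5 := mul_star_of_norm norm_γ
  have : (p - γ) * (p - star γ) = 0 := by linear_combination p * h + h5 - h4
  simpa [sub_eq_zero] using this

/-- The two triangles on each edge at `u` have gains with real sum `a`, so all four triangles around
`u` have the same gain in the cyclic direction. The nonadjacent vertices `p` and `r` then leave the
walk through `w` a relative gain `1 - a²`. Its modulus is 1, so `a² = 2`. -/
theorem Quadratic.octahedron_gains (h : Quadratic A a 4) (ha : 0 < a) {u w p q r s : V} 
    (hu : Nb4 A u p q r s) (hp : Nb4 A p u q s w) (hr : Nb4 A r u q s w) (hq : Nb4 A q u p r w)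
    (hs : Nb4 A s u p r w) (hw : Nb4 A w p q r s) (huw : u ≠ w) :
    a ^ 2 = 2 ∧ tri A u p q + star (tri A u p q) = a ∧ tri A u q r = tri A u p q ∧
      tri A u r s = tri A u p q ∧ tri A u s p = tri A u p q ∧
      A w r * A r u = -(A w p * A p u) ∧ A w s * A s u = -(A w q * A q u) ∧
      A w q * A q u * (star (tri A u p q) - tri A u p q) = a * (A w p * A p u) := by
  obtain ⟨up, uq, ur, us⟩ := h.nb4_adj hu
  obtain ⟨-, pq, ps, pw⟩ := h.nb4_adj hp
  obtain ⟨-, rq, rs, rw'⟩ := h.nb4_adj hr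
  obtain ⟨-, -, -, qw⟩ := h.nb4_adj hq
  obtain ⟨-, -, -, sw⟩ := h.nb4_adj hs
  have sy := fun {x y : V} (hxy : Adj A x y) => h.symm hxy
  have upw : ¬ Adj A u w := fun h' => by
    rcases (hu.2 w).1 h' with rfl | rfl | rfl | rfl
    exacts [h.ne pw rfl, h.ne qw rfl, h.ne rw' rfl, h.ne sw rfl]
  have pr : ¬ Adj A p r := fun h' => by
    rcases (hp.2 r).1 h' with rfl | rfl | rfl | rfl
    exacts [h.ne ur rfl, h.ne rq rfl, h.ne rs rfl, h.ne rw' rfl]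
  have qs : ¬ Adj A q s := fun h' => by
    rcases (hq.2 s).1 h' with rfl | rfl | rfl | rfl
    exacts [h.ne us rfl, h.ne ps rfl, h.ne rs rfl, h.ne sw rfl]
  have pr' : ¬ Adj A r p := fun h' => pr (sy h')
  have qs' : ¬ Adj A s q := fun h' => qs (sy h')
  have t1 := h.tri_sum hu.swap12
  have t2 := h.tri_sum hu.swap23.swap12
  have t3 := h.tri_sum hu.swap34.swap23.swap12
  rw [tri_eq_zero qs', add_zero, ← h.star_tri u q r] at t1
  rw [tri_eq_zero pr, zero_add, ← h.star_tri u r s] at t2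
  rw [tri_eq_zero qs, add_zero, add_comm, ← h.star_tri u s p] at t3
  have n1 := h.norm_tri up uq pq
  have n2 := h.norm_tri uq ur (sy rq)
  have n3 := h.norm_tri ur us rs
  have n4 := h.norm_tri us up (sy ps)
  have e1 := eq_of_add_star n1 n2 ha.ne' t1
  have e2 := eq_of_add_star n2 n3 ha.ne' t2
  have e3 := eq_of_add_star n3 n4 ha.ne' t3
  rw [← e1] at t1
  have m1 := h.mul_swap up
  have m2 := h.mul_swap uq
  have m3 := h.mul_swap ur
  have m4 := h.mul_swap us
  have nT : ∀ {x y z w : V}, Adj A x y → Adj A z w → ‖A x y * A z w‖ = 1 := fun h1 h2 => by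
    simp [h.norm_eq_one h1, h.norm_eq_one h2]
  have hpp := mul_star_of_norm n1
  -- Relative to the walk through `u`, the walks from `p` to `r` through `q` and `s` contribute the
  -- product of two consecutive triangles and its conjugate, with sum `a² - 2`.
  have opp : ∀ {p q r s}, Nb4 A p u q s w → Adj A u p → Adj A u q → Adj A u r → Adj A u s →
      Adj A w p → Adj A w r → p ≠ r → ¬ Adj A p r →
      tri A u p q * tri A u q r + tri A u p s * tri A u s r = a ^ 2 - 2 →
      A w r * A r u = (1 - a ^ 2) * (A w p * A p u) := by
    intro p q r s hp up uq ur us wp wr hpr pr ht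
    have e := h.sum4 hp hpr
    rw [eq_zero_of_not_adj pr] at e
    simp only [tri] at ht
    have m1 := h.mul_swap up
    have m2 := h.mul_swap uq
    have m3 := h.mul_swap ur
    have m4 := h.mul_swap us
    have m5 := h.mul_swap wp
    linear_combination (A u p * A r u * A w p * A p u) * e - A w p * A p u * ht -
      A r u * A w r * (A w p * A p w * m1 + m5) - A w p * A p u * (A u r * A r u * m1 + m3) +
      A w p * A p u * A u p * A r u * A p q * A q r * m2 +
      A w p * A p u * A u p * A r u * A p s * A s r * m4
  have x3 := opp (q := q) (s := s) hp up uq ur us (sy pw) (sy rw') hu.1.2.1 pr (by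
    rw [← h.star_tri u s p, ← h.star_tri u r s, ← e3, ← e2, ← e1]
    linear_combination (tri A u p q + star (tri A u p q) + a) * t1 - 2 * hpp)
  have x4 := opp (q := p) (s := r) hq uq up us ur (sy qw) (sy sw) hu.1.2.2.2.2.1 qs (by
    rw [← h.star_tri u p q, ← h.star_tri u s p, ← e3, ← e2, ← e1]
    linear_combination (tri A u p q + star (tri A u p q) + a) * t1 - 2 * hpp)
  have ha2 : a ^ 2 = 2 := by
    have := congrArg norm x3
    rw [norm_mul _ (A w p * A p u), nT (sy rw') (sy ur), nT (sy pw) (sy up), mul_one,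
      show (1 - (a : ℂ) ^ 2) = ((1 - a ^ 2 : ℝ) : ℂ) by push_cast; ring, norm_real,
      Real.norm_eq_abs] at this
    rcases eq_or_eq_neg_of_abs_eq this.symm with h5 | h5 <;> nlinarith
  have ha2' : (a : ℂ) ^ 2 = 2 := by exact_mod_cast ha2
  have x3' : A w r * A r u = -(A w p * A p u) := by rw [x3, ha2']; ring
  have x4' : A w s * A s u = -(A w q * A q u) := by rw [x4, ha2']; ring
  refine ⟨ha2, t1, e1.symm, (e1.trans e2).symm, (e1.trans (e2.trans e3)).symm, x3', x4', ?_⟩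
  have e := h.sum4 hw (h.ne pw).symm
  rw [eq_zero_of_not_adj pr', h.diag] at e
  have f : tri A u s p = tri A u p q := (e1.trans (e2.trans e3)).symm
  have g : star (tri A u p q) = A u q * A q p * A p u := h.star_tri u p q
  rw [g, ← f]
  simp only [tri]
  linear_combination A p u * e + A w q * A q p * A p u * m2 - A u s * A s p * A p u * x4' +
    A w s * A s p * A p u * m4

/-- Hermitian matrices with zero diagonal can be compared above the diagonal. -/
theorem Quadratic.mswitch_of_lt {n : ℕ} (h : Quadratic A a k) {B : Matrix (Fin n) (Fin n) ℂ}
    (hB : B.IsHermitian) (hB0 : ∀ i, B i i = 0) (e : Fin n ≃ V) (s : Fin n → ℂ)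
    (hs : ∀ i, ‖s i‖ = 1)
    (hlt : (∀ i j, i < j → A (e i) (e j) * s j = s i * B i j) ∨
      ∀ i j, i < j → A (e i) (e j) * s j = s i * star (B i j)) : MSwitch A B := by
  have key : ∀ i j b, A (e j) (e i) * s i = s j * b → A (e i) (e j) * s j = s i * star b := by
    intro i j b hb
    have h3 := congrArg star hb
    simp only [star_mul', ← h.herm] at h3
    linear_combination (s i * s j) * h3 - A (e i) (e j) * s j * star_mul_of_norm (hs i) +
      s i * star b * star_mul_of_norm (hs j)
  refine ⟨e, s, hs, hlt.imp (fun hlt i j => ?_) fun hlt i j => ?_⟩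
  · rcases lt_trichotomy i j with hij | rfl | hij
    · exact hlt i j hij
    · simp [h.diag, hB0]
    · rw [key i j _ (hlt j i hij), hB.apply]
  · rcases lt_trichotomy i j with hij | rfl | hij
    · exact hlt i j hij
    · simp [h.diag, hB0]
    · rw [key i j _ (hlt j i hij), star_star, ← hB.apply i j, star_star]

/-- Edges at `u` are normalised first, and then the triangle gain determines everything. It is one
of two conjugate eighth roots of unity, which correspond to the model and its converse. -/
theorem Quadratic.mswitch_octahedron (h : Quadratic A a 4) (ha : 0 < a) {u w p q r s : V}
    (hu : Nb4 A u p q r s) (hp : Nb4 A p u q s w) (hr : Nb4 A r u q s w) (hq : Nb4 A q u p r w)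
    (hs : Nb4 A s u p r w) (hw : Nb4 A w p q r s) (huw : u ≠ w) :
    MSwitch A K₂₂₂γ.gainMatrix := by
  obtain ⟨e, he⟩ := h.exists_equiv ![w, u, p, r, q, s] (by
      have d1 := hu.1
      have d2 := hp.1
      have d3 := hq.1
      have d4 := hr.1
      have d5 := hs.1
      have d6 := h.ne (h.nb4_adj hu).1
      have d7 := h.ne (h.nb4_adj hu).2.1
      have d8 := h.ne (h.nb4_adj hu).2.2.1
      have d9 := h.ne (h.nb4_adj hu).2.2.2
      have d10 := h.ne (h.nb4_adj hw).1
      have d11 := h.ne (h.nb4_adj hw).2.1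
      have d12 := h.ne (h.nb4_adj hw).2.2.1
      have d13 := h.ne (h.nb4_adj hw).2.2.2
      clear * - d1 d2 d3 d4 d5 d6 d7 d8 d9 d10 d11 d12 d13
      rw [← List.nodup_ofFn]
      simp
      grind) (by
    have key := fun {e v' : V} {i j k l : Fin 6} => Nb4.exists_eq (A := A)
      (c := ![w, u, p, r, q, s]) (e := e) (i := i) (j := j) (k := k) (l := l) (v := v')
    intro i v hv
    suffices ∃ j, v = ![w, u, p, r, q, s] j by
      obtain ⟨j, rfl⟩ := this; exact ⟨j, rfl⟩
    revert hv
    fin_cases i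
    exacts [key (i := 2) (j := 4) (k := 3) (l := 5) hw, key (i := 2) (j := 4) (k := 3) (l := 5) hu,
      key (i := 1) (j := 4) (k := 5) (l := 0) hp, key (i := 1) (j := 4) (k := 5) (l := 0) hr,
      key (i := 1) (j := 2) (k := 3) (l := 0) hq, key (i := 1) (j := 2) (k := 3) (l := 0) hs])
  obtain ⟨ha2, f1, f2, f3, f4, x3, x4, x2⟩ := h.octahedron_gains ha hu hp hr hq hs hw huw
  obtain ⟨up, uq, ur, us⟩ := h.nb4_adj hu
  obtain ⟨-, pq, ps, pw⟩ := h.nb4_adj hp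
  obtain ⟨-, rq, rs, rw'⟩ := h.nb4_adj hr
  obtain ⟨-, -, -, qw⟩ := h.nb4_adj hq
  obtain ⟨-, -, -, sw⟩ := h.nb4_adj hs
  have sy := fun {x y : V} (hxy : Adj A x y) => h.symm hxy
  have n := fun {x y : V} (hxy : Adj A x y) => h.norm_eq_one hxy
  have upw : A w u = 0 := eq_zero_of_not_adj fun h' => by
    rcases (hw.2 u).1 h' with rfl | rfl | rfl | rfl
    exacts [h.ne up rfl, h.ne uq rfl, h.ne ur rfl, h.ne us rfl]
  have pr : A p r = 0 := eq_zero_of_not_adj fun h' => by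
    rcases (hp.2 r).1 h' with rfl | rfl | rfl | rfl
    exacts [h.ne ur rfl, h.ne rq rfl, h.ne rs rfl, h.ne rw' rfl]
  have qs : A q s = 0 := eq_zero_of_not_adj fun h' => by
    rcases (hq.2 s).1 h' with rfl | rfl | rfl | rfl
    exacts [h.ne us rfl, h.ne ps rfl, h.ne rs rfl, h.ne sw rfl]
  have m1 := h.mul_swap up
  have m2 := h.mul_swap uq
  have m3 := h.mul_swap ur
  have m4 := h.mul_swap us
  have n1 := h.norm_tri up uq pq
  -- The parameters stand for `I, γ` or for their conjugates, so both cases share one computation.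
  have main : ∀ ξ p0 : ℂ, ‖ξ‖ = 1 → star ξ = -ξ → ξ ^ 2 = -1 → tri A u p q = star p0 →
      A w q * A q u = -ξ * (A w p * A p u) →
      ∀ i j, i < j → A (e i) (e j) * ![A w p * A p u * ξ, 1, A p u, A r u, -A q u, A s u] j =
        ![A w p * A p u * ξ, 1, A p u, A r u, -A q u, A s u] i *
          !![0, 0, -ξ, ξ, 1, 1; 0, 0, 1, 1, -1, 1; ξ, 1, 0, 0, -star p0, p0;
            -ξ, 1, 0, 0, -p0, star p0; 1, -1, -p0, -star p0, 0, 0; 1, 1, star p0, p0, 0, 0] i j := by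
    intro ξ p0 hξ sξ ξ2 hp0 hq0 i j hij
    rw [he, he]
    have g1 : A u p * A p q * A q u = star p0 := hp0
    have g2 : A u p * A p s * A s u = p0 := by
      have := congrArg star (f4.trans hp0)
      rwa [h.star_tri, star_star] at this
    have g3 : A u r * A r q * A q u = p0 := by
      have := congrArg star (f2.trans hp0)
      rwa [h.star_tri, star_star] at this
    have g4 : A u r * A r s * A s u = star p0 := f3.trans hp0
    clear he
    fin_cases i <;> fin_cases j <;> first | exact absurd hij (by decide) | skip
    · exact (by rw [upw]; ring : A w u * 1 = A w p * A p u * ξ * 0)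
    · exact (by linear_combination A w p * A p u * ξ2 :
        A w p * A p u = A w p * A p u * ξ * -ξ)
    · exact (by linear_combination x3 - A w p * A p u * ξ2 :
        A w r * A r u = A w p * A p u * ξ * ξ)
    · exact (by linear_combination -hq0 : A w q * -A q u = A w p * A p u * ξ * 1)
    · exact (by linear_combination x4 - hq0 : A w s * A s u = A w p * A p u * ξ * 1)
    · exact (by rw [m1, mul_one] : A u p * A p u = 1 * 1)
    · exact (by rw [m3, mul_one] : A u r * A r u = 1 * 1)
    · exact (by linear_combination -m2 : A u q * -A q u = 1 * -1)
    · exact (by rw [m4, mul_one] : A u s * A s u = 1 * 1)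
    · exact (by rw [pr]; ring : A p r * A r u = A p u * 0)
    · exact (by linear_combination A p q * A q u * m1 - A p u * g1 :
        A p q * -A q u = A p u * -star p0)
    · exact (by linear_combination -(A p s * A s u) * m1 + A p u * g2 :
        A p s * A s u = A p u * p0)
    · exact (by linear_combination A r q * A q u * m3 - A r u * g3 :
        A r q * -A q u = A r u * -p0)
    · exact (by linear_combination -(A r s * A s u) * m3 + A r u * g4 :
        A r s * A s u = A r u * star p0)
    · exact (by rw [qs]; ring : A q s * A s u = -A q u * 0)
  have nS : ∀ ξ : ℂ, ‖ξ‖ = 1 →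
      ∀ i, ‖![A w p * A p u * ξ, 1, A p u, A r u, -A q u, A s u] i‖ = 1 := by
    intro ξ hξ i
    fin_cases i <;> simp [hξ, n (sy pw), n (sy up), n (sy uq), n (sy ur), n (sy us)]
  have hγ : γ - star γ = a * I := by rw [γ_sub_star, ← eq_sqrt_two ha ha2]
  have ha0 : (a : ℂ) ≠ 0 := by exact_mod_cast ha.ne'
  have sI : star I = -I := conj_I
  rcases eq_γ_or ha n1 f1 ha2 with hγ' | hγ'
  · refine h.mswitch_of_lt K₂₂₂γ.gainMatrix_isHermitian K₂₂₂γ.gainMatrix_diag e _ (nS (-I) (by simp))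
      (Or.inr fun i j hij => ?_)
    rw [main (-I) (star γ) (by simp) (by simp) (by simp) (by simpa using hγ') ?_ i j hij,
      gainMatrix_K₂₂₂γ]
    · congr 1
      clear hij
      fin_cases i <;> fin_cases j <;> simp
    · rw [hγ', ← neg_sub, hγ] at x2
      exact mul_left_cancel₀ ha0 (by linear_combination I * x2 + a * A w q * A q u * I_sq)
  · refine h.mswitch_of_lt K₂₂₂γ.gainMatrix_isHermitian K₂₂₂γ.gainMatrix_diag e _ (nS I (by simp))
      (Or.inl fun i j hij => ?_)
    rw [main I γ (by simp) sI I_sq hγ' ?_ i j hij, gainMatrix_K₂₂₂γ]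
    rw [hγ', star_star, hγ] at x2
    exact mul_left_cancel₀ ha0 (by linear_combination -I * x2 + a * A w q * A q u * I_sq)

/-- The classification in degree four, when the eigenvalues have positive sum. -/
theorem Quadratic.degree_four_of_pos (h : Quadratic A a 4) (ha : 0 < a) (u : V) :
    a = 3 ∧ MSwitch A (complete 5).gainMatrix ∨ MSwitch A K₂₂₂γ.gainMatrix := by
  by_cases h3 : NoTripleEdge A
  · by_cases h1 : NoSingleEdge A
    · obtain ⟨w, p, q, r, s, ⟨hu, hw⟩, ⟨hp, hr⟩, hq, hs, huw⟩ := h.octahedron ha.ne' h1 h3 u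
      exact Or.inr (h.mswitch_octahedron ha hu hp hr hq hs hw huw)
    · exfalso
      unfold NoSingleEdge at h1
      push Not at h1
      obtain ⟨u₀, v, x, y, z, hu, hvx, hvy, hvz⟩ := h1
      obtain ⟨h5, rfl⟩ := h.local_matching ha h3 hu hvx hvy hvz
      -- If the edges at `u` lie in single triangles, an edge `uv` starts the local analysis at `v`,
      -- so the property spreads along edges.
      refine h.not_uniqueTriangles u₀ fun v => h.conn {v | UniqueTriangles A v} ⟨u₀, h5⟩ ?_ v
      intro u hu v huv
      obtain ⟨w, h6, h7⟩ := h.exists_triangle ha.ne' huv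
      obtain ⟨y, z, hv⟩ := h.exists_nb4_of_two (h.ne h6) (h.symm huv) h7
      have hu' : UniqueTriangles A u := hu
      refine (h.local_matching ha h3 hv h6 (fun h' => ?_) fun h' => ?_).1
      · exact hv.1.2.2.2.1 (hu' v w y huv h6 h7 h' (h.nb4_adj hv).2.2.1)
      · exact hv.1.2.2.2.2.1 (hu' v w z huv h6 h7 h' (h.nb4_adj hv).2.2.2)
  · left
    unfold NoTripleEdge at h3
    push Not at h3
    obtain ⟨u, v, x, y, z, hu, h1, h2, h4⟩ := h3
    refine h.complete_five ha.le (h.card_eq_five ha hu (h.nb4_of_four ?_ (h.symm (h.nb4_adj hu).1) h1 h2 h4))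
    exact ⟨h.ne (h.nb4_adj hu).2.1, h.ne (h.nb4_adj hu).2.2.1, h.ne (h.nb4_adj hu).2.2.2,
      hu.1.2.2.2⟩

end Octahedron

end GainGraph

namespace GainGraph

/-! ### From eigenvalues to the quadratic equation and back. -/

section Spectrum

variable {V : Type u} [Fintype V] [DecidableEq V] {W : Type v} [Fintype W] [DecidableEq W]
  {A : Matrix V V ℂ} {a : ℝ} {k : ℕ}

/-- Conjugation by the eigenvector unitary is an algebra automorphism, so the identity can be tested
on the diagonal matrix of eigenvalues. -/
theorem sq_eq_iff_eigenvalues (hA : A.IsHermitian) (a c : ℝ) :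
    A * A = (a : ℂ) • A + (c : ℂ) • 1 ↔
      ∀ i, hA.eigenvalues i ^ 2 = a * hA.eigenvalues i + c := by
  set F := Unitary.conjStarAlgAut ℂ (Matrix V V ℂ) hA.eigenvectorUnitary
  set D : Matrix V V ℂ := diagonal (RCLike.ofReal ∘ hA.eigenvalues)
  have h1 : A = F D := hA.spectral_theorem
  have h2 : A * A = (a : ℂ) • A + (c : ℂ) • 1 ↔ D * D = (a : ℂ) • D + (c : ℂ) • 1 := by
    have e : F ((a : ℂ) • D + (c : ℂ) • 1) = (a : ℂ) • F D + (c : ℂ) • 1 := by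
      rw [map_add, map_smul, map_smul, map_one]
    rw [h1, ← e, ← map_mul]
    exact F.injective.eq_iff
  rw [h2]
  constructor
  · intro h i
    have := congrFun (congrFun h i) i
    simp [D] at this
    rw [pow_two]
    exact_mod_cast this
  · intro h
    ext i j
    by_cases hij : i = j
    · subst hij
      have := h i
      simp [D]
      rw [pow_two] at this
      exact_mod_cast this
    · simp [D, hij]

theorem isRoot_charpoly_iff (hA : A.IsHermitian) (z : ℂ) :
    A.charpoly.IsRoot z ↔ ∃ i, (hA.eigenvalues i : ℂ) = z := by
  rw [hA.charpoly_eq, IsRoot, eval_prod, Finset.prod_eq_zero_iff]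
  simp only [Finset.mem_univ, true_and, eval_sub, eval_X, eval_C, sub_eq_zero]
  exact exists_congr fun i => eq_comm

omit [Fintype V] [DecidableEq V] in
theorem adj_gainMatrix (Ψ : GainGraph V) (u v : V) : Adj Ψ.gainMatrix u v ↔ Ψ.graph.Adj u v := by
  by_cases h : Ψ.graph.Adj u v <;> simp [Adj, gainMatrix, h]

omit [DecidableEq V] in
theorem sum_gainMatrix_mul_self (Ψ : GainGraph V) (u : V) :
    ∑ w, Ψ.gainMatrix u w * Ψ.gainMatrix w u = ((Ψ.graph.neighborSet u).ncard : ℂ) := by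
  classical
  have h : ∀ w, Ψ.gainMatrix u w * Ψ.gainMatrix w u = if Ψ.graph.Adj u w then 1 else 0 := by
    intro w
    split_ifs with huw
    · rw [← Ψ.gainMatrix_isHermitian.apply w u]
      exact mul_star_of_norm ((Ψ.gainMatrix_unitEntries u w).resolve_left
        ((adj_gainMatrix Ψ u w).2 huw))
    · rw [eq_zero_of_not_adj fun h' => huw ((adj_gainMatrix Ψ u w).1 h'), zero_mul]
  rw [Finset.sum_congr rfl fun w _ => h w, Finset.sum_boole, Set.ncard_eq_toFinset_card']
  congr 2
  ext w
  simp

omit [Fintype V] [DecidableEq V] in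
theorem connected_iff (Ψ : GainGraph V) [Nonempty V] : Ψ.graph.Connected ↔
    ∀ S : Set V, S.Nonempty → (∀ u ∈ S, ∀ v, Adj Ψ.gainMatrix u v → v ∈ S) → ∀ v, v ∈ S := by
  simp only [adj_gainMatrix]
  constructor
  · rintro h S ⟨u, hu⟩ hS v
    obtain ⟨p⟩ := h.preconnected u v
    induction p with
    | nil => exact hu
    | cons hadj _ ih => exact ih (hS _ hu _ hadj)
  · intro h
    refine ⟨fun u v => ?_⟩
    exact h {v | Ψ.graph.Reachable u v} ⟨u, SimpleGraph.Reachable.refl u⟩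
      (fun x hx y hxy => SimpleGraph.Reachable.trans hx hxy.reachable) v

theorem quadratic_iff (Ψ : GainGraph V) [Nonempty V] (a : ℝ) (k : ℕ) :
    Quadratic Ψ.gainMatrix a k ↔ Ψ.graph.Connected ∧
      Ψ.gainMatrix * Ψ.gainMatrix = (a : ℂ) • Ψ.gainMatrix + (k : ℂ) • 1 := by
  have key : Ψ.gainMatrix * Ψ.gainMatrix = (a : ℂ) • Ψ.gainMatrix + (k : ℂ) • 1 ↔
      ∀ u v, ∑ w, Ψ.gainMatrix u w * Ψ.gainMatrix w v =
        a * Ψ.gainMatrix u v + if u = v then (k : ℂ) else 0 := by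
    rw [← Matrix.ext_iff]
    simp [Matrix.mul_apply, Matrix.one_apply]
  rw [key, connected_iff]
  exact ⟨fun h => ⟨h.conn, h.sq⟩, fun h => ⟨fun u v => (Ψ.gainMatrix_isHermitian.apply v u).symm,
    Ψ.gainMatrix_diag, Ψ.gainMatrix_unitEntries, h.2, h.1⟩⟩

theorem Quadratic.ncard_neighborSet {Ψ : GainGraph V} (h : Quadratic Ψ.gainMatrix a k) (u : V) :
    (Ψ.graph.neighborSet u).ncard = k := by
  have h1 := h.sq u u
  rw [sum_gainMatrix_mul_self, h.diag] at h1
  simpa using h1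

/-- A connected gain graph with two eigenvalues satisfies a quadratic equation. -/
theorem exists_quadratic (Ψ : GainGraph V) (θ₁ θ₂ : ℝ) (hconn : Ψ.graph.Connected)
    (hdeg : ∀ v, (Ψ.graph.neighborSet v).ncard ≤ 4) (hθ : θ₁ ≠ θ₂)
    (heig : Ψ.eigenvalues = {(θ₁ : ℂ), (θ₂ : ℂ)}) :
    ∃ k, 1 ≤ k ∧ k ≤ 4 ∧ Quadratic Ψ.gainMatrix (θ₁ + θ₂) k := by
  have hne := hconn.nonempty
  have hA := Ψ.gainMatrix_isHermitian
  have heig' : ∀ z : ℂ, (∃ i, (hA.eigenvalues i : ℂ) = z) ↔ z = θ₁ ∨ z = θ₂ := by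
    intro z
    rw [← isRoot_charpoly_iff]
    exact Set.ext_iff.1 heig z
  have hsq : Ψ.gainMatrix * Ψ.gainMatrix =
      ((θ₁ + θ₂ : ℝ) : ℂ) • Ψ.gainMatrix + ((-(θ₁ * θ₂) : ℝ) : ℂ) • 1 := by
    refine (sq_eq_iff_eigenvalues hA _ _).2 fun i => ?_
    rcases (heig' _).1 ⟨i, rfl⟩ with h | h <;> rw [ofReal_inj.1 h] <;> ring
  -- Comparing diagonals shows that the graph is regular and that the constant term is its degree.
  have hcount : ∀ u, ((Ψ.graph.neighborSet u).ncard : ℂ) = ((-(θ₁ * θ₂) : ℝ) : ℂ) := by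
    intro u
    rw [← sum_gainMatrix_mul_self, ← Matrix.mul_apply, hsq]
    simp [gainMatrix_diag]
  obtain ⟨u⟩ := hne
  refine ⟨(Ψ.graph.neighborSet u).ncard, ?_, hdeg u, ?_⟩
  -- Degree zero would make the matrix zero, which has only one eigenvalue.
  · by_contra hzero
    have hz : (Ψ.graph.neighborSet u).ncard = 0 := by omega
    have hall : ∀ v, (Ψ.graph.neighborSet v).ncard = 0 := by
      intro v
      have := (hcount v).trans (hcount u).symm
      rw [hz] at this
      exact_mod_cast this
    have h0 : Ψ.gainMatrix = 0 := by
      ext v w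
      refine eq_zero_of_not_adj fun hvw => ?_
      have := hall v
      rw [Set.ncard_eq_zero] at this
      exact Set.notMem_empty w (this ▸ (adj_gainMatrix Ψ v w).1 hvw)
    have h1 := hA.eigenvalues_eq_zero_iff.2 h0
    obtain ⟨i, hi⟩ := (heig' θ₁).2 (Or.inl rfl)
    obtain ⟨j, hj⟩ := (heig' θ₂).2 (Or.inr rfl)
    rw [h1] at hi hj
    exact hθ (ofReal_inj.1 (hi.symm.trans hj))
  · have : Nonempty V := ⟨u⟩
    exact (quadratic_iff Ψ _ _).2 ⟨hconn, by rw [hsq, ← hcount u]⟩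

/-- A gain graph cospectral to one that satisfies a quadratic equation satisfies the same one. -/
theorem Quadratic.of_charpoly_eq {Ψ : GainGraph W} (h : Quadratic Ψ.gainMatrix a k)
    {Φ : GainGraph V} (hconn : Φ.graph.Connected) (hchar : Φ.charpoly = Ψ.charpoly) :
    Quadratic Φ.gainMatrix a k ∧ Fintype.card V = Fintype.card W := by
  have hne := hconn.nonempty
  have hcard : Fintype.card V = Fintype.card W := by
    have := congrArg natDegree hchar
    rwa [charpoly, charpoly, charpoly_natDegree_eq_dim, charpoly_natDegree_eq_dim] at this
  have hW : Nonempty W := Fintype.card_pos_iff.1 (hcard ▸ Fintype.card_pos)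
  have hB := Ψ.gainMatrix_isHermitian
  have hA := Φ.gainMatrix_isHermitian
  refine ⟨(quadratic_iff Φ _ _).2 ⟨hconn, ?_⟩, hcard⟩
  have h1 := (sq_eq_iff_eigenvalues hB a k).1 (by simpa using ((quadratic_iff Ψ _ _).1 h).2)
  have := (sq_eq_iff_eigenvalues hA a k).2 (fun i => by
    have h2 := (isRoot_charpoly_iff hA _).2 ⟨i, rfl⟩
    change Φ.charpoly.IsRoot _ at h2
    rw [hchar] at h2
    obtain ⟨j, hj⟩ := (isRoot_charpoly_iff hB _).1 h2
    rw [← ofReal_inj.1 hj]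
    exact h1 j)
  simpa using this

/-- The parameters of a gain graph that satisfies a quadratic equation. -/
theorem Quadratic.hasParameters {Ψ : GainGraph V} (h : Quadratic Ψ.gainMatrix a k) (ha : 0 ≤ a)
    {n m : ℕ} (hn : Fintype.card V = n) {θ₁ θ₂ : ℝ} (hlt : θ₂ < θ₁) (hs : θ₁ + θ₂ = a)
    (hp : θ₁ * θ₂ = -k) (hm0 : 0 < m) (hmn : m < n) (hm : m * θ₁ + (n - m : ℝ) * θ₂ = 0) :
    Ψ.HasParameters k n m := by
  have hne : Nonempty V := Fintype.card_pos_iff.1 (by omega)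
  have hA := Ψ.gainMatrix_isHermitian
  obtain ⟨hconn, hsq⟩ := (quadratic_iff Ψ _ _).1 h
  refine ⟨hconn, h.ncard_neighborSet, hn, hm0, hmn, θ₁, θ₂, hlt, by linarith, ?_⟩
  have h1 := (sq_eq_iff_eigenvalues hA a k).1 (by simpa using hsq)
  have h2 : ∀ i, hA.eigenvalues i = if hA.eigenvalues i = θ₁ then θ₁ else θ₂ := by
    intro i
    split_ifs with h3
    · exact h3
    · have : (hA.eigenvalues i - θ₁) * (hA.eigenvalues i - θ₂) = 0 := by
        linear_combination h1 i - hA.eigenvalues i * hs + hp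
      rcases mul_eq_zero.1 this with h4 | h4
      · exact absurd (sub_eq_zero.1 h4) h3
      · exact sub_eq_zero.1 h4
  set S := Finset.univ.filter fun i => hA.eigenvalues i = θ₁
  have hSc : (Finset.univ.filter fun i => ¬ hA.eigenvalues i = θ₁).card + S.card = n := by
    rw [← hn, add_comm, Finset.card_filter_add_card_filter_not, Finset.card_univ]
  have hSm : S.card = m := by
    -- The trace vanishes, which is a linear equation for the multiplicity of `θ₁`.
    have htr : ∑ i, hA.eigenvalues i = 0 := by
      have := hA.trace_eq_sum_eigenvalues
      rw [Matrix.trace, Finset.sum_eq_zero (s := Finset.univ)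
        fun i _ => (Matrix.diag_apply _ _).trans (Ψ.gainMatrix_diag i)] at this
      refine ofReal_injective ?_
      rw [ofReal_sum, ofReal_zero]
      exact this.symm
    rw [Finset.sum_congr rfl fun i _ => h2 i, Finset.sum_ite, Finset.sum_const, Finset.sum_const,
      nsmul_eq_mul, nsmul_eq_mul] at htr
    have e : ((Finset.univ.filter fun i => ¬ hA.eigenvalues i = θ₁).card : ℝ) + S.card = n := by
      exact_mod_cast hSc
    have : ((S.card : ℝ) - m) * (θ₁ - θ₂) = 0 := by
      linear_combination htr - hm - θ₂ * e
    rcases mul_eq_zero.1 this with h3 | h3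
    · exact_mod_cast sub_eq_zero.1 h3
    · linarith
  have h5 : ∀ i, (X - C (hA.eigenvalues i : ℂ)) =
      if hA.eigenvalues i = θ₁ then X - C (θ₁ : ℂ) else X - C (θ₂ : ℂ) := by
    intro i
    conv_lhs => rw [h2 i]
    split_ifs <;> rfl
  have h6 : Ψ.charpoly = ∏ i, (X - C (hA.eigenvalues i : ℂ)) := hA.charpoly_eq
  rw [h6, Finset.prod_congr rfl fun i _ => h5 i, Finset.prod_ite, Finset.prod_const,
    Finset.prod_const]
  congr 2
  omega

omit [DecidableEq V] [DecidableEq W] in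
theorem MSwitch.card_eq {B : Matrix W W ℂ} (h : MSwitch A B) :
    Fintype.card V = Fintype.card W := by
  obtain ⟨σ, -⟩ := h
  exact (Fintype.card_congr σ).symm

/-- The coefficient `a` can be read off at any edge and is unaffected by switching, and being real
it survives conjugation. This separates `K₄` from `W₄`, which have equal order and degree. -/
theorem MSwitch.sum_eq {B : Matrix W W ℂ} {b : ℝ} {l : ℕ} (h : MSwitch A B)
    (hA : Quadratic A a k) (hB : Quadratic B b l) (hl : l ≠ 0) [Nonempty W] : a = b := by
  obtain ⟨σ, s, hs, h⟩ := h
  let i := Classical.arbitrary W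
  obtain ⟨j, hij⟩ := hB.exists_adj hl i
  have key : ∀ C : Matrix W W ℂ, (∀ i j, A (σ i) (σ j) * s j = s i * C i j) →
      ∑ w, C i w * C w j = b * C i j → C i j ≠ 0 → a = b := by
    intro C hC h1 h2
    have h3 := hA.sq (σ i) (σ j)
    rw [← σ.sum_comp, if_neg (fun h' => hB.ne hij (σ.injective h')), add_zero] at h3
    have h4 : ∑ w, A (σ i) (σ w) * A (σ w) (σ j) * s j = s i * (b * C i j) := by
      rw [← h1, Finset.mul_sum]
      refine Finset.sum_congr rfl fun w _ => ?_
      linear_combination A (σ i) (σ w) * hC w j + C w j * hC i w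
    rw [← Finset.sum_mul, h3] at h4
    have h5 : ((a : ℂ) - b) * (s i * C i j) = 0 := by
      linear_combination h4 - a * hC i j
    rcases mul_eq_zero.1 h5 with h6 | h6
    · exact_mod_cast sub_eq_zero.1 h6
    · exact absurd h6 (mul_ne_zero (ne_zero_of_norm (hs i)) h2)
  have h1 := hB.sq i j
  rw [if_neg (hB.ne hij), add_zero] at h1
  rcases h with h | h
  · exact key B h h1 hij
  · refine key (B.map star) h ?_ (by simpa [Adj] using hij)
    have := congrArg star h1
    simpa [star_sum, star_ofReal_eq] using this

end Spectrum

end GainGraph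

namespace GainGraph

/-! ### The quadratic equations of the sporadic graphs. -/

section Examples

/-- In a gain graph where all the other vertices can be reached from one vertex, every closed set
is everything. -/
theorem conn_of_common {V : Type u} {A : Matrix V V ℂ}
    (h : ∀ u v, u = v ∨ Adj A u v ∨ ∃ w, Adj A u w ∧ Adj A w v) (S : Set V) (hS : S.Nonempty)
    (hc : ∀ u ∈ S, ∀ v, Adj A u v → v ∈ S) (v : V) : v ∈ S := by
  obtain ⟨u, hu⟩ := hS
  rcases h u v with rfl | h1 | ⟨w, h1, h2⟩
  · exact hu
  · exact hc u hu v h1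
  · exact hc w (hc u hu w h1) v h2

theorem quadratic_complete {n k : ℕ} (hn : n = k + 1) :
    Quadratic (complete n).gainMatrix ((k : ℝ) - 1) k := by
  refine ⟨fun u v => ((complete n).gainMatrix_isHermitian.apply v u).symm,
    (complete n).gainMatrix_diag, (complete n).gainMatrix_unitEntries, ?_, conn_of_common ?_⟩
  · intro u v
    simp only [gainMatrix_complete, Matrix.of_apply]
    have h1 : ∀ w, (if u = w then (0 : ℂ) else 1) * (if w = v then 0 else 1) =
        1 - (if u = w then 1 else 0) - (if w = v then 1 else 0) +
          (if u = w then (if w = v then 1 else 0) else 0) := by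
      intro w
      split_ifs <;> simp
    rw [Finset.sum_congr rfl fun w _ => h1 w]
    simp only [Finset.sum_add_distrib, Finset.sum_sub_distrib, Finset.sum_ite_eq,
      Finset.sum_ite_eq', Finset.mem_univ, if_true, Finset.sum_const, Finset.card_univ,
      Fintype.card_fin, nsmul_eq_mul, hn]
    push_cast
    split_ifs <;> ring
  · intro u v
    by_cases h : u = v
    · exact Or.inl h
    · right; left
      simp [Adj, gainMatrix_complete, h]

/-- For a square matrix, orthogonal rows imply orthogonal columns. Connectedness follows because any
two rows overlap and no column is empty. -/
theorem quadratic_IG {n k : ℕ} {B : Matrix (Fin n) (Fin n) ℂ} (hB : UnitEntries B)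
    (h1 : B * Bᴴ = (k : ℂ) • 1) (hk : k ≠ 0) (h2 : ∀ i i', ∃ j, B i j ≠ 0 ∧ B i' j ≠ 0) :
    Quadratic (IG B hB).gainMatrix 0 k := by
  have hk' : (k : ℂ) ≠ 0 := by exact_mod_cast hk
  have h3 : Bᴴ * B = (k : ℂ) • 1 := by
    have : B * ((k : ℂ)⁻¹ • Bᴴ) = 1 := by
      rw [Matrix.mul_smul, h1, smul_smul, inv_mul_cancel₀ hk', one_smul]
    have := mul_eq_one_comm.1 this
    rw [Matrix.smul_mul] at this
    rw [← this, smul_smul, mul_inv_cancel₀ hk', one_smul]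
  refine ⟨fun u v => ((IG B hB).gainMatrix_isHermitian.apply v u).symm,
    (IG B hB).gainMatrix_diag, (IG B hB).gainMatrix_unitEntries, ?_, ?_⟩
  · intro u v
    rw [← Matrix.mul_apply, gainMatrix_IG, Matrix.fromBlocks_multiply]
    simp only [Matrix.zero_mul, Matrix.mul_zero, zero_add, add_zero, h1, h3]
    rcases u with u | u <;> rcases v with v | v <;> simp [Matrix.one_apply]
  · intro S hS hc
    rw [gainMatrix_IG] at hc
    have hcol : ∀ j, ∃ i, B i j ≠ 0 := by
      intro j
      by_contra! hj
      have := congrFun (congrFun h3 j) j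
      rw [Matrix.mul_apply, Finset.sum_eq_zero fun i _ => by rw [hj i, mul_zero]] at this
      simp at this
      exact hk' this.symm
    have step : ∀ i j, B i j ≠ 0 → (Sum.inl i ∈ S ↔ Sum.inr j ∈ S) := by
      intro i j hij
      exact ⟨fun hi => hc _ hi _ hij, fun hj => hc _ hj _ (by simpa [Adj] using hij)⟩
    have hall : ∃ i, Sum.inl i ∈ S := by
      obtain ⟨i | j, hi⟩ := hS
      · exact ⟨i, hi⟩
      · obtain ⟨i, hij⟩ := hcol j
        exact ⟨i, (step i j hij).2 hi⟩
    obtain ⟨i₀, hi₀⟩ := hall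
    have hl : ∀ i, Sum.inl i ∈ S := by
      intro i
      obtain ⟨j, h4, h5⟩ := h2 i₀ i
      exact (step i j h5).2 ((step i₀ j h4).1 hi₀)
    rintro (i | j)
    · exact hl i
    · obtain ⟨i, hij⟩ := hcol j
      exact (step i j hij).1 (hl i)

theorem quadratic_ND {V : Type u} [Fintype V] [DecidableEq V] {Ψ : GainGraph V} {k : ℕ}
    (h : Quadratic Ψ.gainMatrix 0 k) : Quadratic Ψ.ND.gainMatrix 0 (k + 1) := by
  refine ⟨fun u v => (Ψ.ND.gainMatrix_isHermitian.apply v u).symm,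
    Ψ.ND.gainMatrix_diag, Ψ.ND.gainMatrix_unitEntries, ?_, ?_⟩
  · have hsq : Ψ.gainMatrix * Ψ.gainMatrix = (k : ℂ) • 1 := by
      ext u v
      rw [Matrix.mul_apply, h.sq]
      simp [Matrix.one_apply]
    intro u v
    rw [← Matrix.mul_apply, gainMatrix_ND, Matrix.fromBlocks_multiply]
    simp only [Matrix.mul_one, Matrix.one_mul, hsq, neg_mul_neg, add_neg_cancel]
    rcases u with u | u <;> rcases v with v | v <;> simp [Matrix.one_apply]
    · split_ifs <;> simp
    · split_ifs <;> simp [add_comm]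
  · intro S hS hc
    rw [gainMatrix_ND] at hc
    have step : ∀ i, (Sum.inl i ∈ S ↔ Sum.inr i ∈ S) := by
      intro i
      exact ⟨fun hi => hc _ hi _ (by simp [Adj]), fun hj => hc _ hj _ (by simp [Adj])⟩
    have hl : ∀ i, Sum.inl i ∈ S := h.conn {i | Sum.inl i ∈ S}
      (by
        obtain ⟨i | i, hi⟩ := hS
        · exact ⟨i, hi⟩
        · exact ⟨i, (step i).2 hi⟩)
      fun u hu v huv => hc _ hu _ huv
    rintro (i | i)
    · exact hl i
    · exact (step i).1 (hl i)

theorem quadratic_W₄ : Quadratic W₄.gainMatrix 0 3 := by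
  refine ⟨fun u v => (W₄.gainMatrix_isHermitian.apply v u).symm,
    W₄.gainMatrix_diag, W₄.gainMatrix_unitEntries, ?_, conn_of_common ?_⟩
  · rw [gainMatrix_W₄]
    intro u v
    fin_cases u <;> fin_cases v <;> simp [Fin.sum_univ_succ] <;> norm_num
  · rw [gainMatrix_W₄]
    intro u v
    by_cases h : u = v
    · exact Or.inl h
    · right; left
      revert h
      fin_cases u <;> fin_cases v <;> simp [Adj]

theorem quadratic_K₂₂₂γ : Quadratic K₂₂₂γ.gainMatrix (√2) 4 := by
  have hγ := mul_star_of_norm norm_γ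
  have h1 := γ_add_star
  have h2 := γ_sub_star
  have h3 := γ_sq
  have h4 : star γ ^ 2 = -I := by rw [← star_pow, h3]; exact conj_I
  have hγ0 := ne_zero_of_norm norm_γ
  refine ⟨fun u v => (K₂₂₂γ.gainMatrix_isHermitian.apply v u).symm,
    K₂₂₂γ.gainMatrix_diag, K₂₂₂γ.gainMatrix_unitEntries, ?_, conn_of_common ?_⟩
  · rw [gainMatrix_K₂₂₂γ, ← h1]
    have h5 : γ - star γ = (γ + star γ) * I := by rw [h1, h2]
    have h6 := I_sq
    generalize star γ = δ at *
    clear h1 h2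
    generalize γ = ε at *
    intro u v
    fin_cases u <;> fin_cases v <;> simp [Fin.sum_univ_succ]
    all_goals grind only
  · rw [gainMatrix_K₂₂₂γ]
    have : ∀ u v : Fin 6, u.val / 2 ≠ v.val / 2 → Adj !![0, 0, -I, I, 1, 1;
         0, 0, 1, 1, -1, 1;
         I, 1, 0, 0, -star γ, γ;
         -I, 1, 0, 0, -γ, star γ;
         1, -1, -γ, -star γ, 0, 0;
         1, 1, star γ, γ, 0, 0] u v := by
      intro u v h
      fin_cases u <;> fin_cases v <;> first | exact absurd rfl h | simp [Adj, hγ0]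
    intro u v
    by_cases h : u.val / 2 = v.val / 2
    · right; right
      have : ∃ w : Fin 6, u.val / 2 ≠ w.val / 2 ∧ w.val / 2 ≠ v.val / 2 := by
        revert u v; decide
      obtain ⟨w, h5, h6⟩ := this
      exact ⟨w, this _ _ h5, this _ _ h6⟩
    · exact Or.inr (Or.inl (this u v h))

theorem quadratic_W₂ : Quadratic (IG W₂ unitEntries_W₂).gainMatrix 0 2 := by
  refine quadratic_IG _ ?_ two_ne_zero ?_
  · ext i j
    fin_cases i <;> fin_cases j <;> simp [W₂, Matrix.mul_apply, Fin.sum_univ_succ] <;> norm_num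
  · intro i i'
    refine ⟨0, ?_⟩
    fin_cases i <;> fin_cases i' <;> simp [W₂]

theorem quadratic_W₃ : Quadratic (IG W₃ unitEntries_W₃).gainMatrix 0 3 := by
  refine quadratic_IG _ ?_ three_ne_zero ?_
  · have h1 : (starRingEnd ℂ) φ = φ ^ 2 := star_φ
    have h2 := φ_sq_add
    have h3 := φ_cubed
    ext i j
    fin_cases i <;> fin_cases j <;> simp [W₃, Matrix.mul_apply, Fin.sum_univ_succ, h1]
    all_goals grind only
  · intro i i'
    refine ⟨0, ?_⟩
    fin_cases i <;> fin_cases i' <;> simp [W₃]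

/-- Inner products of rows depend only on the shift between them, so one autocorrelation per shift
suffices. -/
theorem cyclicMatrix_mul_conjTranspose {n : ℕ} [NeZero n] (c : Fin n → ℂ) (k : ℂ)
    (h : ∀ d, ∑ l, c l * star (c (l + d)) = if d = 0 then k else 0) :
    cyclicMatrix c * (cyclicMatrix c)ᴴ = k • 1 := by
  ext i j
  rw [Matrix.mul_apply, ← Equiv.sum_comp (Equiv.addRight i)]
  have := h (i - j)
  simp only [cyclicMatrix, Matrix.conjTranspose_apply, Matrix.of_apply, Equiv.coe_addRight,
    add_sub_cancel_right, add_sub_assoc, this, sub_eq_zero]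
  simp [Matrix.one_apply]

theorem quadratic_W₅ : Quadratic (IG W₅ unitEntries_W₅).gainMatrix 0 4 := by
  have hφ := ne_zero_of_norm norm_φ
  refine quadratic_IG _ ?_ four_ne_zero ?_
  · refine cyclicMatrix_mul_conjTranspose _ _ fun d => ?_
    have h1 : (starRingEnd ℂ) φ = φ ^ 2 := star_φ
    have h2 := φ_sq_add
    have h3 := φ_cubed
    fin_cases d <;> simp [Fin.sum_univ_succ, h1]
    all_goals grind only
  · intro i i'
    have : ∀ i i' : Fin 5, ∃ j, j - i ≠ 0 ∧ j - i' ≠ 0 := by decide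
    obtain ⟨j, h1, h2⟩ := this i i'
    have h3 : ∀ l : Fin 5, l ≠ 0 → ![0, 1, φ, φ, 1] l ≠ 0 := by
      intro l hl
      fin_cases l <;> simp_all
    exact ⟨j, h3 _ h1, h3 _ h2⟩

theorem quadratic_W₇ : Quadratic (IG W₇ unitEntries_W₇).gainMatrix 0 4 := by
  refine quadratic_IG _ ?_ four_ne_zero ?_
  · refine cyclicMatrix_mul_conjTranspose _ _ fun d => ?_
    fin_cases d <;> simp [Fin.sum_univ_succ]
    all_goals norm_num
  · intro i i'
    -- The list is the support of the first row; any two of its translates meet.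
    have : ∀ i i' : Fin 7, ∃ j, (j - i) ∈ [0, 1, 2, 4] ∧ (j - i') ∈ [0, 1, 2, 4] := by decide
    obtain ⟨j, h1, h2⟩ := this i i'
    have h3 : ∀ l : Fin 7, l ∈ [0, 1, 2, 4] → (![-1, 1, 1, 0, 1, 0, 0] : Fin 7 → ℂ) l ≠ 0 := by
      intro l hl
      fin_cases l <;> simp_all
    exact ⟨j, h3 _ h1, h3 _ h2⟩

end Examples

end GainGraph

namespace GainGraph

/-! ### The toral graphs, and degrees, orders and multiplicities. -/

section Parameters

theorem shiftMatrix_apply {t : ℕ} (x : Circle) (i j : Fin t) : shiftMatrix t x i j =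
    if (i.1 + 1 = j ∨ i.1 + 1 = t ∧ j.1 = 0) then (if i.1 + 1 = j then 1 else (x : ℂ)) else 0 := by
  simp only [shiftMatrix, Matrix.of_apply]
  split_ifs <;> first | rfl | (exfalso; tauto)

theorem shiftMatrix_mul_conjTranspose {t : ℕ} (ht : 3 ≤ t) (x : Circle) :
    shiftMatrix t x * (shiftMatrix t x)ᴴ = 1 := by
  ext i k
  rw [Matrix.mul_apply]
  obtain ⟨j, hj⟩ : ∃ j : Fin t, i.1 + 1 = j ∨ i.1 + 1 = t ∧ j.1 = 0 := by
    by_cases hi : i.1 + 1 = t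
    · exact ⟨⟨0, by omega⟩, Or.inr ⟨hi, rfl⟩⟩
    · exact ⟨⟨i + 1, by omega⟩, Or.inl rfl⟩
  rw [Finset.sum_eq_single j]
  · rw [Matrix.conjTranspose_apply]
    by_cases hik : i = k
    · subst hik
      have h0 : shiftMatrix t x i j ≠ 0 := by
        rw [shiftMatrix_apply, if_pos hj]
        split_ifs <;> simp
      rw [Matrix.one_apply_eq]
      exact mul_star_of_norm ((shiftMatrix_entry t ht x i j).1.resolve_left h0)
    · have h0 : shiftMatrix t x k j = 0 := by
        rw [shiftMatrix_apply, if_neg]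
        exact fun hk => hik (Fin.ext (by omega))
      rw [h0, Matrix.one_apply_ne hik, star_zero, mul_zero]
  · intro b _ hb
    rw [shiftMatrix_apply, if_neg, zero_mul]
    intro hb'
    exact hb (Fin.ext (by omega))
  · simp

/-- The weighted shift is unitary. In the square of the block matrix the squares of `C` and `C*`
cancel and only `C C*` and `C* C` survive, which add up to 4 on the diagonal blocks and cancel off
them. -/
theorem quadratic_toral {t : ℕ} (ht : 3 ≤ t) (x : Circle) :
    Quadratic (toral t ht x).gainMatrix 0 4 := by
  refine ⟨fun u v => ((toral t ht x).gainMatrix_isHermitian.apply v u).symm,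
    (toral t ht x).gainMatrix_diag, (toral t ht x).gainMatrix_unitEntries, ?_, ?_⟩
  · have h1 := shiftMatrix_mul_conjTranspose ht x
    have h2 := mul_eq_one_comm.1 h1
    intro u v
    rw [← Matrix.mul_apply, gainMatrix_toral, Matrix.fromBlocks_multiply]
    generalize (shiftMatrix t x)ᴴ = D at *
    generalize shiftMatrix t x = C at *
    have e1 : (C + D) * (C + D) + (C - D) * (D - C) = 4 := by
      have : (C + D) * (C + D) + (C - D) * (D - C) = 2 * (C * D) + 2 * (D * C) := by
        noncomm_ring
      rw [this, h1, h2]; norm_num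
    have e2 : (C + D) * (C - D) + (C - D) * (-C - D) = 0 := by
      have : (C + D) * (C - D) + (C - D) * (-C - D) = 2 * (D * C) - 2 * (C * D) := by
        noncomm_ring
      rw [this, h1, h2]; simp
    have e3 : (D - C) * (C + D) + (-C - D) * (D - C) = 0 := by
      have : (D - C) * (C + D) + (-C - D) * (D - C) = 2 * (D * C) - 2 * (C * D) := by
        noncomm_ring
      rw [this, h1, h2]; simp
    have e4 : (D - C) * (C - D) + (-C - D) * (-C - D) = 4 := by
      have : (D - C) * (C - D) + (-C - D) * (-C - D) = 2 * (C * D) + 2 * (D * C) := by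
        noncomm_ring
      rw [this, h1, h2]; norm_num
    rw [e1, e2, e3, e4]
    rcases u with u | u <;> rcases v with v | v <;> simp [Matrix.ofNat_apply]
  · intro S hS hc
    -- A forward step reaches both vertices of the next position, so going once around reaches
    -- everything.
    have adj : ∀ y z : Fin t ⊕ Fin t, ((position y).1 + 1 = position z ∨
        (position y).1 + 1 = t ∧ (position z).1 = 0) → y ∈ S → z ∈ S := by
      intro y z hyz hy
      refine hc y hy z ?_
      have h1 : shiftMatrix t x (position y) (position z) ≠ 0 := by
        rw [shiftMatrix_apply, if_pos hyz]
        split_ifs <;> simp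
      have h2 := (shiftMatrix_entry t ht x (position y) (position z)).2.resolve_left h1
      rw [Adj, toral_apply, h2]
      have h3 : sgn (side y) ≠ 0 := by cases side y <;> simp [sgn]
      simpa using ⟨h3, h1⟩
    have all : ∀ y z : Fin t ⊕ Fin t, (position y).1 < (position z).1 → y ∈ S → z ∈ S := by
      intro y z hyz hy
      obtain ⟨n, hn⟩ : ∃ n, (position z).1 = (position y).1 + 1 + n :=
        ⟨(position z).1 - (position y).1 - 1, by omega⟩
      induction n generalizing z with
      | zero => exact adj y z (by omega) hy
      | succ n ih =>
        have hz := (position z).2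
        exact adj (Sum.inl ⟨(position y).1 + 1 + n, by omega⟩) z
          (Or.inl (by change (position y).1 + 1 + n + 1 = _; omega))
          (ih _ (by change _ < (position y).1 + 1 + n; omega) rfl)
    obtain ⟨y, hy⟩ := hS
    have h0 : ∀ z : Fin t ⊕ Fin t, (position z).1 = 0 → z ∈ S := by
      intro z hz
      have := (position y).2
      by_cases hyt : (position y).1 + 1 = t
      · exact adj y z (by omega) hy
      · exact adj (Sum.inl ⟨t - 1, by omega⟩) z (by simp [position] at *; omega)
          (all y _ (by simp [position] at *; omega) hy)
    intro z
    by_cases hz : (position z).1 = 0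
    · exact h0 z hz
    · exact all (Sum.inl ⟨0, by omega⟩) z (by simp [position] at *; omega) (h0 _ rfl)

/-- The eigenvalues are `√k` and `-√k`, and trace zero makes their multiplicities equal. -/
theorem Quadratic.hasParameters_of_zero {V : Type u} [Fintype V] [DecidableEq V] {Ψ : GainGraph V}
    {k m : ℕ} (h : Quadratic Ψ.gainMatrix 0 k) (hk : 0 < k) (hV : Fintype.card V = 2 * m)
    (hm : 0 < m) : Ψ.HasParameters k (2 * m) m := by
  have h1 : (0 : ℝ) < k := by exact_mod_cast hk
  have h2 := Real.sqrt_pos.2 h1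
  refine h.hasParameters le_rfl hV (θ₁ := √k) (θ₂ := -√k) (by linarith) (by ring) ?_ hm (by omega) ?_
  · rw [mul_neg, Real.mul_self_sqrt h1.le]
  · push_cast; ring

theorem hasParameters_complete {k : ℕ} (hk : 0 < k) :
    (complete (k + 1)).HasParameters k (k + 1) 1 := by
  have h1 : (1 : ℝ) ≤ k := by exact_mod_cast hk
  refine (quadratic_complete rfl).hasParameters (by linarith) (by simp) (θ₁ := k) (θ₂ := -1)
    (by linarith) (by ring) (by ring) one_pos (by omega) ?_
  push_cast; ring

theorem hasParameters_K₂₂₂γ : K₂₂₂γ.HasParameters 4 6 2 := by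
  have h2 : (0 : ℝ) < √2 := Real.sqrt_pos.2 two_pos
  have h3 : √2 * √2 = (2 : ℝ) := Real.mul_self_sqrt zero_le_two
  refine quadratic_K₂₂₂γ.hasParameters h2.le (by simp) (θ₁ := 2 * √2) (θ₂ := -√2)
    (by linarith) (by ring) ?_ two_pos (by norm_num) ?_
  · push_cast; linear_combination -2 * h3
  · push_cast; ring

end Parameters

/-! ### The classification for each degree, with the orders that separate the cases. -/

section Conclusion

variable {V : Type u} [Fintype V] [DecidableEq V] {Ψ : GainGraph V} {a : ℝ}

theorem Quadratic.cases_one (h : Quadratic Ψ.gainMatrix a 1) (u : V) :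
    Ψ.SwitchingIsomorphic (complete 2) :=
  (h.degree_one u).switchingIsomorphic

theorem Quadratic.cases_two (h : Quadratic Ψ.gainMatrix a 2) (ha : 0 ≤ a) (u : V) :
    Fintype.card V = 3 ∧ Ψ.SwitchingIsomorphic (complete 3) ∨
      Fintype.card V = 4 ∧ Ψ.SwitchingIsomorphic (IG W₂ unitEntries_W₂) :=
  (h.degree_two ha u).imp (fun h => ⟨by simpa using h.card_eq, h.switchingIsomorphic⟩)
    fun h => ⟨by simpa using h.card_eq, h.switchingIsomorphic⟩

theorem Quadratic.cases_three (h : Quadratic Ψ.gainMatrix a 3) (ha : 0 ≤ a) (u : V) :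
    (Fintype.card V = 4 ∧ a = 2) ∧ Ψ.SwitchingIsomorphic (complete 4) ∨
      (Fintype.card V = 4 ∧ a = 0) ∧ Ψ.SwitchingIsomorphic W₄ ∨
      Fintype.card V = 6 ∧ Ψ.SwitchingIsomorphic (IG W₃ unitEntries_W₃) ∨
      Fintype.card V = 8 ∧ Ψ.SwitchingIsomorphic (IG W₂ unitEntries_W₂).ND := by
  rcases h.degree_three ha u with ⟨h1, h2⟩ | h2 | h2 | h2
  · exact Or.inl ⟨⟨by simpa using h2.card_eq, h1⟩, h2.switchingIsomorphic⟩
  · exact Or.inr (Or.inl ⟨⟨by simpa using h2.card_eq, h2.sum_eq h quadratic_W₄ three_ne_zero⟩,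
      h2.switchingIsomorphic⟩)
  · exact Or.inr (Or.inr (Or.inl ⟨by simpa using h2.card_eq, h2.switchingIsomorphic⟩))
  · exact Or.inr (Or.inr (Or.inr ⟨by simpa using h2.card_eq, h2.switchingIsomorphic⟩))

theorem Quadratic.cases_four_of_pos (h : Quadratic Ψ.gainMatrix a 4) (ha : 0 < a) (u : V) :
    Fintype.card V = 5 ∧ Ψ.SwitchingIsomorphic (complete 5) ∨
      Fintype.card V = 6 ∧ Ψ.SwitchingIsomorphic K₂₂₂γ :=
  (h.degree_four_of_pos ha u).imp
    (fun h => ⟨by simpa using h.2.card_eq, h.2.switchingIsomorphic⟩)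
    fun h => ⟨by simpa using h.card_eq, h.switchingIsomorphic⟩

theorem Quadratic.cases_four_of_eq_zero (h : Quadratic Ψ.gainMatrix 0 4) (u : V) :
    Fintype.card V = 8 ∧ Ψ.SwitchingIsomorphic W₄.ND ∨
      Fintype.card V = 10 ∧ Ψ.SwitchingIsomorphic (IG W₅ unitEntries_W₅) ∨
      Fintype.card V = 12 ∧ Ψ.SwitchingIsomorphic (IG W₃ unitEntries_W₃).ND ∨
      Fintype.card V = 14 ∧ Ψ.SwitchingIsomorphic (IG W₇ unitEntries_W₇) ∨
      Fintype.card V = 16 ∧ Ψ.SwitchingIsomorphic (IG W₂ unitEntries_W₂).ND.ND ∨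
      ∃ (t : ℕ) (ht : 3 ≤ t) (x : Circle),
        Fintype.card V = t + t ∧ Ψ.SwitchingIsomorphic (toral t ht x) := by
  rcases h.degree_four_of_eq_zero u with h1 | h1 | (h1 | h1 | h1) | ⟨t, ht, x, h1⟩
  · exact Or.inr (Or.inl ⟨by simpa using h1.card_eq, h1.switchingIsomorphic⟩)
  · exact Or.inr (Or.inr (Or.inr (Or.inl ⟨by simpa using h1.card_eq, h1.switchingIsomorphic⟩)))
  · exact Or.inl ⟨by simpa using h1.card_eq, h1.switchingIsomorphic⟩
  · exact Or.inr (Or.inr (Or.inl ⟨by simpa using h1.card_eq, h1.switchingIsomorphic⟩))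
  · exact Or.inr (Or.inr (Or.inr (Or.inr
      (Or.inl ⟨by simpa using h1.card_eq, h1.switchingIsomorphic⟩))))
  · exact Or.inr (Or.inr (Or.inr (Or.inr
      (Or.inr ⟨t, ht, x, by simpa using h1.card_eq, h1.switchingIsomorphic⟩))))

end Conclusion

end GainGraph

theorem mainTheorem2 :
    -- the classification
    (∀ (V : Type u) [Fintype V] [DecidableEq V] (Ψ : GainGraph V) (θ₁ θ₂ : ℝ),
      Ψ.graph.Connected →
      (∀ v, (Ψ.graph.neighborSet v).ncard ≤ 4) →
      θ₁ ≠ θ₂ → Ψ.eigenvalues = {(θ₁ : ℂ), (θ₂ : ℂ)} → 0 ≤ θ₁ + θ₂ →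
        Ψ.SwitchingIsomorphic (GainGraph.complete 2) ∨
        Ψ.SwitchingIsomorphic (GainGraph.complete 3) ∨
        Ψ.SwitchingIsomorphic (GainGraph.IG GainGraph.W₂ GainGraph.unitEntries_W₂) ∨
        Ψ.SwitchingIsomorphic (GainGraph.complete 4) ∨
        Ψ.SwitchingIsomorphic GainGraph.W₄ ∨
        Ψ.SwitchingIsomorphic (GainGraph.IG GainGraph.W₃ GainGraph.unitEntries_W₃) ∨
        Ψ.SwitchingIsomorphic (GainGraph.IG GainGraph.W₂ GainGraph.unitEntries_W₂).ND ∨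
        Ψ.SwitchingIsomorphic (GainGraph.complete 5) ∨
        Ψ.SwitchingIsomorphic GainGraph.K₂₂₂γ ∨
        Ψ.SwitchingIsomorphic GainGraph.W₄.ND ∨
        Ψ.SwitchingIsomorphic (GainGraph.IG GainGraph.W₅ GainGraph.unitEntries_W₅) ∨
        Ψ.SwitchingIsomorphic (GainGraph.IG GainGraph.W₃ GainGraph.unitEntries_W₃).ND ∨
        Ψ.SwitchingIsomorphic (GainGraph.IG GainGraph.W₇ GainGraph.unitEntries_W₇) ∨
        Ψ.SwitchingIsomorphic (GainGraph.IG GainGraph.W₂ GainGraph.unitEntries_W₂).ND.ND ∨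
        ∃ (t : ℕ) (ht : 3 ≤ t) (x : Circle), Ψ.SwitchingIsomorphic (GainGraph.toral t ht x)) ∧
    -- degree, order and multiplicity of the larger eigenvalue of each listed graph
    ((GainGraph.complete 2).HasParameters 1 2 1 ∧
      (GainGraph.complete 3).HasParameters 2 3 1 ∧
      (GainGraph.IG GainGraph.W₂ GainGraph.unitEntries_W₂).HasParameters 2 4 2 ∧
      (GainGraph.complete 4).HasParameters 3 4 1 ∧
      GainGraph.W₄.HasParameters 3 4 2 ∧
      (GainGraph.IG GainGraph.W₃ GainGraph.unitEntries_W₃).HasParameters 3 6 3 ∧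
      (GainGraph.IG GainGraph.W₂ GainGraph.unitEntries_W₂).ND.HasParameters 3 8 4 ∧
      (GainGraph.complete 5).HasParameters 4 5 1 ∧
      GainGraph.K₂₂₂γ.HasParameters 4 6 2 ∧
      GainGraph.W₄.ND.HasParameters 4 8 4 ∧
      (GainGraph.IG GainGraph.W₅ GainGraph.unitEntries_W₅).HasParameters 4 10 5 ∧
      (GainGraph.IG GainGraph.W₃ GainGraph.unitEntries_W₃).ND.HasParameters 4 12 6 ∧
      (GainGraph.IG GainGraph.W₇ GainGraph.unitEntries_W₇).HasParameters 4 14 7 ∧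
      (GainGraph.IG GainGraph.W₂ GainGraph.unitEntries_W₂).ND.ND.HasParameters 4 16 8 ∧
      ∀ (t : ℕ) (ht : 3 ≤ t) (x : Circle), (GainGraph.toral t ht x).HasParameters 4 (2 * t) t) ∧
    -- spectral determination among connected gain graphs
    (GainGraph.DeterminedBySpectrum.{u} (GainGraph.complete 2) ∧
      GainGraph.DeterminedBySpectrum.{u} (GainGraph.complete 3) ∧
      GainGraph.DeterminedBySpectrum.{u} (GainGraph.IG GainGraph.W₂ GainGraph.unitEntries_W₂) ∧
      GainGraph.DeterminedBySpectrum.{u} (GainGraph.complete 4) ∧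
      GainGraph.DeterminedBySpectrum.{u} GainGraph.W₄ ∧
      GainGraph.DeterminedBySpectrum.{u} (GainGraph.IG GainGraph.W₃ GainGraph.unitEntries_W₃) ∧
      GainGraph.DeterminedBySpectrum.{u} (GainGraph.IG GainGraph.W₂ GainGraph.unitEntries_W₂).ND ∧
      GainGraph.DeterminedBySpectrum.{u} (GainGraph.complete 5) ∧
      GainGraph.DeterminedBySpectrum.{u} GainGraph.K₂₂₂γ ∧
      GainGraph.DeterminedBySpectrumUpToToral.{u} GainGraph.W₄.ND 4 (by norm_num) ∧
      GainGraph.DeterminedBySpectrumUpToToral.{u}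
        (GainGraph.IG GainGraph.W₅ GainGraph.unitEntries_W₅) 5 (by norm_num) ∧
      GainGraph.DeterminedBySpectrumUpToToral.{u}
        (GainGraph.IG GainGraph.W₃ GainGraph.unitEntries_W₃).ND 6 (by norm_num) ∧
      GainGraph.DeterminedBySpectrumUpToToral.{u}
        (GainGraph.IG GainGraph.W₇ GainGraph.unitEntries_W₇) 7 (by norm_num) ∧
      GainGraph.DeterminedBySpectrumUpToToral.{u}
        (GainGraph.IG GainGraph.W₂ GainGraph.unitEntries_W₂).ND.ND 8 (by norm_num)) := by
  refine ⟨?_, ⟨?_, ?_, ?_, ?_, ?_, ?_, ?_, ?_, ?_, ?_, ?_, ?_, ?_, ?_, ?_⟩,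
    ⟨?_, ?_, ?_, ?_, ?_, ?_, ?_, ?_, ?_, ?_, ?_, ?_, ?_, ?_⟩⟩
  · intro V _ _ Ψ θ₁ θ₂ hconn hdeg hθ heig hsum
    obtain ⟨k, h1, h2, h⟩ := GainGraph.exists_quadratic Ψ θ₁ θ₂ hconn hdeg hθ heig
    obtain ⟨u⟩ := hconn.nonempty
    interval_cases k
    · exact Or.inl (h.cases_one u)
    · have := h.cases_two hsum u
      tauto
    · have := h.cases_three hsum u
      tauto
    · rcases hsum.eq_or_lt with h0 | h0
      · rw [← h0] at h
        rcases h.cases_four_of_eq_zero u with h | h | h | h | h | ⟨t, ht, x, -, h⟩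
        iterate 5 tauto
        iterate 14 right
        exact ⟨t, ht, x, h⟩
      · have := h.cases_four_of_pos h0 u
        tauto
  · exact GainGraph.hasParameters_complete one_pos
  · exact GainGraph.hasParameters_complete two_pos
  · exact GainGraph.quadratic_W₂.hasParameters_of_zero two_pos (by simp) two_pos
  · exact GainGraph.hasParameters_complete three_pos
  · exact GainGraph.quadratic_W₄.hasParameters_of_zero three_pos (by simp) two_pos
  · exact GainGraph.quadratic_W₃.hasParameters_of_zero three_pos (by simp) three_pos
  · exact (GainGraph.quadratic_ND GainGraph.quadratic_W₂).hasParameters_of_zero three_pos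
      (by simp) four_pos
  · exact GainGraph.hasParameters_complete four_pos
  · exact GainGraph.hasParameters_K₂₂₂γ
  · exact (GainGraph.quadratic_ND GainGraph.quadratic_W₄).hasParameters_of_zero four_pos
      (by simp) four_pos
  · exact GainGraph.quadratic_W₅.hasParameters_of_zero (m := 5) four_pos (by simp) (by norm_num)
  · exact (GainGraph.quadratic_ND GainGraph.quadratic_W₃).hasParameters_of_zero (m := 6) four_pos
      (by simp) (by norm_num)
  · exact GainGraph.quadratic_W₇.hasParameters_of_zero (m := 7) four_pos (by simp) (by norm_num)
  · exact (GainGraph.quadratic_ND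
      (GainGraph.quadratic_ND GainGraph.quadratic_W₂)).hasParameters_of_zero (m := 8) four_pos
      (by simp) (by norm_num)
  · intro t ht x
    exact (GainGraph.quadratic_toral ht x).hasParameters_of_zero four_pos
      (by simp [two_mul]) (by omega)
  · intro U _ _ Φ hconn hchar
    obtain ⟨h, hc⟩ := (GainGraph.quadratic_complete rfl).of_charpoly_eq hconn hchar
    obtain ⟨u⟩ := hconn.nonempty
    exact h.cases_one u
  · intro U _ _ Φ hconn hchar
    obtain ⟨h, hc⟩ := (GainGraph.quadratic_complete rfl).of_charpoly_eq hconn hchar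
    obtain ⟨u⟩ := hconn.nonempty
    rcases h.cases_two (by norm_num) u with ⟨h1, h2⟩ | ⟨h1, h2⟩
    · exact h2
    · simp at hc; omega
  · intro U _ _ Φ hconn hchar
    obtain ⟨h, hc⟩ := GainGraph.quadratic_W₂.of_charpoly_eq hconn hchar
    obtain ⟨u⟩ := hconn.nonempty
    rcases h.cases_two le_rfl u with ⟨h1, h2⟩ | ⟨h1, h2⟩
    · simp at hc; omega
    · exact h2
  · intro U _ _ Φ hconn hchar
    obtain ⟨h, hc⟩ := (GainGraph.quadratic_complete rfl).of_charpoly_eq hconn hchar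
    obtain ⟨u⟩ := hconn.nonempty
    -- Order alone leaves `K₄` and `W₄`; the eigenvalue sum 2 excludes the latter.
    rcases h.cases_three (by norm_num) u with ⟨-, h2⟩ | ⟨⟨-, h1⟩, -⟩ | ⟨h1, -⟩ | ⟨h1, -⟩
    · exact h2
    · norm_num at h1
    all_goals simp at hc; omega
  · intro U _ _ Φ hconn hchar
    obtain ⟨h, hc⟩ := GainGraph.quadratic_W₄.of_charpoly_eq hconn hchar
    obtain ⟨u⟩ := hconn.nonempty
    rcases h.cases_three le_rfl u with ⟨⟨-, h1⟩, -⟩ | ⟨-, h2⟩ | ⟨h1, -⟩ | ⟨h1, -⟩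
    · norm_num at h1
    · exact h2
    all_goals simp at hc; omega
  · intro U _ _ Φ hconn hchar
    obtain ⟨h, hc⟩ := GainGraph.quadratic_W₃.of_charpoly_eq hconn hchar
    obtain ⟨u⟩ := hconn.nonempty
    rcases h.cases_three le_rfl u with ⟨⟨h1, -⟩, -⟩ | ⟨⟨h1, -⟩, -⟩ | ⟨-, h2⟩ | ⟨h1, -⟩
    iterate 2 simp at hc; omega
    · exact h2
    · simp at hc; omega
  · intro U _ _ Φ hconn hchar
    obtain ⟨h, hc⟩ := (GainGraph.quadratic_ND GainGraph.quadratic_W₂).of_charpoly_eq hconn hchar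
    obtain ⟨u⟩ := hconn.nonempty
    rcases h.cases_three le_rfl u with ⟨⟨h1, -⟩, -⟩ | ⟨⟨h1, -⟩, -⟩ | ⟨h1, -⟩ | ⟨-, h2⟩
    iterate 3 simp at hc; omega
    exact h2
  · intro U _ _ Φ hconn hchar
    obtain ⟨h, hc⟩ := (GainGraph.quadratic_complete rfl).of_charpoly_eq hconn hchar
    obtain ⟨u⟩ := hconn.nonempty
    rcases h.cases_four_of_pos (by norm_num) u with ⟨h1, h2⟩ | ⟨h1, h2⟩
    · exact h2
    · simp at hc; omega
  · intro U _ _ Φ hconn hchar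
    obtain ⟨h, hc⟩ := GainGraph.quadratic_K₂₂₂γ.of_charpoly_eq hconn hchar
    obtain ⟨u⟩ := hconn.nonempty
    rcases h.cases_four_of_pos (Real.sqrt_pos.2 two_pos) u with ⟨h1, h2⟩ | ⟨h1, h2⟩
    · simp at hc; omega
    · exact h2
  · intro U _ _ Φ hconn hchar
    obtain ⟨h, hc⟩ :=
      (GainGraph.quadratic_ND GainGraph.quadratic_W₄).of_charpoly_eq hconn hchar
    obtain ⟨u⟩ := hconn.nonempty
    simp at hc
    rcases h.cases_four_of_eq_zero u with
      ⟨-, h2⟩ | ⟨h1, -⟩ | ⟨h1, -⟩ | ⟨h1, -⟩ | ⟨h1, -⟩ | ⟨t, ht, x, h1, h2⟩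
    · exact Or.inl h2
    · omega
    · omega
    · omega
    · omega
    -- A toral graph of this order survives, since degree, order and eigenvalue sum all agree.
    · obtain rfl : t = 4 := by omega
      exact Or.inr ⟨x, h2⟩
  · intro U _ _ Φ hconn hchar
    obtain ⟨h, hc⟩ :=
      GainGraph.quadratic_W₅.of_charpoly_eq hconn hchar
    obtain ⟨u⟩ := hconn.nonempty
    simp at hc
    rcases h.cases_four_of_eq_zero u with
      ⟨h1, -⟩ | ⟨-, h2⟩ | ⟨h1, -⟩ | ⟨h1, -⟩ | ⟨h1, -⟩ | ⟨t, ht, x, h1, h2⟩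
    · omega
    · exact Or.inl h2
    · omega
    · omega
    · omega
    · obtain rfl : t = 5 := by omega
      exact Or.inr ⟨x, h2⟩
  · intro U _ _ Φ hconn hchar
    obtain ⟨h, hc⟩ :=
      (GainGraph.quadratic_ND GainGraph.quadratic_W₃).of_charpoly_eq hconn hchar
    obtain ⟨u⟩ := hconn.nonempty
    simp at hc
    rcases h.cases_four_of_eq_zero u with
      ⟨h1, -⟩ | ⟨h1, -⟩ | ⟨-, h2⟩ | ⟨h1, -⟩ | ⟨h1, -⟩ | ⟨t, ht, x, h1, h2⟩
    · omega
    · omega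
    · exact Or.inl h2
    · omega
    · omega
    · obtain rfl : t = 6 := by omega
      exact Or.inr ⟨x, h2⟩
  · intro U _ _ Φ hconn hchar
    obtain ⟨h, hc⟩ :=
      GainGraph.quadratic_W₇.of_charpoly_eq hconn hchar
    obtain ⟨u⟩ := hconn.nonempty
    simp at hc
    rcases h.cases_four_of_eq_zero u with
      ⟨h1, -⟩ | ⟨h1, -⟩ | ⟨h1, -⟩ | ⟨-, h2⟩ | ⟨h1, -⟩ | ⟨t, ht, x, h1, h2⟩
    · omega
    · omega
    · omega
    · exact Or.inl h2
    · omega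
    · obtain rfl : t = 7 := by omega
      exact Or.inr ⟨x, h2⟩
  · intro U _ _ Φ hconn hchar
    obtain ⟨h, hc⟩ :=
      (GainGraph.quadratic_ND (GainGraph.quadratic_ND GainGraph.quadratic_W₂)).of_charpoly_eq hconn hchar
    obtain ⟨u⟩ := hconn.nonempty
    simp at hc
    rcases h.cases_four_of_eq_zero u with
      ⟨h1, -⟩ | ⟨h1, -⟩ | ⟨h1, -⟩ | ⟨h1, -⟩ | ⟨-, h2⟩ | ⟨t, ht, x, h1, h2⟩
    · omega
    · omega
    · omega
    · omega
    · exact Or.inl h2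
    · obtain rfl : t = 8 := by omega
      exact Or.inr ⟨x, h2⟩
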